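/- Notation. Let $\Gamma=\mathrm{SL}_2(\mathbb Z)$, let $\mathfrak H^{\pm}$ be the upper and lower half-planes, $\rho=e^{\pi i/3}$, and let all complex powers be principal ($\arg\in(-\pi,\pi]$). *Modular forms.* For $r\in\mathbb R$ and $v:\Gamma\to\mathbb C^\ast$, $A_r(v)$ is the space of holomorphic $f:\mathfrak H^+\to\mathbb C$ with $f(\gamma z)=v(\gamma)(cz+d)^r f(z)$ for all $\gamma=\begin{pmatrix}a&b\\c&d\end{pmatrix}\in\Gamma$. The function $v$ is a multiplier system for the weight $r$ if $A_r(v)\ne 0$. $M_r(v)\subset A_r(v)$ is the subspace given by $f(z)=O(1)$ as $\operatorname{Im}z\to\infty$, and $S_r(v)$ the subspace given by $f(z)=O((\operatorname{Im}z)^{-a})$ as $\operatorname{Im} z\to\infty$, for every $a>0$. For $t\in\mathfrak H^-$ put $c_f(z_1,z_2;t)=\int_{z_1}^{z_2}f(z)(z-t)^{r-2}\,dz$, with $z_1,z_2\in\mathfrak H^+$ if $f\in A_r(v)$, and with $z_2=\infty$ also allowed if $f\in S_r(v)$. *Duality.* Let $r>0$. For $f$ on $\mathfrak H^-$ and $h$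 on $\mathfrak H^+$ put $f^-(t)=(i-t)^rf(t)$ and $h^+(z)=(-i-z)^rh(z)$. Let $\mathcal D^\omega_r$ be the space of holomorphic $f$ on $\mathfrak H^-$ for which $f^-$ extends holomorphically to a neighbourhood of $\mathfrak H^-\cup\mathbb P^1_{\mathbb R}$ in $\mathbb P^1_{\mathbb C}$, and let $\mathcal D^\infty_r\supset \mathcal D^\omega_r$ be the space of holomorphic $f$ for which $f^-$ extends to a $C^\infty$ function on $\mathfrak H^-\cup\mathbb P^1_{\mathbb R}$, with the topology given by the suprema over $\mathbb P^1_{\mathbb R}$ of all derivatives of $f^-(-\cot\theta)$ with respect to $\theta$. For $0<c<1$ let $K_c$ be the positively oriented circle $\bigl|\frac{z-i}{z+i}\bigr|=c$ in $\mathfrak H^+$. For holomorphic $h$ on $\mathfrak H^+$ and $f\in\mathcal D^\omega_r$ put $$[h,f]_r=\frac1\pi\int_{K_{c_2}}h^+(z)\,\sigma_rf^-(z)\,\frac{dz}{(z+i)^2},\qquad \sigma_rf^-(z)=\frac1\pi\,\frac{z+i}{z-i}\int_{K_{c_1}}f^-(\tau)\;{}_2F_1\Bigl(1,1;r;\frac{(\tau-i)(z+i)}{(\tau+i)(z-i)}\Bigr)\frac{d\tau}{\tau^2+1},$$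 where $c_1<c_2<1$ and $c_1$ is so close to $1$ that $f^-$ is holomorphic on and outside $K_{c_1}$; the value does not depend on $c_1,c_2$. If $h\in M_r(v)$ for some multiplier system $v$ for the weight $r$, then $[h,\cdot]_r$ is extended by continuity from $\mathcal D_r^\omega$ to $\mathcal D^\infty_r$. Proposition. Let $r_1,r_2,r_3\in\mathbb R$ with $r_1+r_2+r_3=4$, $r_2>0$, $r_3>0$, let $v_j$ be a multiplier system for the weight $r_j$ ($j=1,2,3$) with $v_1v_2v_3=1$, and let $f_1\in A_{r_1}(v_1)$, $f_2\in S_{r_2}(v_2)$, $f_3\in M_{r_3}(v_3)$. Then the product $c_{f_1}(\rho-1,\rho)\,c_{f_2}(i,\infty)$ lies in $\mathcal D^\infty_{r_3}$ and in the closure of $\mathcal D^\omega_{r_3}$, the extension by continuity of $[f_3,\cdot]_{r_3}$ to this product exists, and its value $$\mathcal T(f_1,f_2,f_3)=\bigl[f_3,\;c_{f_1}(\rho-1,\rho)\,c_{f_2}(i,\infty)\bigr]_{r_3}$$ satisfies $$\mathcal T(f_1,f_2,f_3)=\lim_{a\to\infty}\int_{\tau_1=\rho-1}^{\rho}f_1(\tau_1)\int_{\tau_2=i}^{ia}f_2(\tau_2)\,\frac1\pi\int_{z\in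 C_2(a)}f_3(z)\,(-z-i)^{r_3}$$ $$\cdot\frac1\pi\int_{\tau\in C_1(a)}{}_2F_1\Bigl(1,1;r_3;\frac{(\tau-i)(z+i)}{(\tau+i)(z-i)}\Bigr)\Bigl(\frac{\tau_1-\tau}{i-\tau}\Bigr)^{r_1-2}\Bigl(\frac{\tau_2-\tau}{i-\tau}\Bigr)^{r_2-2}\frac{d\tau}{\tau^2+1}\,\frac{dz}{z^2+1}\,d\tau_2\,d\tau_1 .$$ Here, for each $a>1$, $C_1(a)=K_{c_1(a)}$ and $C_2(a)=K_{c_2(a)}$ with any $c_1(a)<c_2(a)<1$, and the integrals over $\tau_1$ and $\tau_2$ are taken along any $C^1$ paths in $\mathfrak H^+$ from $\rho-1$ to $\rho$ and from $i$ to $ia$ that are encircled by $C_1(a)$. -/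

import Mathlib

open Complex Set Filter Topology MeasureTheory
open scoped UpperHalfPlane MatrixGroups Manifold ContDiff

noncomputable section

namespace ModularCup

/-! ### Modular forms of real weight on `SL(2,ℤ)` -/

/-- Holomorphic functions on the upper half-plane with
`f (γ z) = v γ (c z + d) ^ r f z` for all `γ ∈ SL(2,ℤ)`, where `arg (c z + d) ∈ (-π, π]`
(the principal power). No growth condition is imposed: this is the space `A_r(v)`. -/
structure IsAutomorphicForm (r : ℝ) (v : SL(2, ℤ) → ℂˣ) (f : ℍ → ℂ) : Prop where
  holo : MDifferentiable 𝓘(ℂ) 𝓘(ℂ) f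
  transf : ∀ (γ : SL(2, ℤ)) (z : ℍ),
    f (γ • z) = (v γ : ℂ) * (((γ 1 0 : ℤ) : ℂ) * (z : ℂ) + ((γ 1 1 : ℤ) : ℂ)) ^ (r : ℂ) * f z

/-- `v` is a multiplier system for the weight `r`: the transformation law of weight `r` has a
non-zero holomorphic solution. -/
def IsMultiplierSystem (r : ℝ) (v : SL(2, ℤ) → ℂˣ) : Prop :=
  ∃ f : ℍ → ℂ, f ≠ 0 ∧ IsAutomorphicForm r v f

/-- Entire modular forms `M_r(v)`: bounded as `Im z → ∞`. -/
structure IsEntireModularForm (r : ℝ) (v : SL(2, ℤ) → ℂˣ) (f : ℍ → ℂ) : Prop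
    extends IsAutomorphicForm r v f where
  bounded : f =O[UpperHalfPlane.atImInfty] (fun _ => (1 : ℝ))

/-- Cusp forms `S_r(v)`: decaying faster than every power of `Im z` as `Im z → ∞`. -/
structure IsCuspForm (r : ℝ) (v : SL(2, ℤ) → ℂˣ) (f : ℍ → ℂ) : Prop
    extends IsAutomorphicForm r v f where
  decay : ∀ a : ℝ, f =O[UpperHalfPlane.atImInfty] (fun z => z.im ^ (-a))

/-! ### Eichler integrals -/

/-- The lower half-plane. -/
abbrev LowerHalf : Type := {t : ℂ // t.im < 0}

/-- Eichler kernel applied to `f`, i.e. `f(z) (z - t)^(r-2)`. For `z` in the upper and `t` in the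
lower half-plane `z - t` lies in the upper half-plane, so the power is the principal one. -/
def eichlerIntegrand (r : ℝ) (f : ℍ → ℂ) (t : ℂ) (z : ℂ) : ℂ :=
  f (UpperHalfPlane.ofComplex z) * (z - t) ^ ((r : ℂ) - 2)

/-- `c_f(z₁, z₂; t) = ∫_{z₁}^{z₂} f(z) (z - t)^(r-2) dz` for `z₁, z₂` in the upper half-plane
(the integrand is holomorphic there; we integrate along the segment). -/
def eichler (r : ℝ) (f : ℍ → ℂ) (z₁ z₂ : ℂ) (t : LowerHalf) : ℂ :=
  ∫ s in (0 : ℝ)..1, eichlerIntegrand r f t (z₁ + s * (z₂ - z₁)) * (z₂ - z₁)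

/-- `c_f(i, ∞; t)`, the integral along the imaginary half-axis from `i` upwards. -/
def eichlerToCusp (r : ℝ) (f : ℍ → ℂ) (t : LowerHalf) : ℂ :=
  ∫ y in Ioi (1 : ℝ), eichlerIntegrand r f t (y * I) * I

/-- `ρ = exp (π i / 3)`. -/
def rho : ℂ := exp (Real.pi * I / 3)

/-- The product `c_{f₁}(ρ - 1, ρ) · c_{f₂}(i, ∞)` on the lower half-plane. -/
def cupProduct (r₁ r₂ : ℝ) (f₁ f₂ : ℍ → ℂ) (t : LowerHalf) : ℂ :=
  eichler r₁ f₁ (rho - 1) rho t * eichlerToCusp r₂ f₂ t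

/-! ### Analytic and smooth vectors

The coordinate `u = (t + i)/(t - i)` identifies the complement of the point `i` in the Riemann
sphere with `ℂ`. It sends the lower half-plane to `|u| < 1`, and `ℝ ∪ {∞}` to `|u| = 1`. It is the
inverse of the disk coordinate `w = (t - i)/(t + i)`. -/

/-- The coordinate `u = (t + i)/(t - i)`. -/
def uCoord (t : ℂ) : ℂ := (t + I) / (t - I)

/-- `F`, read in the coordinate `u`, extends `f⁻(t) = (i - t)^r f(t)`. -/
def ExtendsMinus (r : ℝ) (f : LowerHalf → ℂ) (F : ℂ → ℂ) : Prop :=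
  ∀ t : LowerHalf, F (uCoord t) = (I - (t : ℂ)) ^ (r : ℂ) * f t

/-- `F` is an extension of `f⁻`, in the coordinate `u`, that is holomorphic on `|u| < R`
for some `R > 1`, hence on a neighbourhood of the closed lower half-plane with `∞` included. -/
def IsAnalyticExtension (r : ℝ) (f : LowerHalf → ℂ) (R : ℝ) (F : ℂ → ℂ) : Prop :=
  1 < R ∧ DifferentiableOn ℂ F (Metric.ball 0 R) ∧ ExtendsMinus r f F

/-- `F` is an extension of `f⁻`, in the coordinate `u`, that is holomorphic on the lower
half-plane and `C^∞` up to its boundary `ℝ ∪ {∞}`. -/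
def IsSmoothExtension (r : ℝ) (f : LowerHalf → ℂ) (F : ℂ → ℂ) : Prop :=
  DifferentiableOn ℂ F (Metric.ball 0 1) ∧ ContDiffOn ℝ ∞ F (Metric.closedBall 0 1) ∧
    ExtendsMinus r f F

/-- The space `D^ω` of weight `r`, as a condition on functions on the lower half-plane. -/
def IsAnalyticVector (r : ℝ) (f : LowerHalf → ℂ) : Prop :=
  ∃ R F, IsAnalyticExtension r f R F

/-- The space `D^∞` of weight `r`, as a condition on functions on the lower half-plane. -/
def IsSmoothVector (r : ℝ) (f : LowerHalf → ℂ) : Prop :=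
  ∃ F, IsSmoothExtension r f F

/-- The space `D^∞` of weight `r`. -/
structure SmoothVector (r : ℝ) where
  toFun : LowerHalf → ℂ
  smooth : IsSmoothVector r toFun

/-- The boundary function `θ ↦ f⁻(-cot θ)`. The point `t = -cot θ` of `ℝ ∪ {∞}`
has `u = exp(-2iθ)`. The chosen extension is unique on `|u| ≤ 1`. -/
def SmoothVector.boundary {r : ℝ} (φ : SmoothVector r) (θ : ℝ) : ℂ :=
  Classical.choose φ.smooth (exp (-2 * θ * I))

/-- The natural topology on `D^∞`: that of the supremum norms of all derivatives with respect
to `θ` of the boundary function, i.e. uniform convergence of each of these derivatives. -/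
instance (r : ℝ) : TopologicalSpace (SmoothVector r) :=
  TopologicalSpace.induced
    (fun (φ : SmoothVector r) (k : ℕ) => UniformFun.ofFun (iteratedDeriv k φ.boundary))
    inferInstance

/-! ### Duality -/

/-- `∮ G(z) dz` over the positively oriented circle `|(z - i)/(z + i)| = c`, for `0 < c < 1`. -/
def diskCircleIntegral (c : ℝ) (G : ℂ → ℂ) : ℂ :=
  ∮ z in C(((1 + c ^ 2) / (1 - c ^ 2) : ℝ) * I, 2 * c / (1 - c ^ 2)), G z

/-- The circle used in `diskCircleIntegral` is `|(z - i)/(z + i)| = c`. -/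
theorem mem_diskCircle_iff {c : ℝ} (hc0 : 0 < c) (hc1 : c < 1) (z : ℂ) :
    z ∈ Metric.sphere ((((1 + c ^ 2) / (1 - c ^ 2) : ℝ) : ℂ) * I) (2 * c / (1 - c ^ 2)) ↔
      ‖(z - I) / (z + I)‖ = c := by
  have h1 : 0 < 1 - c ^ 2 := by nlinarith
  have hr : 0 ≤ 2 * c / (1 - c ^ 2) := by positivity
  have key : z ∈ Metric.sphere ((((1 + c ^ 2) / (1 - c ^ 2) : ℝ) : ℂ) * I)
      (2 * c / (1 - c ^ 2)) ↔
      z.re ^ 2 + (z.im - 1) ^ 2 = c ^ 2 * (z.re ^ 2 + (z.im + 1) ^ 2) := by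
    rw [mem_sphere_iff_norm, ← sq_eq_sq₀ (norm_nonneg _) hr, ← Complex.normSq_eq_norm_sq,
      Complex.normSq_apply]
    simp only [sub_re, mul_re, ofReal_re, I_re, mul_zero, ofReal_im, I_im, mul_one, sub_self,
      sub_zero, sub_im, mul_im, add_zero]
    constructor
    · intro h
      field_simp at h
      have h2 : (1 - c ^ 2) * (z.re ^ 2 + (z.im - 1) ^ 2) =
          (1 - c ^ 2) * (c ^ 2 * (z.re ^ 2 + (z.im + 1) ^ 2)) := by nlinarith
      exact mul_left_cancel₀ h1.ne' h2
    · intro h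
      field_simp
      have h2 : (1 - c ^ 2) * (z.re ^ 2 + (z.im - 1) ^ 2) =
          (1 - c ^ 2) * (c ^ 2 * (z.re ^ 2 + (z.im + 1) ^ 2)) := by rw [h]
      nlinarith
  rw [key]
  have e1 : ‖z - I‖ ^ 2 = z.re ^ 2 + (z.im - 1) ^ 2 := by
    rw [← Complex.normSq_eq_norm_sq, Complex.normSq_apply]; simp; ring
  have e2 : ‖z + I‖ ^ 2 = z.re ^ 2 + (z.im + 1) ^ 2 := by
    rw [← Complex.normSq_eq_norm_sq, Complex.normSq_apply]; simp; ring
  rw [← e1, ← e2, norm_div]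
  rcases eq_or_ne (z + I) 0 with h0 | h0
  · have hz : z = -I := by linear_combination h0
    subst hz
    have hn : ‖(-I - I : ℂ)‖ ^ 2 = 4 := by
      rw [← Complex.normSq_eq_norm_sq, Complex.normSq_apply]; simp; norm_num
    rw [hn]
    simp [hc0.ne]
  · have hp : 0 < ‖z + I‖ := norm_pos_iff.mpr h0
    rw [div_eq_iff hp.ne', ← mul_pow, sq_eq_sq₀ (norm_nonneg _) (by positivity)]

/-- The lift `σ_r f⁻` at `z`, integrating over the circle `|(τ - i)/(τ + i)| = c`; here `F` is an
extension of `f⁻` in the coordinate `u`, so `f⁻(τ) = F((τ + i)/(τ - i))`. -/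
def sigmaLift (r : ℝ) (F : ℂ → ℂ) (c : ℝ) (z : ℂ) : ℂ :=
  1 / Real.pi * ((z + I) / (z - I)) *
    diskCircleIntegral c (fun τ =>
      F (uCoord τ) * ₂F₁ (1 : ℂ) 1 (r : ℂ) (((τ - I) * (z + I)) / ((τ + I) * (z - I))) /
        (τ ^ 2 + 1))

/-- `(1/π) ∮ h⁺(z) σ_r f⁻(z) dz/(z + i)²` with `h⁺(z) = (-i - z)^r h(z)`, where `z` runs over the
circle of radius `c₂` in the disk coordinate and `σ_r f⁻` is computed with the circle of
radius `c₁`. For `z` in the upper half-plane `-i - z` lies in the lower half-plane, so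
the power is the principal one. -/
def dualityIntegral (r : ℝ) (h : ℍ → ℂ) (F : ℂ → ℂ) (c₁ c₂ : ℝ) : ℂ :=
  1 / Real.pi * diskCircleIntegral c₂ (fun z =>
    ((-I - z) ^ (r : ℂ) * h (UpperHalfPlane.ofComplex z)) * sigmaLift r F c₁ z / (z + I) ^ 2)

/-- The bilinear form `[h, f]_r` for `f` in `D^ω`: the common value of the duality integrals for
all holomorphic extensions `F` of `f⁻` and all circles, with `|(τ - i)/(τ + i)| = c₁` inside
the domain of `f⁻` and inside `|(z - i)/(z + i)| = c₂`. -/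
def dualityAnalytic (r : ℝ) (h : ℍ → ℂ) (f : LowerHalf → ℂ) : ℂ :=
  Classical.epsilon fun L : ℂ =>
    ∀ (R : ℝ) (F : ℂ → ℂ), IsAnalyticExtension r f R F →
      ∀ c₁ c₂ : ℝ, R⁻¹ < c₁ → c₁ < c₂ → c₂ < 1 → dualityIntegral r h F c₁ c₂ = L

/-- The analytic vectors inside `D^∞`. -/
def analyticVectors (r : ℝ) : Set (SmoothVector r) := {φ | IsAnalyticVector r φ.toFun}

/-- The bilinear form `[h, f]_r` for `f` in `D^∞`: extension by continuity of the form on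
`D^ω`, for the natural topology of `D^∞`. -/
def duality (r : ℝ) (h : ℍ → ℂ) : SmoothVector r → ℂ :=
  extendFrom (analyticVectors r) (fun φ => dualityAnalytic r h φ.toFun)

open Classical in
/-- The trilinear form `T(f₁, f₂, f₃) = [f₃, c_{f₁}(ρ - 1, ρ) c_{f₂}(i, ∞)]_{r₃}`. -/
def trilinear (r₁ r₂ r₃ : ℝ) (f₁ f₂ f₃ : ℍ → ℂ) : ℂ :=
  if hs : IsSmoothVector r₃ (cupProduct r₁ r₂ f₁ f₂) then duality r₃ f₃ ⟨_, hs⟩ else 0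

/-! ### The fourfold integral -/

/-- `∫ G(z) dz` along the path `γ : [0,1] → ℂ`. -/
def pathIntegral (γ : ℝ → ℂ) (G : ℂ → ℂ) : ℂ :=
  ∫ s in (0 : ℝ)..1, G (γ s) * deriv γ s

/-- `γ` is a `C¹` path from `z₁` to `z₂` in the upper half-plane that is encircled by
`|(z - i)/(z + i)| = c`. -/
def IsEncircledPath (c : ℝ) (z₁ z₂ : ℂ) (γ : ℝ → ℂ) : Prop :=
  ContDiff ℝ 1 γ ∧ γ 0 = z₁ ∧ γ 1 = z₂ ∧
    ∀ s ∈ Icc (0 : ℝ) 1, 0 < (γ s).im ∧ ‖(γ s - I) / (γ s + I)‖ < c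

/-- The modified Eichler kernel `((τ' - τ)/(i - τ))^(r - 2)`. The principal power is holomorphic
in `τ` on the Riemann sphere minus the segment from `τ'` to `i`, and equals `1` at `τ = ∞`. -/
def modKernel (r : ℝ) (τ' τ : ℂ) : ℂ := ((τ' - τ) / (I - τ)) ^ ((r : ℂ) - 2)

/-- The fourfold integral, with `τ₁` on `γ₁`, `τ₂` on `γ₂`, `z` on `|(z - i)/(z + i)| = c₂` and
`τ` on `|(τ - i)/(τ + i)| = c₁`. -/
def fourfold (r₁ r₂ r₃ : ℝ) (f₁ f₂ f₃ : ℍ → ℂ) (γ₁ γ₂ : ℝ → ℂ) (c₁ c₂ : ℝ) : ℂ :=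
  pathIntegral γ₁ fun τ₁ => f₁ (UpperHalfPlane.ofComplex τ₁) *
    pathIntegral γ₂ fun τ₂ => f₂ (UpperHalfPlane.ofComplex τ₂) *
      (1 / Real.pi * diskCircleIntegral c₂ fun z =>
        f₃ (UpperHalfPlane.ofComplex z) * (-z - I) ^ (r₃ : ℂ) *
          (1 / Real.pi * diskCircleIntegral c₁ fun τ =>
            ₂F₁ (1 : ℂ) 1 (r₃ : ℂ) (((τ - I) * (z + I)) / ((τ + I) * (z - I))) *
              modKernel r₁ τ₁ τ * modKernel r₂ τ₂ τ / (τ ^ 2 + 1)) / (z ^ 2 + 1))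

end ModularCup

end

noncomputable section

namespace ModularCup

/-! Everything is read in the disk coordinate `w = (z - i)/(z + i)`, with `u = w⁻¹` on the side of
the lower half-plane. There `₂F₁(1,1;r;·)` has argument `w'/w`, and expanding it on `|w'| = c₁ < |w|
= c₂` turns the double contour integral into `∑ n!/(r)_n · a_n · b_n` (`hasSum_dualityIntegral`),
where `a_n` is the coefficient of `u ^ n` in `f⁻` and `b_n` the Taylor coefficient of `h⁺`. By
Cauchy's theorem neither depends on the radius, and at radius `1` the `a_n` are the Fourier
coefficients of `θ ↦ f⁻(-cot θ)`.

The series extends to smooth vectors. For an entire modular form of weight `r > 0` the function `|f|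
y^(r/2)` is `SL(2,ℤ)`-invariant, so `h⁺` grows at most like a power of `(1 - |w|)⁻¹` and `b_n` grows
polynomially (`exists_norm_bCoef_le`). Fourier coefficients of smooth functions decay rapidly,
uniformly near a given vector. Hence `coefPairing` is continuous on all of `D^∞`, and on the closure
of `D^ω` it is the extension by continuity (`duality_eq_coefPairing`).

The condition `r₁ + r₂ + r₃ = 4` lets `(i - t)^r₃` be shared between the two Eichler integrals, each
of which becomes an integral of `((τ - t)/(i - t))^(r_j - 2)`. For `τ` with disk coordinate `w` this
base is `(1 - wu)/(1 - w)`, so compact paths give functions holomorphic beyond `|u| = 1`, and the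
path up to the cusp gives a function smooth on `|u| ≤ 1`, thanks to the decay of the cusp form.
Replacing `∞` by `ia` therefore gives analytic vectors, and these converge in `D^∞` to the full
product (`tendsto_truncatedCup`).

It remains to see that the fourfold integral is the pairing with the truncated product
(`fourfold_eq_coefPairing`). The pairing is a contour integral against one fixed continuous kernel
(`exists_kernel`), so Fubini moves the path integrals inside, and path independence replaces them by
integrals over the standard segments. Continuity of the pairing then gives the limit. -/

/-! ### The disk coordinate -/

/-- The inverse `w ↦ i (1 + w)/(1 - w)` of the disk coordinate `z ↦ (z - i)/(z + i)`. -/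
def mob (w : ℂ) : ℂ := I * (1 + w) / (1 - w)

theorem one_sub_ne_zero_of_norm_lt {w : ℂ} (hw : ‖w‖ < 1) : 1 - w ≠ 0 := by
  intro h
  have : w = 1 := by linear_combination -h
  simp [this] at hw

theorem mob_add_I {w : ℂ} (hw : 1 - w ≠ 0) : mob w + I = 2 * I / (1 - w) := by
  rw [mob]; field_simp; ring

theorem mob_sub_I {w : ℂ} (hw : 1 - w ≠ 0) : mob w - I = 2 * I * w / (1 - w) := by
  rw [mob]; field_simp; ring

theorem mob_add_I_ne_zero {w : ℂ} (hw : 1 - w ≠ 0) : mob w + I ≠ 0 := by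
  rw [mob_add_I hw]; simp [hw]

theorem disk_mob {w : ℂ} (hw : 1 - w ≠ 0) : (mob w - I) / (mob w + I) = w := by
  rw [mob_add_I hw, mob_sub_I hw]; field_simp

theorem mob_disk {z : ℂ} (hz : z + I ≠ 0) : mob ((z - I) / (z + I)) = z := by
  have h2 : (1 - (z - I) / (z + I)) = 2 * I / (z + I) := by field_simp; ring
  have h1 : (1 + (z - I) / (z + I)) = 2 * z / (z + I) := by field_simp; ring
  rw [mob, h1, h2]; field_simp

theorem hasDerivAt_mob {w : ℂ} (hw : 1 - w ≠ 0) :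
    HasDerivAt mob (2 * I / (1 - w) ^ 2) w := by
  have h1 : HasDerivAt (fun w : ℂ => I * (1 + w)) (I * 1) w :=
    ((hasDerivAt_id w).const_add 1).const_mul I
  have h2 : HasDerivAt (fun w : ℂ => 1 - w) (-1) w := (hasDerivAt_id w).const_sub 1
  refine (h1.div h2 hw).congr_deriv ?_
  congr 1; ring

theorem mob_im (w : ℂ) : (mob w).im = (1 - ‖w‖ ^ 2) / ‖1 - w‖ ^ 2 := by
  rw [← Complex.normSq_eq_norm_sq, ← Complex.normSq_eq_norm_sq, mob, Complex.div_im,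
    div_sub_div_same]
  congr 1
  simp [Complex.normSq_apply]
  ring

theorem mob_im_pos {w : ℂ} (hw : ‖w‖ < 1) : 0 < (mob w).im := by
  rw [mob_im]
  have h1 : 0 < 1 - ‖w‖ ^ 2 := by nlinarith [norm_nonneg w]
  have := norm_pos_iff.2 (one_sub_ne_zero_of_norm_lt hw)
  positivity

theorem add_I_ne_zero_of_im_pos {z : ℂ} (hz : 0 < z.im) : z + I ≠ 0 := by
  intro h
  have := congrArg Complex.im h
  simp at this
  linarith

theorem norm_disk_lt_one {z : ℂ} (hz : 0 < z.im) : ‖(z - I) / (z + I)‖ < 1 := by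
  have h0 := norm_pos_iff.2 (add_I_ne_zero_of_im_pos hz)
  rw [norm_div, div_lt_one h0]
  apply lt_of_pow_lt_pow_left₀ 2 h0.le
  rw [← Complex.normSq_eq_norm_sq, ← Complex.normSq_eq_norm_sq]
  simp [Complex.normSq_apply]
  nlinarith

/-- The disk `|(z - i)/(z + i)| < c` as a Euclidean disk. -/
def hypBall (c : ℝ) : Set ℂ :=
  Metric.ball ((((1 + c ^ 2) / (1 - c ^ 2) : ℝ) : ℂ) * I) (2 * c / (1 - c ^ 2))

theorem mem_hypBall_iff {c : ℝ} (hc0 : 0 < c) (hc1 : c < 1) {z : ℂ} (hz : z + I ≠ 0) :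
    z ∈ hypBall c ↔ ‖(z - I) / (z + I)‖ < c := by
  have h1 : 0 < 1 - c ^ 2 := by nlinarith
  have hr : 0 ≤ 2 * c / (1 - c ^ 2) := by positivity
  have hp : 0 < ‖z + I‖ := norm_pos_iff.mpr hz
  rw [hypBall, mem_ball_iff_norm, ← sq_lt_sq₀ (norm_nonneg _) hr, norm_div, div_lt_iff₀ hp,
    ← sq_lt_sq₀ (norm_nonneg _) (by positivity), mul_pow]
  simp only [← Complex.normSq_eq_norm_sq, Complex.normSq_apply]
  simp only [sub_re, add_re, add_im, mul_re, ofReal_re, I_re, mul_zero, ofReal_im, I_im, mul_one,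
    sub_self, sub_zero, sub_im, mul_im, add_zero]
  have e : z.re * z.re + (z.im - (1 + c ^ 2) / (1 - c ^ 2)) * (z.im - (1 + c ^ 2) / (1 - c ^ 2)) -
      (2 * c / (1 - c ^ 2)) ^ 2 = (z.re * z.re + (z.im - 1) * (z.im - 1) -
        c ^ 2 * (z.re * z.re + (z.im + 1) * (z.im + 1))) / (1 - c ^ 2) := by
    field_simp; ring
  rw [← sub_neg, e, div_neg_iff, ← sub_neg (b := c ^ 2 * _)]
  constructor
  · rintro (⟨_, h⟩ | ⟨h, _⟩)
    · linarith
    · exact h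
  · intro h; exact Or.inr ⟨h, h1⟩

theorem im_pos_of_mem_hypBall {c : ℝ} (hc0 : 0 < c) (hc1 : c < 1) {z : ℂ} (hz : z ∈ hypBall c) :
    0 < z.im := by
  have h1 : 0 < 1 - c ^ 2 := by nlinarith
  rw [hypBall, mem_ball_iff_norm] at hz
  have := (Complex.abs_im_le_norm _).trans_lt hz
  rw [abs_lt] at this
  have h3 := this.1
  simp only [sub_im, mul_im, ofReal_re, I_im, mul_one, ofReal_im, I_re, mul_zero, add_zero] at h3
  have h4 : (1 + c ^ 2) / (1 - c ^ 2) - 2 * c / (1 - c ^ 2) = (1 - c) ^ 2 / (1 - c ^ 2) := by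
    field_simp; ring
  have h5 : 0 < (1 - c) ^ 2 / (1 - c ^ 2) := by
    have : 0 < 1 - c := by linarith
    positivity
  linarith

/-! ### Circles in the disk coordinate -/

/-- The argument in the disk coordinate of the point with argument `φ` on `|(z - i)/(z + i)| = c`,
seen from the Euclidean centre. -/
def diskAngle (c φ : ℝ) : ℝ := φ - Real.pi / 2 - 2 * (log (1 - I * c * exp (φ * I))).im

theorem one_sub_mem_slitPlane {w : ℂ} (hw : ‖w‖ < 1) : 1 - w ∈ slitPlane := by
  left
  simp only [sub_re, one_re, sub_pos]
  exact (re_le_norm w).trans_lt hw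

theorem norm_diskAngle_aux {c : ℝ} (hc0 : 0 < c) (φ : ℝ) : ‖I * c * exp (φ * I)‖ = c := by
  rw [norm_mul, norm_mul, norm_exp_ofReal_mul_I]; simp [hc0.le]

theorem hasDerivAt_diskAngle {c : ℝ} (hc0 : 0 < c) (hc1 : c < 1) (φ : ℝ) :
    HasDerivAt (diskAngle c)
      (1 - 2 * (c * exp (φ * I) / (1 - I * c * exp (φ * I))).im) φ := by
  have h1 : HasDerivAt (fun φ : ℝ => exp ((φ : ℂ) * I)) (exp (φ * I) * (1 * I)) φ :=
    (((hasDerivAt_id φ).ofReal_comp).mul_const I).cexp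
  have h2 := ((h1.const_mul (I * c)).const_sub 1).clog_real
    (one_sub_mem_slitPlane (by rw [norm_diskAngle_aux hc0]; exact hc1))
  have h3 : HasDerivAt (fun φ : ℝ => (log (1 - I * c * exp (φ * I))).im) _ φ :=
    (imCLM.hasFDerivAt.comp_hasDerivAt φ h2)
  have h4 := ((hasDerivAt_id φ).sub_const (Real.pi / 2)).sub (h3.const_mul 2)
  refine h4.congr_deriv ?_
  have e : -(I * c * (exp (φ * I) * (1 * I))) = c * exp (φ * I) := by
    linear_combination (-(c * exp (φ * I))) * I_sq
  rw [e, imCLM_apply]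

/-- With `b = 1 - i c e^{iφ}`, the right-hand side is `-i e^{iφ}` times `conj b / b = exp (-2 i Im
log b)`. Since `Re b > 0`, the principal logarithm provides a smooth choice of angle. -/
theorem exp_diskAngle {c : ℝ} (hc0 : 0 < c) (hc1 : c < 1) (φ : ℝ) :
    exp (diskAngle c φ * I) =
      -I * exp (φ * I) * (1 + I * c * exp (-(φ * I))) / (1 - I * c * exp (φ * I)) := by
  set b : ℂ := 1 - I * c * exp (φ * I) with hb
  have hb0 : b ≠ 0 := one_sub_ne_zero_of_norm_lt (by rw [norm_diskAngle_aux hc0]; exact hc1)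
  have hconj : (1 + I * c * exp (-(φ * I))) = (starRingEnd ℂ) b := by
    rw [hb]; simp [← exp_conj]
  rw [hconj]
  have h1 : exp (-2 * ((log b).im : ℂ) * I) = (starRingEnd ℂ) b / b := by
    have h2 : -2 * ((log b).im : ℂ) * I = (starRingEnd ℂ) (log b) - log b := by
      apply Complex.ext <;> simp; ring
    rw [h2, exp_sub, exp_log hb0, exp_conj, exp_log hb0]
  have h3 : (diskAngle c φ : ℂ) * I =
      φ * I + (-(Real.pi / 2 * I) + -2 * ((log b).im : ℂ) * I) := by
    rw [diskAngle]; push_cast; ring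
  have h4 : exp (-(Real.pi / 2 * I)) = -I := by
    rw [exp_neg, exp_pi_div_two_mul_I, inv_I]
  rw [h3, exp_add, exp_add, h1, h4]
  ring

theorem circleMap_eq_mob {c : ℝ} (hc0 : 0 < c) (hc1 : c < 1) (φ : ℝ) :
    circleMap ((((1 + c ^ 2) / (1 - c ^ 2) : ℝ) : ℂ) * I) (2 * c / (1 - c ^ 2)) φ =
      mob (circleMap 0 c (diskAngle c φ)) := by
  have hw : ‖circleMap 0 c (diskAngle c φ)‖ < 1 := by simp [abs_of_pos hc0, hc1]
  have h1 := one_sub_ne_zero_of_norm_lt hw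
  have hb0 : 1 - I * c * exp (φ * I) ≠ 0 :=
    one_sub_ne_zero_of_norm_lt (by rw [norm_diskAngle_aux hc0]; exact hc1)
  have hc : (1 - (c : ℂ) ^ 2) ≠ 0 := by
    have : (1 - c ^ 2 : ℝ) ≠ 0 := by nlinarith
    exact_mod_cast this
  rw [mob, eq_div_iff h1]
  simp only [circleMap, zero_add]
  rw [exp_diskAngle hc0 hc1, exp_neg]
  have he := exp_ne_zero ((φ : ℂ) * I)
  push_cast
  generalize exp ((φ : ℂ) * I) = e at *
  generalize hb : 1 - I * (c : ℂ) * e = b at *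
  have e1 : 1 - (c : ℂ) * (-I * e * (1 + I * c * e⁻¹) / b) = (1 - (c : ℂ) ^ 2) / b := by
    field_simp
    rw [← hb]
    linear_combination (c : ℂ) ^ 2 * I_sq
  have e2 : I * (1 + (c : ℂ) * (-I * e * (1 + I * c * e⁻¹) / b)) =
      (I * (1 + (c : ℂ) ^ 2) + 2 * c * e) / b := by
    field_simp
    rw [← hb]
    linear_combination (-2 * (c : ℂ) * e - I * (c : ℂ) ^ 2) * I_sq
  rw [e1, e2]
  field_simp

/-- A change of variables from the Euclidean angle to the angle in the disk coordinate. No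
holomorphy of `G` is involved, so this applies before anything is known beyond continuity on the
circle. -/
theorem diskCircleIntegral_eq {c : ℝ} (hc0 : 0 < c) (hc1 : c < 1) {G : ℂ → ℂ}
    (hG : ContinuousOn (fun w => G (mob w)) (Metric.sphere 0 c)) :
    diskCircleIntegral c G = ∮ w in C(0, c), 2 * I / (1 - w) ^ 2 * G (mob w) := by
  have hne : ∀ t : ℝ, 1 - circleMap 0 c t ≠ 0 := fun t =>
    one_sub_ne_zero_of_norm_lt (by simp [abs_of_pos hc0, hc1])
  set g : ℝ → ℂ := fun t => deriv (circleMap 0 c) t •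
    (2 * I / (1 - circleMap 0 c t) ^ 2 * G (mob (circleMap 0 c t))) with hg
  have hgc : Continuous g := by
    have h1 : Continuous fun t => G (mob (circleMap 0 c t)) :=
      hG.comp_continuous (continuous_circleMap 0 c) (fun t => circleMap_mem_sphere 0 hc0.le t)
    have h2 := continuous_circleMap 0 c
    simp only [hg, deriv_circleMap, smul_eq_mul]
    exact (h2.mul continuous_const).mul
      ((continuous_const.div ((continuous_const.sub h2).pow 2) fun t => pow_ne_zero 2 (hne t)).mul h1)
  have hper : Function.Periodic g (2 * Real.pi) := by
    intro t
    simp only [hg, deriv_circleMap, periodic_circleMap 0 c t]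
  set θ' : ℝ → ℝ := fun φ => 1 - 2 * (c * exp (φ * I) / (1 - I * c * exp (φ * I))).im with hθ'
  have hθ'c : Continuous θ' := by
    refine continuous_const.sub (continuous_const.mul (continuous_im.comp ?_))
    refine Continuous.div (by fun_prop) (by fun_prop) fun φ => ?_
    exact one_sub_ne_zero_of_norm_lt (by rw [norm_diskAngle_aux hc0]; exact hc1)
  have hd : ∀ φ, HasDerivAt (diskAngle c) (θ' φ) φ := hasDerivAt_diskAngle hc0 hc1
  -- The logarithmic correction is `2π`-periodic, so the new angle makes exactly one positive turn.
  have hend : diskAngle c (2 * Real.pi) = diskAngle c 0 + 2 * Real.pi := by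
    simp only [diskAngle]
    push_cast
    rw [exp_two_pi_mul_I]
    simp; ring
  have key := intervalIntegral.integral_deriv_smul_comp (a := 0) (b := 2 * Real.pi) (g := g)
    (fun x _ => hd x) hθ'c.continuousOn hgc
  rw [hend, hper.intervalIntegral_add_eq (diskAngle c 0) 0, zero_add] at key
  rw [diskCircleIntegral, circleIntegral, circleIntegral, ← key]
  refine intervalIntegral.integral_congr fun φ _ => ?_
  simp only [Function.comp, hg]
  have hz := circleMap_eq_mob hc0 hc1 φ
  have hder : deriv (circleMap ((((1 + c ^ 2) / (1 - c ^ 2) : ℝ) : ℂ) * I)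
      (2 * c / (1 - c ^ 2))) φ =
      2 * I / (1 - circleMap 0 c (diskAngle c φ)) ^ 2 *
        (θ' φ • deriv (circleMap 0 c) (diskAngle c φ)) := by
    have e : circleMap ((((1 + c ^ 2) / (1 - c ^ 2) : ℝ) : ℂ) * I) (2 * c / (1 - c ^ 2)) =
        fun φ => mob (circleMap 0 c (diskAngle c φ)) := funext (circleMap_eq_mob hc0 hc1)
    rw [e]
    have h1 : HasDerivAt (fun φ => circleMap 0 c (diskAngle c φ))
        (θ' φ • deriv (circleMap 0 c) (diskAngle c φ)) φ :=
      ((differentiable_circleMap 0 c _).hasDerivAt).scomp φ (hd φ)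
    exact ((hasDerivAt_mob (hne _)).comp_of_eq φ h1 rfl).deriv
  rw [hder, hz]
  simp only [smul_eq_mul, real_smul]
  ring

/-! ### Series of circle integrals -/

theorem hasSum_circleIntegral {R : ℝ} (hR : 0 ≤ R) {f : ℕ → ℂ → ℂ} {g : ℂ → ℂ} {M : ℕ → ℝ}
    (hf : ∀ n, ContinuousOn (f n) (Metric.sphere 0 R)) (hM : Summable M)
    (hfM : ∀ n, ∀ w ∈ Metric.sphere (0 : ℂ) R, ‖f n w‖ ≤ M n)
    (hfg : ∀ w ∈ Metric.sphere (0 : ℂ) R, HasSum (fun n => f n w) (g w)) :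
    HasSum (fun n => ∮ w in C(0, R), f n w) (∮ w in C(0, R), g w) := by
  have hmem : ∀ t, circleMap 0 R t ∈ Metric.sphere (0 : ℂ) R := circleMap_mem_sphere 0 hR
  refine intervalIntegral.hasSum_integral_of_dominated_convergence (fun n _ => R * M n) ?_ ?_ ?_ ?_ ?_
  · intro n
    have h1 : Continuous fun t => f n (circleMap 0 R t) :=
      (hf n).comp_continuous (continuous_circleMap 0 R) hmem
    have h2 : Continuous fun t => deriv (circleMap 0 R) t := by
      simp only [deriv_circleMap]
      exact (continuous_circleMap 0 R).mul continuous_const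
    exact (h2.smul h1).aestronglyMeasurable
  · intro n
    refine ae_of_all _ fun t _ => ?_
    rw [norm_smul, deriv_circleMap, norm_mul, norm_I, mul_one, norm_circleMap_zero, abs_of_nonneg hR]
    exact mul_le_mul_of_nonneg_left (hfM n _ (hmem t)) hR
  · exact ae_of_all _ fun t _ => hM.mul_left R
  · exact intervalIntegrable_const
  · exact ae_of_all _ fun t _ => (hfg _ (hmem t)).const_smul _

/-! ### The hypergeometric series `₂F₁(1,1;r;x)` -/

/-- The coefficient `n!/(r)_n` of `₂F₁(1,1;r;x)`. -/
def hypCoef (r : ℝ) (n : ℕ) : ℝ := n.factorial / (ascPochhammer ℝ n).eval r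

theorem hypCoef_nonneg {r : ℝ} (hr : 0 < r) (n : ℕ) : 0 ≤ hypCoef r n :=
  div_nonneg (by positivity) (ascPochhammer_pos n r hr).le

/-- The ratio of consecutive coefficients is `(n + 1)/(r + n)`, and `1 + n/r = (r + n)/r` cancels
its denominator. Linear growth is all that the later estimates need, for large and small `r` alike.
-/
theorem hypCoef_le {r : ℝ} (hr : 0 < r) (n : ℕ) : hypCoef r n ≤ 1 + n / r := by
  induction n with
  | zero => simp [hypCoef]
  | succ n ih =>
    have h1 : hypCoef r (n + 1) = hypCoef r n * ((n + 1) / (r + n)) := by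
      have := (ascPochhammer_pos n r hr).ne'
      have : r + n ≠ 0 := by positivity
      rw [hypCoef, hypCoef, ascPochhammer_succ_eval, Nat.factorial_succ]
      push_cast
      field_simp
    rw [h1]
    calc hypCoef r n * ((n + 1) / (r + n)) ≤ (1 + n / r) * ((n + 1) / (r + n)) := by gcongr
      _ = (n + 1) / r := by field_simp
      _ ≤ 1 + ((n + 1 : ℕ) : ℝ) / r := by push_cast; linarith

theorem summable_hypCoef_mul_pow {r : ℝ} (hr : 0 < r) {x : ℝ} (hx0 : 0 ≤ x) (hx : x < 1) :
    Summable fun n => hypCoef r n * x ^ n := by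
  have h1 : Summable fun n : ℕ => x ^ n := summable_geometric_of_lt_one hx0 hx
  have h2 : Summable fun n : ℕ => (n : ℝ) * x ^ n := by
    simpa using summable_pow_mul_geometric_of_norm_lt_one (R := ℝ) 1
      (r := x) (by rwa [Real.norm_of_nonneg hx0])
  refine Summable.of_nonneg_of_le (fun n => mul_nonneg (hypCoef_nonneg hr n) (by positivity))
    (fun n => ?_) (h1.add (h2.mul_left (1 / r)))
  calc hypCoef r n * x ^ n ≤ (1 + n / r) * x ^ n := by gcongr; exact hypCoef_le hr n
    _ = x ^ n + 1 / r * (n * x ^ n) := by ring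

theorem hypergeometricSeries_radius {r : ℝ} (hr : 0 < r) :
    (ordinaryHypergeometricSeries ℂ (1 : ℂ) 1 (r : ℂ)).radius = 1 := by
  refine ordinaryHypergeometricSeries_radius_eq_one ℂ _ _ _ fun n => ?_
  refine ⟨fun h => ?_, fun h => ?_, fun h => ?_⟩
  · have := congrArg re h; simp at this; linarith [(Nat.cast_nonneg n : (0 : ℝ) ≤ n)]
  · have := congrArg re h; simp at this; linarith [(Nat.cast_nonneg n : (0 : ℝ) ≤ n)]
  · have := congrArg re h; simp at this; linarith [(Nat.cast_nonneg n : (0 : ℝ) ≤ n)]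

theorem continuousOn_hypergeometric {r : ℝ} (hr : 0 < r) :
    ContinuousOn (fun x : ℂ => ₂F₁ (1 : ℂ) 1 (r : ℂ) x) (Metric.ball 0 1) := by
  have h := (ordinaryHypergeometricSeries ℂ (1 : ℂ) 1 (r : ℂ)).hasFPowerSeriesOnBall
    (by rw [hypergeometricSeries_radius hr]; exact one_pos)
  rw [hypergeometricSeries_radius hr] at h
  have h2 := h.continuousOn
  rwa [← ENNReal.ofReal_one, Metric.eball_ofReal] at h2

/-- Since `(1)_n = n!`, one of the two upper parameters cancels the factorial in the denominator. -/
theorem hasSum_hypergeometric {r : ℝ} (hr : 0 < r) {x : ℂ} (hx : ‖x‖ < 1) :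
    HasSum (fun n => (hypCoef r n : ℂ) * x ^ n) (₂F₁ (1 : ℂ) 1 (r : ℂ) x) := by
  have hx' : x ∈ Metric.eball (0 : ℂ) (ordinaryHypergeometricSeries ℂ (1 : ℂ) 1 (r : ℂ)).radius := by
    rw [hypergeometricSeries_radius hr, ← ENNReal.ofReal_one, Metric.eball_ofReal]
    simpa using hx
  have h := (ordinaryHypergeometricSeries ℂ (1 : ℂ) 1 (r : ℂ)).hasSum hx'
  refine (congrArg (fun f => HasSum f _) (funext fun n => ?_)).mpr h
  rw [ordinaryHypergeometricSeries_apply_eq, smul_eq_mul]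
  congr 1
  have h1 : (ascPochhammer ℂ n).eval (1 : ℂ) = n.factorial := by
    rw [ascPochhammer_eval_one]
  have h2 : (ascPochhammer ℂ n).eval (r : ℂ) = ((ascPochhammer ℝ n).eval r : ℝ) := by
    rw [← ascPochhammer_map (algebraMap ℝ ℂ)]
    exact Polynomial.eval_map_algebraMap _ _ |>.trans (Polynomial.aeval_algebraMap_apply_eq_algebraMap_eval r _)
  rw [h1, h2, hypCoef]
  have : (n.factorial : ℂ) ≠ 0 := by exact_mod_cast n.factorial_ne_zero
  push_cast
  field_simp

/-! ### The duality integral as a series -/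

/-- The coefficient of `u ^ n`, `u = w⁻¹`, computed on `|w| = c`. -/
def aCoef (F : ℂ → ℂ) (c : ℝ) (n : ℕ) : ℂ :=
  (2 * Real.pi * I)⁻¹ * ∮ w in C(0, c), F w⁻¹ * w ^ n * w⁻¹

/-- The coefficient of `w ^ n`, computed on `|w| = c`. -/
def bCoef (H : ℂ → ℂ) (c : ℝ) (n : ℕ) : ℂ :=
  (2 * Real.pi * I)⁻¹ * ∮ w in C(0, c), H w * (w ^ (n + 1))⁻¹

/-- The function `h⁺` in the disk coordinate. -/
def diskPlus (r : ℝ) (h : ℍ → ℂ) (w : ℂ) : ℂ :=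
  (-I - mob w) ^ (r : ℂ) * h (UpperHalfPlane.ofComplex (mob w))

theorem ne_zero_of_mem_sphere {c : ℝ} (hc : 0 < c) {w : ℂ} (hw : w ∈ Metric.sphere (0 : ℂ) c) :
    w ≠ 0 := by
  rintro rfl
  simp at hw
  exact hc.ne hw

theorem norm_two_pi_I_inv_mul_circleIntegral_le {c M : ℝ} (hc : 0 < c) {f : ℂ → ℂ}
    (hf : ∀ w ∈ Metric.sphere (0 : ℂ) c, ‖f w‖ ≤ M) :
    ‖(2 * Real.pi * I : ℂ)⁻¹ * ∮ w in C(0, c), f w‖ ≤ c * M := by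
  simpa using circleIntegral.norm_two_pi_i_inv_smul_integral_le_of_norm_le_const hc.le hf

theorem norm_aCoef_le {F : ℂ → ℂ} {c M : ℝ} (hc : 0 < c)
    (hF : ∀ w ∈ Metric.sphere (0 : ℂ) c, ‖F w⁻¹‖ ≤ M) (n : ℕ) : ‖aCoef F c n‖ ≤ M * c ^ n := by
  have h := norm_two_pi_I_inv_mul_circleIntegral_le (M := M * c ^ n * c⁻¹) hc
    (f := fun w => F w⁻¹ * w ^ n * w⁻¹) (fun w hw => by
      rw [norm_mul, norm_mul, norm_pow, norm_inv, mem_sphere_zero_iff_norm.1 hw]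
      gcongr
      exact hF w hw)
  refine h.trans_eq ?_
  field_simp

theorem uCoord_mob {w : ℂ} (hw : 1 - w ≠ 0) : uCoord (mob w) = w⁻¹ := by
  rw [uCoord, mob_add_I hw, mob_sub_I hw]
  rcases eq_or_ne w 0 with rfl | h
  · simp
  · field_simp

theorem cross_ratio_mob {w w' : ℂ} (hw : 1 - w ≠ 0) (hw' : 1 - w' ≠ 0) :
    ((mob w' - I) * (mob w + I)) / ((mob w' + I) * (mob w - I)) = w' / w := by
  rw [mul_div_mul_comm, disk_mob hw', ← inv_div (mob w - I), disk_mob hw, div_eq_mul_inv]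

theorem continuousOn_mob : ContinuousOn mob {w | 1 - w ≠ 0} := fun _ hw =>
  (hasDerivAt_mob hw).continuousAt.continuousWithinAt

theorem sphere_subset_one_sub_ne_zero {c : ℝ} (hc1 : c < 1) :
    Metric.sphere (0 : ℂ) c ⊆ {w | 1 - w ≠ 0} := fun w hw =>
  one_sub_ne_zero_of_norm_lt (by rwa [mem_sphere_zero_iff_norm.1 hw])

/-- From `dτ = 2i dw'/(1 - w')²` and `τ² + 1 = -4w'/(1 - w')²` the measure `dτ/(τ² + 1)` becomes
`(-i/2) dw'/w'`. The factor `1/π` then completes it to the Cauchy normalisation `1/(2πi)`. -/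
theorem sigmaLift_mob_eq {r : ℝ} (hr : 0 < r) {F : ℂ → ℂ} {c₁ : ℝ} (hc0 : 0 < c₁)
    (hc1 : c₁ < 1) (hF : ContinuousOn (fun w => F w⁻¹) (Metric.sphere 0 c₁)) {w : ℂ}
    (hw : c₁ < ‖w‖) (hw1 : 1 - w ≠ 0) :
    sigmaLift r F c₁ (mob w) = w⁻¹ * ((2 * Real.pi * I)⁻¹ *
      ∮ w' in C(0, c₁), F w'⁻¹ * ₂F₁ (1 : ℂ) 1 (r : ℂ) (w' / w) * w'⁻¹) := by
  have hw0 : w ≠ 0 := by rintro rfl; simp at hw; linarith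
  have hne := sphere_subset_one_sub_ne_zero hc1
  have hint : EqOn (fun w' => (fun τ => F (uCoord τ) * ₂F₁ (1 : ℂ) 1 (r : ℂ)
      (((τ - I) * (mob w + I)) / ((τ + I) * (mob w - I))) / (τ ^ 2 + 1)) (mob w'))
      (fun w' => F w'⁻¹ * ₂F₁ (1 : ℂ) 1 (r : ℂ) (w' / w) * (-((1 - w') ^ 2) / 4 * w'⁻¹))
      (Metric.sphere 0 c₁) := by
    intro w' hw'
    have h1 := hne hw'
    have h0 := ne_zero_of_mem_sphere hc0 hw'
    simp only [Set.mem_ofPred_eq] at h1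
    have e : mob w' ^ 2 + 1 = -4 * w' / (1 - w') ^ 2 := by
      have : mob w' ^ 2 + 1 = (mob w' - I) * (mob w' + I) := by
        linear_combination I_sq
      rw [this, mob_add_I h1, mob_sub_I h1, div_mul_div_comm, sq]
      congr 1
      linear_combination 4 * w' * I_sq
    simp only
    rw [uCoord_mob h1, cross_ratio_mob hw1 h1, e]
    field_simp
  have hcont : ContinuousOn (fun w' => F w'⁻¹ * ₂F₁ (1 : ℂ) 1 (r : ℂ) (w' / w) *
      (-((1 - w') ^ 2) / 4 * w'⁻¹)) (Metric.sphere 0 c₁) := by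
    refine (hF.mul ?_).mul ?_
    · refine (continuousOn_hypergeometric hr).comp (by fun_prop) fun w' hw' => ?_
      rw [mem_ball_zero_iff, norm_div, mem_sphere_zero_iff_norm.1 hw']
      rwa [div_lt_one (hc0.trans hw)]
    · refine ContinuousOn.mul (by fun_prop) ?_
      exact continuousOn_id.inv₀ fun w' hw' => ne_zero_of_mem_sphere hc0 hw'
  rw [sigmaLift, diskCircleIntegral_eq hc0 hc1 (hcont.congr hint),
    ← inv_div (mob w - I), disk_mob hw1]
  have h2 : (∮ w' in C(0, c₁), 2 * I / (1 - w') ^ 2 * (fun τ => F (uCoord τ) *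
      ₂F₁ (1 : ℂ) 1 (r : ℂ) (((τ - I) * (mob w + I)) / ((τ + I) * (mob w - I))) /
        (τ ^ 2 + 1)) (mob w')) =
      ∮ w' in C(0, c₁), (-I / 2) * (F w'⁻¹ * ₂F₁ (1 : ℂ) 1 (r : ℂ) (w' / w) * w'⁻¹) := by
    refine circleIntegral.integral_congr hc0.le fun w' hw' => ?_
    have h1 := hne hw'
    simp only [Set.mem_ofPred_eq] at h1
    have := hint hw'
    simp only at this ⊢
    rw [this]
    field_simp
    ring
  rw [h2, circleIntegral.integral_const_mul]
  have hpi : (Real.pi : ℂ) ≠ 0 := by exact_mod_cast Real.pi_ne_zero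
  generalize (∮ w' in C(0, c₁), F w'⁻¹ * ₂F₁ (1 : ℂ) 1 (r : ℂ) (w' / w) * w'⁻¹) = x
  field_simp
  linear_combination (-x) * I_sq

theorem hasSum_sigmaLift {r : ℝ} (hr : 0 < r) {F : ℂ → ℂ} {c₁ : ℝ} (hc0 : 0 < c₁)
    (hc1 : c₁ < 1) (hF : ContinuousOn (fun w => F w⁻¹) (Metric.sphere 0 c₁)) {w : ℂ}
    (hw : c₁ < ‖w‖) (hw1 : 1 - w ≠ 0) :
    HasSum (fun n => hypCoef r n * aCoef F c₁ n * (w ^ (n + 1))⁻¹) (sigmaLift r F c₁ (mob w)) := by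
  have hw0 : w ≠ 0 := by rintro rfl; simp at hw; linarith
  rw [sigmaLift_mob_eq hr hc0 hc1 hF hw hw1]
  obtain ⟨M, hM⟩ := (isCompact_sphere (0 : ℂ) c₁).exists_bound_of_continuousOn hF
  have hx : c₁ / ‖w‖ < 1 := by rwa [div_lt_one (hc0.trans hw)]
  have key := hasSum_circleIntegral hc0.le
    (f := fun n w' => F w'⁻¹ * (hypCoef r n * (w' / w) ^ n) * w'⁻¹)
    (g := fun w' => F w'⁻¹ * ₂F₁ (1 : ℂ) 1 (r : ℂ) (w' / w) * w'⁻¹)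
    (M := fun n => M * (hypCoef r n * (c₁ / ‖w‖) ^ n) * c₁⁻¹)
    (fun n => (hF.mul (by fun_prop)).mul
      (continuousOn_id.inv₀ fun w' hw' => ne_zero_of_mem_sphere hc0 hw'))
    (((summable_hypCoef_mul_pow hr (by positivity) hx).mul_left M).mul_right _)
    (fun n w' hw' => by
      rw [norm_mul, norm_mul, norm_mul, norm_pow, norm_div, norm_inv,
        mem_sphere_zero_iff_norm.1 hw', norm_real, Real.norm_of_nonneg (hypCoef_nonneg hr n)]
      have := hypCoef_nonneg hr n
      gcongr
      exact hM w' hw')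
    (fun w' hw' => by
      refine ((hasSum_hypergeometric hr ?_).mul_left _).mul_right _
      rwa [norm_div, mem_sphere_zero_iff_norm.1 hw'])
  refine (congrArg (fun f => HasSum f _) (funext fun n => ?_)).mpr
    ((key.mul_left (2 * Real.pi * I : ℂ)⁻¹).mul_left w⁻¹)
  rw [aCoef]
  have : (∮ w' in C(0, c₁), F w'⁻¹ * (hypCoef r n * (w' / w) ^ n) * w'⁻¹) =
      ∮ w' in C(0, c₁), (hypCoef r n * (w ^ n)⁻¹) * (F w'⁻¹ * w' ^ n * w'⁻¹) := by
    refine circleIntegral.integral_congr hc0.le fun w' hw' => ?_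
    simp only [div_pow]
    ring
  rw [this, circleIntegral.integral_const_mul, pow_succ]
  field_simp

/-- Here `dz/(z + i)²` becomes `(-i/2) dw`, again giving `1/(2πi)`. Termwise integration is
justified by the factor `(c₁/c₂)^n`. Only continuity on the two circles enters, so the lemma also
applies to the kernels inside the fourfold integral. -/
theorem hasSum_dualityIntegral {r : ℝ} (hr : 0 < r) {F : ℂ → ℂ} {h : ℍ → ℂ} {c₁ c₂ : ℝ}
    (hc0 : 0 < c₁) (hc12 : c₁ < c₂) (hc2 : c₂ < 1)
    (hF : ContinuousOn (fun w => F w⁻¹) (Metric.sphere 0 c₁))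
    (hh : ContinuousOn (diskPlus r h) (Metric.sphere 0 c₂)) :
    HasSum (fun n => hypCoef r n * aCoef F c₁ n * bCoef (diskPlus r h) c₂ n)
      (dualityIntegral r h F c₁ c₂) := by
  have hc1 := hc12.trans hc2
  have hc20 := hc0.trans hc12
  have hne := sphere_subset_one_sub_ne_zero hc2
  obtain ⟨M, hM⟩ := (isCompact_sphere (0 : ℂ) c₁).exists_bound_of_continuousOn hF
  obtain ⟨N, hN⟩ := (isCompact_sphere (0 : ℂ) c₂).exists_bound_of_continuousOn hh
  have hM0 : 0 ≤ M := (norm_nonneg _).trans (hM (c₁ : ℂ) (by simp [hc0.le]))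
  have hx : c₁ / c₂ < 1 := by rwa [div_lt_one hc20]
  have hsum := summable_hypCoef_mul_pow hr (x := c₁ / c₂) (by positivity) hx
  have hsig : ∀ w ∈ Metric.sphere (0 : ℂ) c₂, HasSum (fun n => hypCoef r n * aCoef F c₁ n *
      (w ^ (n + 1))⁻¹) (sigmaLift r F c₁ (mob w)) := fun w hw =>
    hasSum_sigmaLift hr hc0 hc1 hF (by rwa [mem_sphere_zero_iff_norm.1 hw]) (hne hw)
  have hterm : ∀ n, ∀ w ∈ Metric.sphere (0 : ℂ) c₂, ‖hypCoef r n * aCoef F c₁ n *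
      (w ^ (n + 1))⁻¹‖ ≤ M * c₂⁻¹ * (hypCoef r n * (c₁ / c₂) ^ n) := by
    intro n w hw
    rw [norm_mul, norm_mul, norm_inv, norm_pow, mem_sphere_zero_iff_norm.1 hw, norm_real,
      Real.norm_of_nonneg (hypCoef_nonneg hr n)]
    have := hypCoef_nonneg hr n
    calc _ ≤ hypCoef r n * (M * c₁ ^ n) * (c₂ ^ (n + 1))⁻¹ := by
          gcongr; exact norm_aCoef_le hc0 hM n
      _ = _ := by rw [div_pow]; field_simp; ring
  have hcts : ∀ n, ContinuousOn (fun w : ℂ => hypCoef r n * aCoef F c₁ n *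
      (w ^ (n + 1))⁻¹) (Metric.sphere 0 c₂) := fun n =>
    continuousOn_const.mul ((continuousOn_id.pow _).inv₀ fun w hw =>
      pow_ne_zero _ (ne_zero_of_mem_sphere hc20 hw))
  -- Continuity of the lift comes from uniform convergence of its series; it is what the change of
  -- coordinates of the outer integral requires.
  have hsc : ContinuousOn (fun w => sigmaLift r F c₁ (mob w)) (Metric.sphere 0 c₂) :=
    (continuousOn_tsum hcts (hsum.mul_left _) hterm).congr fun w hw => (hsig w hw).tsum_eq.symm
  rw [dualityIntegral, diskCircleIntegral_eq hc20 hc2]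
  swap
  · refine (hh.mul hsc).div ?_ fun w hw => pow_ne_zero 2 (mob_add_I_ne_zero (hne hw))
    exact ((continuousOn_mob.mono hne).add continuousOn_const).pow 2
  have h2 : (∮ w in C(0, c₂), 2 * I / (1 - w) ^ 2 *
      ((-I - mob w) ^ (r : ℂ) * h (UpperHalfPlane.ofComplex (mob w)) * sigmaLift r F c₁ (mob w) /
        (mob w + I) ^ 2)) =
      ∮ w in C(0, c₂), (-I / 2) * (diskPlus r h w * sigmaLift r F c₁ (mob w)) := by
    refine circleIntegral.integral_congr hc20.le fun w hw => ?_
    have h1 := hne hw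
    simp only [Set.mem_ofPred_eq] at h1
    have hI : (2 * I / (1 - w)) ^ 2 = -4 / (1 - w) ^ 2 := by
      rw [div_pow]; congr 1; linear_combination 4 * I_sq
    simp only [diskPlus]
    rw [mob_add_I h1, hI]
    field_simp
    ring
  have key := hasSum_circleIntegral hc20.le
    (f := fun n w => diskPlus r h w * (hypCoef r n * aCoef F c₁ n * (w ^ (n + 1))⁻¹))
    (g := fun w => diskPlus r h w * sigmaLift r F c₁ (mob w))
    (fun n => hh.mul (hcts n)) ((hsum.mul_left (M * c₂⁻¹)).mul_left N)
    (fun n w hw => by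
      rw [norm_mul]
      exact mul_le_mul (hN w hw) (hterm n w hw) (norm_nonneg _) ((norm_nonneg _).trans (hN w hw)))
    (fun w hw => (hsig w hw).mul_left _)
  rw [h2, circleIntegral.integral_const_mul]
  have hpi : (Real.pi : ℂ) ≠ 0 := by exact_mod_cast Real.pi_ne_zero
  have e : ∀ x : ℂ, 1 / (Real.pi : ℂ) * (-I / 2 * x) = (2 * Real.pi * I : ℂ)⁻¹ * x := by
    intro x
    field_simp
    linear_combination (-x) * I_sq
  rw [e]
  refine (congrArg (fun f => HasSum f _) (funext fun n => ?_)).mpr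
    (key.mul_left (2 * Real.pi * I : ℂ)⁻¹)
  rw [bCoef]
  have : (∮ w in C(0, c₂), diskPlus r h w * (hypCoef r n * aCoef F c₁ n * (w ^ (n + 1))⁻¹)) =
      ∮ w in C(0, c₂), (hypCoef r n * aCoef F c₁ n) * (diskPlus r h w * (w ^ (n + 1))⁻¹) := by
    refine circleIntegral.integral_congr hc20.le fun w' hw' => ?_
    ring
  rw [this, circleIntegral.integral_const_mul]
  ring

/-! ### Independence of the radii -/

/-- Cauchy's theorem on an annulus: `w ↦ F w⁻¹` is holomorphic on the whole exterior `|w| > R⁻¹`.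
There is no upper limit on `c'`, so the radius can be moved out to `1`. -/
theorem aCoef_eq_of_differentiableOn {F : ℂ → ℂ} {R c c' : ℝ} (hR : 0 < R)
    (hF : DifferentiableOn ℂ F (Metric.ball 0 R)) (hc : R⁻¹ < c) (hcc : c ≤ c') (n : ℕ) :
    aCoef F c' n = aCoef F c n := by
  have hc0 : 0 < c := (inv_pos.2 hR).trans hc
  rw [aCoef, aCoef]
  congr 1
  have hd : ∀ w : ℂ, c ≤ ‖w‖ → DifferentiableAt ℂ (fun w => F w⁻¹ * w ^ n * w⁻¹) w := by
    intro w hw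
    have hw0 : w ≠ 0 := by rintro rfl; simp at hw; linarith
    have h1 : DifferentiableAt ℂ F w⁻¹ := by
      refine hF.differentiableAt (Metric.isOpen_ball.mem_nhds ?_)
      rw [mem_ball_zero_iff, norm_inv]
      exact inv_lt_of_inv_lt₀ hR (hc.trans_le hw)
    have h2 : DifferentiableAt ℂ (fun w : ℂ => w⁻¹) w := differentiableAt_inv hw0
    exact ((h1.comp w h2).mul (by fun_prop)).mul h2
  refine circleIntegral_eq_of_differentiable_on_annulus_off_countable hc0 hcc countable_empty ?_ ?_
  · intro w hw
    exact (hd w (by simpa using hw.2)).continuousAt.continuousWithinAt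
  · intro w hw
    have := hw.1.2
    simp at this
    exact hd w this.le

theorem bCoef_eq_of_differentiableOn {H : ℂ → ℂ}
    (hH : DifferentiableOn ℂ H (Metric.ball 0 1)) {c c' : ℝ} (hc : 0 < c) (hcc : c ≤ c')
    (hc' : c' < 1) (n : ℕ) : bCoef H c' n = bCoef H c n := by
  rw [bCoef, bCoef]
  congr 1
  have hd : ∀ w : ℂ, c ≤ ‖w‖ → ‖w‖ ≤ c' →
      DifferentiableAt ℂ (fun w => H w * (w ^ (n + 1))⁻¹) w := by
    intro w hw hw'
    have hw0 : w ≠ 0 := by rintro rfl; simp at hw; linarith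
    have h1 : DifferentiableAt ℂ H w := by
      refine hH.differentiableAt (Metric.isOpen_ball.mem_nhds ?_)
      rw [mem_ball_zero_iff]; linarith
    exact h1.mul ((differentiableAt_id.pow _).inv (pow_ne_zero _ hw0))
  refine circleIntegral_eq_of_differentiable_on_annulus_off_countable hc hcc countable_empty ?_ ?_
  · intro w hw
    exact (hd w (by simpa using hw.2) (by simpa using hw.1)).continuousAt.continuousWithinAt
  · intro w hw
    have h1 := hw.1.1
    have h2 := hw.1.2
    simp at h1 h2
    exact hd w h2.le h1.le

/-! ### Growth of entire modular forms -/

theorem IsAutomorphicForm.norm_smul {r : ℝ} {v : SL(2, ℤ) → ℂˣ} {f : ℍ → ℂ}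
    (hf : IsAutomorphicForm r v f) (γ : SL(2, ℤ)) (z : ℍ) :
    ‖f (γ • z)‖ = ‖(v γ : ℂ)‖ * ‖UpperHalfPlane.denom γ z‖ ^ r * ‖f z‖ := by
  rw [hf.transf, norm_mul, norm_mul, norm_cpow_real, ModularGroup.denom_apply]

/-- In absolute value the automorphy factor is an honest cocycle, so `γ ↦ |v γ|` is a homomorphism
into the positive reals as soon as `f` has a non-zero value. Such a homomorphism is trivial on
elements of finite order, and these generate `SL(2,ℤ)`. -/
theorem IsAutomorphicForm.norm_multiplier {r : ℝ} {v : SL(2, ℤ) → ℂˣ} {f : ℍ → ℂ}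
    (hf : IsAutomorphicForm r v f) (hf0 : f ≠ 0) (γ : SL(2, ℤ)) : ‖(v γ : ℂ)‖ = 1 := by
  obtain ⟨z, hz⟩ := Function.ne_iff.1 hf0
  simp only [Pi.zero_apply] at hz
  have hmul : ∀ γ δ, ‖(v (γ * δ) : ℂ)‖ = ‖(v γ : ℂ)‖ * ‖(v δ : ℂ)‖ := by
    intro γ δ
    have h1 := hf.norm_smul (γ * δ) z
    rw [mul_smul, hf.norm_smul γ, hf.norm_smul δ] at h1
    have h2 : UpperHalfPlane.denom ((γ * δ : SL(2, ℤ)) : GL (Fin 2) ℝ) z =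
        UpperHalfPlane.denom γ (δ • z : ℍ) * UpperHalfPlane.denom δ z := by
      rw [map_mul, map_mul, UpperHalfPlane.denom_cocycle _ _ z.im_ne_zero,
        ModularGroup.sl_moeb, UpperHalfPlane.coe_smul_of_det_pos]
      simp
    rw [h2, norm_mul, Real.mul_rpow (norm_nonneg _) (norm_nonneg _)] at h1
    have p1 : 0 < ‖UpperHalfPlane.denom γ (δ • z : ℍ)‖ ^ r :=
      Real.rpow_pos_of_pos (norm_pos_iff.2 (UpperHalfPlane.denom_ne_zero _ _)) _
    have p2 : 0 < ‖UpperHalfPlane.denom δ z‖ ^ r :=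
      Real.rpow_pos_of_pos (norm_pos_iff.2 (UpperHalfPlane.denom_ne_zero _ _)) _
    have p3 : 0 < ‖f z‖ := norm_pos_iff.2 hz
    have p4 := mul_pos (mul_pos p1 p2) p3
    apply mul_right_cancel₀ p4.ne'
    linear_combination -h1
  have hone : ‖(v 1 : ℂ)‖ = 1 := by
    have h := hmul 1 1
    rw [one_mul] at h
    have h0 : ‖(v 1 : ℂ)‖ ≠ 0 := norm_ne_zero_iff.2 (v 1).ne_zero
    exact mul_left_cancel₀ h0 (by rw [← h, mul_one])
  let χ : SL(2, ℤ) →* ℝ := ⟨⟨fun γ => ‖(v γ : ℂ)‖, hone⟩, hmul⟩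
  have htors : ∀ g : SL(2, ℤ), ∀ n : ℕ, n ≠ 0 → g ^ n = 1 → χ g = 1 := by
    intro g n hn h
    have h1 : χ g ^ n = 1 := by rw [← map_pow, h, map_one]
    exact (pow_eq_one_iff_of_nonneg (norm_nonneg (v g : ℂ)) hn).1 h1
  -- `S ^ 4 = 1` and `(S T) ^ 6 = 1`; the value at `T` follows by division.
  have hS : χ ModularGroup.S = 1 := htors _ 4 (by norm_num) (by decide)
  have hST : χ (ModularGroup.S * ModularGroup.T) = 1 := htors _ 6 (by norm_num) (by decide)
  have hT : χ ModularGroup.T = 1 := by rwa [map_mul, hS, one_mul] at hST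
  have hmem : γ ∈ Subgroup.closure {ModularGroup.S, ModularGroup.T} := by
    rw [SpecialLinearGroup.SL2Z_generators]; trivial
  have : χ γ = 1 := by
    induction hmem using Subgroup.closure_induction with
    | mem x hx => rcases hx with rfl | rfl <;> assumption
    | one => exact map_one χ
    | mul x y _ _ hx hy => rw [map_mul, hx, hy, one_mul]
    | inv x _ hx =>
      have h1 : χ (x⁻¹ * x) = 1 := by rw [inv_mul_cancel, map_one]
      rwa [map_mul, hx, mul_one] at h1
  exact this

/-- The function `|f| y^(r/2)` is invariant because the multipliers are unimodular, and it is
`O(y^(r/2))` at the cusp. Reduction to the fundamental domain makes this a global bound. -/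
theorem IsEntireModularForm.exists_norm_le {r : ℝ} (hr : 0 < r) {v : SL(2, ℤ) → ℂˣ} {f : ℍ → ℂ}
    (hf : IsEntireModularForm r v f) :
    ∃ C, 0 ≤ C ∧ ∀ z : ℍ, ‖f z‖ * z.im ^ (r / 2) ≤ C * max z.im (1 / z.im) ^ (r / 2) := by
  rcases eq_or_ne f 0 with rfl | hf0
  · exact ⟨0, le_rfl, fun z => by simp⟩
  have hv := hf.toIsAutomorphicForm.norm_multiplier hf0
  obtain ⟨C, hC⟩ := ModularGroup.exists_bound_of_invariant_of_isBigO (t := r / 2)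
    (f := fun z : ℍ => ‖f z‖ * z.im ^ (r / 2))
    (hf.holo.continuous.norm.mul
      (UpperHalfPlane.continuous_im.rpow_const fun z => .inl z.im_ne_zero))
    (by positivity)
    (by simpa using hf.bounded.norm_left.mul (Asymptotics.isBigO_refl _ _))
    (fun g z => by
      have hd : 0 < ‖UpperHalfPlane.denom g z‖ :=
        norm_pos_iff.2 (UpperHalfPlane.denom_ne_zero _ _)
      rw [hf.toIsAutomorphicForm.norm_smul, hv, one_mul, ModularGroup.im_smul_eq_div_normSq,
        Complex.normSq_eq_norm_sq, Real.div_rpow z.im_pos.le (by positivity),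
        ← Real.rpow_natCast, ← Real.rpow_mul hd.le]
      have : ((2 : ℕ) : ℝ) * (r / 2) = r := by push_cast; ring
      rw [this]
      have := (Real.rpow_pos_of_pos hd r).ne'
      field_simp)
  refine ⟨max C 0, le_max_right _ _, fun z => ?_⟩
  have h := hC z
  rw [Real.norm_of_nonneg (mul_nonneg (norm_nonneg _) (Real.rpow_nonneg z.im_pos.le _))] at h
  refine h.trans ?_
  have hz := z.im_pos
  gcongr
  exact le_max_left _ _

theorem neg_I_sub_mob_mem_slitPlane {w : ℂ} (hw : ‖w‖ < 1) : -I - mob w ∈ slitPlane := by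
  right
  have := mob_im_pos hw
  simp only [sub_im, neg_im, I_im]
  linarith

theorem differentiableOn_diskPlus {r : ℝ} {h : ℍ → ℂ} (hh : MDifferentiable 𝓘(ℂ) 𝓘(ℂ) h) :
    DifferentiableOn ℂ (diskPlus r h) (Metric.ball 0 1) := by
  have h1 := UpperHalfPlane.mdifferentiable_iff.1 hh
  have hm : DifferentiableOn ℂ mob (Metric.ball 0 1) := fun w hw =>
    (hasDerivAt_mob (one_sub_ne_zero_of_norm_lt
      (mem_ball_zero_iff.1 hw))).differentiableAt.differentiableWithinAt
  refine DifferentiableOn.mul ?_ (h1.comp hm fun w hw => mob_im_pos (mem_ball_zero_iff.1 hw))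
  exact ((differentiableOn_const _).sub hm).cpow (differentiableOn_const _)
    fun w hw => neg_I_sub_mob_mem_slitPlane (mem_ball_zero_iff.1 hw)

/-- With `d = 1 - |w|`, the height satisfies `y ≥ d/4`, so `max y (1/y) ≤ (4/d)² y` and `|f| ≤ C
(4/d)^r`. The other factor is at most `(2/d)^r`, because `|z + i| = 2/|1 - w|`. Together they give
`C 8^r d^(-2r)`. -/
theorem IsEntireModularForm.exists_norm_diskPlus_le {r : ℝ} (hr : 0 < r) {v : SL(2, ℤ) → ℂˣ}
    {f : ℍ → ℂ} (hf : IsEntireModularForm r v f) :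
    ∃ (C : ℝ) (N : ℕ), 0 ≤ C ∧ ∀ w : ℂ, ‖w‖ < 1 →
      ‖diskPlus r f w‖ ≤ C * (1 - ‖w‖)⁻¹ ^ N := by
  obtain ⟨C, hC0, hC⟩ := hf.exists_norm_le hr
  refine ⟨C * 8 ^ r, ⌈2 * r⌉₊, by positivity, fun w hw => ?_⟩
  set d := 1 - ‖w‖ with hd
  have hd0 : 0 < d := by linarith
  have hd1 : d ≤ 1 := by linarith [norm_nonneg w]
  have hy := mob_im_pos hw
  set y := (mob w).im with hydef
  have hle : d ≤ ‖1 - w‖ := by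
    have := norm_sub_norm_le (1 : ℂ) w
    rwa [norm_one] at this
  have hle2 : ‖1 - w‖ ≤ 2 := by
    have := norm_sub_le (1 : ℂ) w
    rw [norm_one] at this
    linarith
  have hyd : d / 4 ≤ y := by
    rw [hydef, mob_im]
    have h0 : 0 < ‖1 - w‖ := hd0.trans_le hle
    rw [div_le_div_iff₀ (by norm_num) (by positivity)]
    have h2 : ‖1 - w‖ ^ 2 ≤ 4 := by nlinarith
    have h3 : d ≤ 1 - ‖w‖ ^ 2 := by nlinarith [norm_nonneg w]
    nlinarith
  have hz := hC (UpperHalfPlane.ofComplex (mob w))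
  have him : (UpperHalfPlane.ofComplex (mob w)).im = y := by
    rw [UpperHalfPlane.ofComplex_apply_of_im_pos hy]; rfl
  rw [him] at hz
  have hf1 : ‖f (UpperHalfPlane.ofComplex (mob w))‖ ≤ C * (4 * d⁻¹) ^ r := by
    have hyp : 0 < y ^ (r / 2) := Real.rpow_pos_of_pos hy _
    have h1 : max y (1 / y) ≤ (4 * d⁻¹) ^ 2 * y := by
      have h4 : 1 ≤ (4 * d⁻¹) * y := by
        rw [mul_assoc, ← div_eq_inv_mul, ← mul_div_assoc, le_div_iff₀ hd0]
        linarith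
      have h5 : 1 ≤ 4 * d⁻¹ := by
        have := (one_le_inv₀ hd0).2 hd1
        linarith
      apply max_le
      · nlinarith
      · rw [div_le_iff₀ hy]
        nlinarith
    have h2 : max y (1 / y) ^ (r / 2) ≤ (4 * d⁻¹) ^ r * y ^ (r / 2) := by
      calc max y (1 / y) ^ (r / 2) ≤ ((4 * d⁻¹) ^ 2 * y) ^ (r / 2) :=
            Real.rpow_le_rpow (hy.le.trans (le_max_left _ _)) h1 (by positivity)
        _ = (4 * d⁻¹) ^ r * y ^ (r / 2) := by
            rw [Real.mul_rpow (by positivity) hy.le, ← Real.rpow_natCast (4 * d⁻¹),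
              ← Real.rpow_mul (by positivity)]
            congr 2
            push_cast; ring
    refine le_of_mul_le_mul_right ?_ hyp
    calc _ ≤ _ := hz
      _ ≤ C * ((4 * d⁻¹) ^ r * y ^ (r / 2)) := by gcongr
      _ = _ := by ring
  have hf2 : ‖(-I - mob w) ^ (r : ℂ)‖ ≤ (2 * d⁻¹) ^ r := by
    rw [norm_cpow_real]
    refine Real.rpow_le_rpow (norm_nonneg _) ?_ hr.le
    have : -I - mob w = -(2 * I / (1 - w)) := by
      rw [← mob_add_I (one_sub_ne_zero_of_norm_lt hw)]; ring
    rw [this, norm_neg, norm_div, norm_mul, norm_I, mul_one, RCLike.norm_ofNat, div_eq_mul_inv]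
    gcongr
  rw [diskPlus, norm_mul]
  have hdi : 1 ≤ d⁻¹ := (one_le_inv₀ hd0).2 hd1
  calc _ ≤ (2 * d⁻¹) ^ r * (C * (4 * d⁻¹) ^ r) := by gcongr
    _ = C * 8 ^ r * d⁻¹ ^ (2 * r) := by
      rw [Real.mul_rpow (by norm_num) (by positivity), Real.mul_rpow (by norm_num) (by positivity),
        two_mul r, Real.rpow_add (by positivity), show (8 : ℝ) = 2 * 4 by norm_num,
        Real.mul_rpow (by norm_num) (by norm_num)]
      ring
    _ ≤ C * 8 ^ r * d⁻¹ ^ ⌈2 * r⌉₊ := by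
      rw [← Real.rpow_natCast]
      gcongr
      exact Nat.le_ceil _

/-- Cauchy's estimate on a circle adapted to `n`: at distance `1/(n + 2)` from the unit circle the
growth bound is `(n + 2)^N`, while the `n`-th inverse power of the radius stays below `e`.
Independence of the radius carries the bound to every `c`. -/
theorem IsEntireModularForm.exists_norm_bCoef_le {r : ℝ} (hr : 0 < r) {v : SL(2, ℤ) → ℂˣ}
    {f : ℍ → ℂ} (hf : IsEntireModularForm r v f) :
    ∃ (C : ℝ) (N : ℕ), 0 ≤ C ∧ ∀ c, 0 < c → c < 1 → ∀ n : ℕ,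
      ‖bCoef (diskPlus r f) c n‖ ≤ C * (n + 2 : ℝ) ^ N := by
  obtain ⟨C, N, hC0, hC⟩ := hf.exists_norm_diskPlus_le hr
  have hdiff := differentiableOn_diskPlus (r := r) hf.holo
  refine ⟨C * Real.exp 1, N, by positivity, fun c hc0 hc1 n => ?_⟩
  -- The shift by `2` keeps this radius positive also for `n = 0`.
  set e : ℝ := 1 - (n + 2 : ℝ)⁻¹ with he
  have hn : (0 : ℝ) < n + 2 := by positivity
  have he0 : 0 < e := by
    have : (n + 2 : ℝ)⁻¹ < 1 := inv_lt_one_of_one_lt₀ (by linarith [(Nat.cast_nonneg n : (0 : ℝ) ≤ n)])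
    linarith
  have he1 : e < 1 := by
    have : 0 < (n + 2 : ℝ)⁻¹ := by positivity
    linarith
  have heq : bCoef (diskPlus r f) c n = bCoef (diskPlus r f) e n := by
    rcases le_total c e with h | h
    · exact (bCoef_eq_of_differentiableOn hdiff hc0 h he1 n).symm
    · exact bCoef_eq_of_differentiableOn hdiff he0 h hc1 n
  have hexp : (e ^ n)⁻¹ ≤ Real.exp 1 := by
    have h1 : e⁻¹ = 1 + (n + 1 : ℝ)⁻¹ := by
      have h3 : e = (n + 1 : ℝ) / (n + 2) := by rw [he]; field_simp; ring
      rw [h3, inv_div]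
      field_simp
      ring
    have h2 : e⁻¹ ≤ Real.exp ((n + 1 : ℝ)⁻¹) := by
      rw [h1, add_comm]; exact Real.add_one_le_exp _
    calc (e ^ n)⁻¹ = e⁻¹ ^ n := (inv_pow _ _).symm
      _ ≤ Real.exp ((n + 1 : ℝ)⁻¹) ^ n := by gcongr
      _ = Real.exp (n * (n + 1 : ℝ)⁻¹) := by rw [← Real.exp_nat_mul]
      _ ≤ Real.exp 1 := by
        gcongr
        rw [← div_eq_mul_inv, div_le_one (by positivity)]
        linarith
  rw [heq, bCoef]
  refine (norm_two_pi_I_inv_mul_circleIntegral_le (M := C * (n + 2 : ℝ) ^ N * (e ^ (n + 1))⁻¹) he0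
    fun w hw => ?_).trans ?_
  · rw [mem_sphere_zero_iff_norm] at hw
    rw [norm_mul, norm_inv, norm_pow, hw]
    gcongr
    have := hC w (by rwa [hw])
    rwa [hw, he, sub_sub_cancel, inv_inv] at this
  · calc e * (C * (n + 2 : ℝ) ^ N * (e ^ (n + 1))⁻¹) = C * (n + 2 : ℝ) ^ N * (e ^ n)⁻¹ := by
          rw [pow_succ]; field_simp
      _ ≤ C * (n + 2 : ℝ) ^ N * Real.exp 1 := by gcongr
      _ = _ := by ring

/-! ### Fourier coefficients of `π`-periodic functions -/

/-- The coefficient of `exp (-2 i n θ)` of a `π`-periodic function. -/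
def perCoef (ψ : ℝ → ℂ) (n : ℕ) : ℂ :=
  (Real.pi : ℂ)⁻¹ * ∫ θ in (0 : ℝ)..Real.pi, ψ θ * exp (2 * n * θ * I)

theorem norm_exp_two_mul_I (n : ℕ) (θ : ℝ) : ‖exp (2 * n * θ * I)‖ = 1 := by
  have := norm_exp_ofReal_mul_I (2 * n * θ)
  push_cast at this
  exact this

theorem norm_perCoef_le {ψ : ℝ → ℂ} {M : ℝ} (hM : ∀ θ, ‖ψ θ‖ ≤ M) (n : ℕ) :
    ‖perCoef ψ n‖ ≤ M := by
  have h := intervalIntegral.norm_integral_le_of_norm_le_const (a := (0 : ℝ)) (b := Real.pi)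
    (f := fun θ : ℝ => ψ θ * exp (2 * n * θ * I)) (C := M) fun θ _ => by
      rw [norm_mul, norm_exp_two_mul_I, mul_one]; exact hM θ
  rw [perCoef, norm_mul, norm_inv, norm_real, Real.norm_of_nonneg Real.pi_pos.le]
  rw [sub_zero, abs_of_pos Real.pi_pos] at h
  rw [inv_mul_le_iff₀ Real.pi_pos]
  linarith

theorem perCoef_sub {ψ χ : ℝ → ℂ} (hψ : Continuous ψ) (hχ : Continuous χ) (n : ℕ) :
    perCoef (fun θ => ψ θ - χ θ) n = perCoef ψ n - perCoef χ n := by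
  have he : Continuous fun θ : ℝ => exp (2 * n * θ * I) := by fun_prop
  have h := intervalIntegral.integral_sub (μ := volume) ((hψ.mul he).intervalIntegrable 0 Real.pi)
    ((hχ.mul he).intervalIntegrable 0 Real.pi)
  simp only [Pi.mul_apply] at h
  simp only [perCoef, sub_mul]
  rw [h, mul_sub]

theorem perCoef_deriv {ψ : ℝ → ℂ} (hψ : ContDiff ℝ ∞ ψ) (hp : Function.Periodic ψ Real.pi) (n : ℕ) :
    perCoef (deriv ψ) n = -(2 * n * I) * perCoef ψ n := by
  have hd : ∀ θ, HasDerivAt ψ (deriv ψ θ) θ := fun θ =>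
    (hψ.differentiable (by simp) θ).hasDerivAt
  have hc : Continuous (deriv ψ) := hψ.continuous_deriv (by simp)
  have hE : ∀ θ : ℝ, HasDerivAt (fun θ : ℝ => exp (2 * n * θ * I))
      (exp (2 * n * θ * I) * (2 * n * I)) θ := by
    intro θ
    have h := (((hasDerivAt_id θ).ofReal_comp.const_mul (2 * n : ℂ)).mul_const I).cexp
    simpa using h
  have hprod := intervalIntegral.integral_deriv_mul_eq_sub (a := 0) (b := Real.pi)
    (u := ψ) (v := fun θ : ℝ => exp (2 * n * θ * I)) (fun θ _ => hd θ) (fun θ _ => hE θ)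
    (hc.intervalIntegrable _ _) (Continuous.intervalIntegrable (by fun_prop) _ _)
  have hend : exp (2 * n * Real.pi * I) = 1 := by
    have := exp_nat_mul_two_pi_mul_I n
    rw [← this]; ring_nf
  have h0 : ψ Real.pi = ψ 0 := by simpa using hp 0
  rw [hend, h0] at hprod
  simp only [ofReal_zero, mul_zero, zero_mul, exp_zero, sub_self] at hprod
  have hψc := hψ.continuous
  rw [intervalIntegral.integral_add (Continuous.intervalIntegrable (by fun_prop) _ _)
    (Continuous.intervalIntegrable (by fun_prop) _ _)] at hprod
  have h2 : (∫ θ in (0 : ℝ)..Real.pi, ψ θ * (exp (2 * n * θ * I) * (2 * n * I))) =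
      (2 * n * I) * ∫ θ in (0 : ℝ)..Real.pi, ψ θ * exp (2 * n * θ * I) := by
    rw [← intervalIntegral.integral_const_mul]
    congr 1; ext θ; ring
  rw [h2] at hprod
  rw [perCoef, perCoef]
  linear_combination (Real.pi : ℂ)⁻¹ * hprod

theorem periodic_deriv {ψ : ℝ → ℂ} {c : ℝ} (hp : Function.Periodic ψ c) :
    Function.Periodic (deriv ψ) c := by
  intro θ
  have h := deriv_comp_add_const (f := ψ) c θ
  rw [← h]
  congr 1
  funext x
  exact hp x

theorem perCoef_iteratedDeriv (k n : ℕ) {ψ : ℝ → ℂ} (hψ : ContDiff ℝ ∞ ψ)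
    (hp : Function.Periodic ψ Real.pi) :
    perCoef (iteratedDeriv k ψ) n = (-(2 * n * I)) ^ k * perCoef ψ n := by
  induction k generalizing ψ with
  | zero => simp
  | succ k ih =>
    rw [iteratedDeriv_succ', ih (contDiff_infty_iff_deriv.1 hψ).2 (periodic_deriv hp),
      perCoef_deriv hψ hp, pow_succ]
    ring

/-- Integrating by parts `k` times gains `(2n)^k`. This says nothing for `n = 0`, where the bound on
`ψ` itself is used; the constant `3^k` covers both `n + 2 ≤ 3 · 2n` for `n ≥ 1` and `2 ≤ 3` for `n =
0`. -/
theorem norm_perCoef_mul_pow_le {ψ : ℝ → ℂ} (hψ : ContDiff ℝ ∞ ψ)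
    (hp : Function.Periodic ψ Real.pi) {k : ℕ} {M₀ M : ℝ} (hM₀ : ∀ θ, ‖ψ θ‖ ≤ M₀)
    (hM : ∀ θ, ‖iteratedDeriv k ψ θ‖ ≤ M) (n : ℕ) :
    ‖perCoef ψ n‖ ≤ 3 ^ k * (M₀ + M) * ((n + 2 : ℝ) ^ k)⁻¹ := by
  have hM0' : 0 ≤ M₀ := (norm_nonneg _).trans (hM₀ 0)
  have hM' : 0 ≤ M := (norm_nonneg _).trans (hM 0)
  rw [← div_eq_mul_inv, le_div_iff₀ (by positivity)]
  rcases Nat.eq_zero_or_pos n with rfl | hn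
  · have h1 := norm_perCoef_le hM₀ 0
    have h2 : ((0 : ℕ) + 2 : ℝ) ^ k ≤ 3 ^ k := by gcongr; norm_num
    calc _ ≤ M₀ * 3 ^ k := by gcongr
      _ ≤ _ := by nlinarith [pow_pos (show (0 : ℝ) < 3 by norm_num) k]
  · have h1 := norm_perCoef_le hM n
    rw [perCoef_iteratedDeriv k n hψ hp, norm_mul, norm_pow] at h1
    have h3 : ‖-(2 * n * I : ℂ)‖ = 2 * n := by simp
    rw [h3] at h1
    have hn' : (1 : ℝ) ≤ n := by exact_mod_cast hn
    have h2 : (n + 2 : ℝ) ^ k ≤ 3 ^ k * (2 * n) ^ k := by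
      rw [← mul_pow]; gcongr; linarith
    calc ‖perCoef ψ n‖ * (n + 2 : ℝ) ^ k ≤ ‖perCoef ψ n‖ * (3 ^ k * (2 * n) ^ k) := by gcongr
      _ = 3 ^ k * ((2 * n) ^ k * ‖perCoef ψ n‖) := by ring
      _ ≤ 3 ^ k * (M₀ + M) := by gcongr; linarith

/-! ### Boundary values -/

theorem uCoord_neg_mob {u : ℂ} (hu : 1 - u ≠ 0) : uCoord (-mob u) = u := by
  rw [uCoord, ← neg_div_neg_eq]
  have h1 : -(-mob u + I) = mob u - I := by ring
  have h2 : -(-mob u - I) = mob u + I := by ring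
  rw [h1, h2, disk_mob hu]

theorem neg_mob_im_neg {u : ℂ} (hu : ‖u‖ < 1) : (-mob u).im < 0 := by
  rw [neg_im]
  linarith [mob_im_pos hu]

theorem ExtendsMinus.eqOn {r : ℝ} {f : LowerHalf → ℂ} {F G : ℂ → ℂ} (hF : ExtendsMinus r f F)
    (hG : ExtendsMinus r f G) : EqOn F G (Metric.ball 0 1) := by
  intro u hu
  rw [mem_ball_zero_iff] at hu
  have h1 := hF ⟨_, neg_mob_im_neg hu⟩
  have h2 := hG ⟨_, neg_mob_im_neg hu⟩
  simp only [uCoord_neg_mob (one_sub_ne_zero_of_norm_lt hu)] at h1 h2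
  rw [h1, h2]

theorem norm_exp_neg_two_mul_I (θ : ℝ) : ‖exp (-2 * θ * I)‖ = 1 := by
  have := norm_exp_ofReal_mul_I (-2 * θ)
  push_cast at this
  exact this

/-- The extension is determined on the open disk by `f`, hence by continuity on the closed disk. So
the arbitrary choice made in `SmoothVector.boundary` is harmless. -/
theorem SmoothVector.boundary_eq {r : ℝ} (φ : SmoothVector r) {F : ℂ → ℂ}
    (hF : ExtendsMinus r φ.toFun F) (hFc : ContinuousOn F (Metric.closedBall 0 1)) (θ : ℝ) :
    φ.boundary θ = F (exp (-2 * θ * I)) := by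
  obtain ⟨_, h2, h3⟩ := Classical.choose_spec φ.smooth
  have h := (h3.eqOn hF).of_subset_closure h2.continuousOn hFc Metric.ball_subset_closedBall
    (by rw [closure_ball (0 : ℂ) one_ne_zero])
  exact h (by simp only [mem_closedBall_zero_iff, norm_exp_neg_two_mul_I]; exact le_rfl)

theorem SmoothVector.contDiff_boundary {r : ℝ} (φ : SmoothVector r) :
    ContDiff ℝ ∞ φ.boundary := by
  obtain ⟨_, h2, _⟩ := Classical.choose_spec φ.smooth
  refine h2.comp_contDiff (f := fun θ : ℝ => exp (-2 * θ * I)) ?_ fun θ => ?_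
  · exact ((contDiff_const.mul ofRealCLM.contDiff).mul contDiff_const).cexp
  · rw [mem_closedBall_zero_iff, norm_exp_neg_two_mul_I]

theorem exp_neg_two_mul_add_pi (θ : ℝ) :
    exp (-2 * ((θ + Real.pi : ℝ) : ℂ) * I) = exp (-2 * θ * I) := by
  have : -2 * ((θ + Real.pi : ℝ) : ℂ) * I = -2 * θ * I - 2 * Real.pi * I := by push_cast; ring
  rw [this, exp_sub, exp_two_pi_mul_I, div_one]

theorem SmoothVector.periodic_boundary {r : ℝ} (φ : SmoothVector r) :
    Function.Periodic φ.boundary Real.pi := by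
  intro θ
  rw [SmoothVector.boundary, SmoothVector.boundary, exp_neg_two_mul_add_pi]

theorem exists_norm_le_of_periodic {ψ : ℝ → ℂ} {c : ℝ} (hc : 0 < c) (hψ : Continuous ψ)
    (hp : Function.Periodic ψ c) : ∃ M, ∀ θ, ‖ψ θ‖ ≤ M := by
  obtain ⟨M, hM⟩ := isCompact_Icc.exists_bound_of_continuousOn (s := Icc 0 c) hψ.continuousOn
  refine ⟨M, fun θ => ?_⟩
  obtain ⟨y, hy, hy'⟩ := hp.exists_mem_Ico₀ hc θ
  rw [hy']
  exact hM y ⟨hy.1, hy.2.le⟩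

theorem periodic_iteratedDeriv {ψ : ℝ → ℂ} {c : ℝ} (hp : Function.Periodic ψ c) (k : ℕ) :
    Function.Periodic (iteratedDeriv k ψ) c := by
  induction k with
  | zero => simpa using hp
  | succ k ih => rw [iteratedDeriv_succ]; exact periodic_deriv ih

theorem SmoothVector.exists_norm_iteratedDeriv_le {r : ℝ} (φ : SmoothVector r) (k : ℕ) :
    ∃ M, ∀ θ, ‖iteratedDeriv k φ.boundary θ‖ ≤ M :=
  exists_norm_le_of_periodic Real.pi_pos
    (φ.contDiff_boundary.continuous_iteratedDeriv k (by exact_mod_cast le_top))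
    (periodic_iteratedDeriv φ.periodic_boundary k)

theorem tendsto_smoothVector_iff {r : ℝ} {ι : Type*} {l : Filter ι} {φ : ι → SmoothVector r}
    {φ₀ : SmoothVector r} : Tendsto φ l (𝓝 φ₀) ↔ ∀ k : ℕ,
      TendstoUniformly (fun i => iteratedDeriv k (φ i).boundary) (iteratedDeriv k φ₀.boundary) l := by
  rw [nhds_induced, tendsto_comap_iff, tendsto_pi_nhds]
  refine forall_congr' fun k => ?_
  rw [UniformFun.tendsto_iff_tendstoUniformly]
  rfl

/-! ### The pairing of smooth vectors with sequences of moderate growth -/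

/-- The pairing `∑ λ_n a_n` of a sequence with the Fourier coefficients of a smooth vector. -/
def coefPairing {r : ℝ} (lam : ℕ → ℂ) (φ : SmoothVector r) : ℂ :=
  ∑' n, lam n * perCoef φ.boundary n

/-- Dominated convergence for series. Near `φ₀` the derivatives of orders `0` and `N + 2` are
bounded uniformly, which beats the growth of `lam` and leaves the summable `(n + 2)⁻²`. Each single
coefficient is continuous already in the supremum norm. -/
theorem continuous_coefPairing {r : ℝ} {lam : ℕ → ℂ} {C : ℝ} {N : ℕ} (hC : 0 ≤ C)
    (hlam : ∀ n : ℕ, ‖lam n‖ ≤ C * (n + 2 : ℝ) ^ N) :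
    Continuous (coefPairing lam : SmoothVector r → ℂ) := by
  rw [continuous_iff_continuousAt]
  intro φ₀
  have hT := tendsto_smoothVector_iff.1 (tendsto_id (x := 𝓝 φ₀))
  have hev : ∀ k, ∀ ε > 0, ∀ᶠ φ : SmoothVector r in 𝓝 φ₀, ∀ θ,
      ‖iteratedDeriv k φ.boundary θ - iteratedDeriv k φ₀.boundary θ‖ < ε := by
    intro k ε hε
    filter_upwards [Metric.tendstoUniformly_iff.1 (hT k) ε hε] with φ hφ θ
    rw [← dist_eq_norm, dist_comm]
    exact hφ θ
  obtain ⟨M₀, hM₀⟩ := φ₀.exists_norm_iteratedDeriv_le 0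
  obtain ⟨M, hM⟩ := φ₀.exists_norm_iteratedDeriv_le (N + 2)
  have hle : ∀ (k : ℕ) (B : ℝ), (∀ θ, ‖iteratedDeriv k φ₀.boundary θ‖ ≤ B) →
      ∀ᶠ φ : SmoothVector r in 𝓝 φ₀, ∀ θ, ‖iteratedDeriv k φ.boundary θ‖ ≤ B + 1 := by
    intro k B hB
    filter_upwards [hev k 1 one_pos] with φ hφ θ
    have h1 := hφ θ
    have h2 := norm_sub_norm_le (iteratedDeriv k φ.boundary θ) (iteratedDeriv k φ₀.boundary θ)
    linarith [hB θ]
  have hsum : Summable fun n : ℕ => ((n + 2 : ℝ) ^ 2)⁻¹ := by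
    have := (summable_nat_add_iff 2).2 (Real.summable_nat_pow_inv.2 one_lt_two)
    simpa using this
  refine tendsto_tsum_of_dominated_convergence
    (hsum.mul_left (C * (3 ^ (N + 2) * ((M₀ + 1) + (M + 1))))) (fun n => ?_) ?_
  · refine Tendsto.const_mul _ ?_
    rw [Metric.tendsto_nhds]
    intro ε hε
    filter_upwards [hev 0 (ε / 2) (by positivity)] with φ hφ
    rw [dist_eq_norm, ← perCoef_sub φ.contDiff_boundary.continuous φ₀.contDiff_boundary.continuous]
    refine (norm_perCoef_le (M := ε / 2) (fun θ => ?_) n).trans_lt (by linarith)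
    simpa using (hφ θ).le
  · filter_upwards [hle 0 M₀ hM₀, hle (N + 2) M hM] with φ h0 h1 n
    rw [iteratedDeriv_zero] at h0
    have hp := norm_perCoef_mul_pow_le φ.contDiff_boundary φ.periodic_boundary h0 h1 n
    rw [norm_mul]
    calc _ ≤ (C * (n + 2 : ℝ) ^ N) *
          (3 ^ (N + 2) * ((M₀ + 1) + (M + 1)) * ((n + 2 : ℝ) ^ (N + 2))⁻¹) := by
          gcongr
          exact hlam n
      _ = _ := by
          rw [pow_add (n + 2 : ℝ)]
          field_simp

/-! ### The duality on analytic vectors -/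

/-- The substitution `w = exp (i t)`, `t = 2θ`, under which `u = w⁻¹ = exp (-2iθ)` is the boundary
parameter of `-cot θ`. -/
theorem aCoef_one_eq_perCoef (F : ℂ → ℂ) (n : ℕ) :
    aCoef F 1 n = perCoef (fun θ => F (exp (-2 * θ * I))) n := by
  have h := intervalIntegral.integral_comp_mul_left (a := 0) (b := Real.pi)
    (fun t : ℝ => F (exp (-t * I)) * exp (n * t * I)) (c := 2) two_ne_zero
  rw [mul_zero] at h
  have h1 : (∮ w in C(0, 1), F w⁻¹ * w ^ n * w⁻¹) =
      I * ∫ t in (0 : ℝ)..(2 * Real.pi), F (exp (-t * I)) * exp (n * t * I) := by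
    rw [circleIntegral, ← intervalIntegral.integral_const_mul]
    congr 1
    ext t
    simp only [deriv_circleMap, circleMap, ofReal_one, one_mul, zero_add, smul_eq_mul]
    rw [← exp_nat_mul, ← exp_neg, neg_mul, mul_assoc (n : ℂ)]
    have := exp_ne_zero ((t : ℂ) * I)
    rw [exp_neg (t * I)]
    field_simp
  rw [aCoef, perCoef, h1]
  have h2 : (∫ θ in (0 : ℝ)..Real.pi, F (exp (-2 * θ * I)) * exp (2 * n * θ * I)) =
      ∫ x in (0 : ℝ)..Real.pi, F (exp (-((2 * x : ℝ) : ℂ) * I)) * exp (n * ((2 * x : ℝ) : ℂ) * I) := by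
    congr 1
    ext θ
    push_cast
    ring_nf
  rw [h2, h, real_smul]
  generalize (∫ t in (0 : ℝ)..(2 * Real.pi), F (exp (-t * I)) * exp (n * t * I)) = x
  have hpi : (Real.pi : ℂ) ≠ 0 := by exact_mod_cast Real.pi_ne_zero
  push_cast
  field_simp

theorem IsAnalyticExtension.continuousOn_closedBall {r R : ℝ} {f : LowerHalf → ℂ} {F : ℂ → ℂ}
    (hF : IsAnalyticExtension r f R F) : ContinuousOn F (Metric.closedBall 0 1) :=
  hF.2.1.continuousOn.mono (Metric.closedBall_subset_ball hF.1)

/-- Moving the contour to the unit circle links the contour definition of the duality with the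
boundary function that defines the topology. -/
theorem IsAnalyticExtension.aCoef_eq {r R : ℝ} {φ : SmoothVector r} {F : ℂ → ℂ}
    (hF : IsAnalyticExtension r φ.toFun R F) {c : ℝ} (hc : R⁻¹ < c) (hc1 : c ≤ 1) (n : ℕ) :
    aCoef F c n = perCoef φ.boundary n := by
  rw [← aCoef_eq_of_differentiableOn (zero_lt_one.trans hF.1) hF.2.1 hc hc1, aCoef_one_eq_perCoef]
  congr 1
  ext θ
  rw [φ.boundary_eq hF.2.2 hF.continuousOn_closedBall]

/-- The sequence that represents the duality with `h`. -/
def dualCoef (r : ℝ) (h : ℍ → ℂ) (n : ℕ) : ℂ := hypCoef r n * bCoef (diskPlus r h) 2⁻¹ n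

theorem bCoef_eq_half {r : ℝ} {h : ℍ → ℂ} (hh : MDifferentiable 𝓘(ℂ) 𝓘(ℂ) h) {c : ℝ} (hc0 : 0 < c)
    (hc1 : c < 1) (n : ℕ) : bCoef (diskPlus r h) c n = bCoef (diskPlus r h) 2⁻¹ n := by
  have hd := differentiableOn_diskPlus (r := r) hh
  rcases le_total c 2⁻¹ with hc | hc
  · exact (bCoef_eq_of_differentiableOn hd hc0 hc (by norm_num) n).symm
  · exact bCoef_eq_of_differentiableOn hd (by norm_num) hc hc1 n

theorem hasSum_dualityIntegral_dualCoef {r : ℝ} (hr : 0 < r) {F : ℂ → ℂ} {h : ℍ → ℂ} {c₁ c₂ : ℝ}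
    (hh : MDifferentiable 𝓘(ℂ) 𝓘(ℂ) h)
    (hc0 : 0 < c₁) (hc12 : c₁ < c₂) (hc2 : c₂ < 1)
    (hF : ContinuousOn (fun w => F w⁻¹) (Metric.sphere 0 c₁)) :
    HasSum (fun n => dualCoef r h n * aCoef F c₁ n) (dualityIntegral r h F c₁ c₂) := by
  have key := hasSum_dualityIntegral hr hc0 hc12 hc2 hF
    ((differentiableOn_diskPlus hh).continuousOn.mono fun w hw => by
      rw [mem_ball_zero_iff, mem_sphere_zero_iff_norm.1 hw]; exact hc2)
  refine (congrArg (fun f => HasSum f _) (funext fun n => ?_)).mpr key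
  rw [dualCoef, bCoef_eq_half hh (hc0.trans hc12) hc2]
  ring

theorem dualityIntegral_eq_coefPairing {r : ℝ} (hr : 0 < r) {h : ℍ → ℂ}
    (hh : MDifferentiable 𝓘(ℂ) 𝓘(ℂ) h) {φ : SmoothVector r} {R : ℝ} {F : ℂ → ℂ}
    (hF : IsAnalyticExtension r φ.toFun R F) {c₁ c₂ : ℝ} (hc0 : R⁻¹ < c₁) (hc12 : c₁ < c₂)
    (hc2 : c₂ < 1) : dualityIntegral r h F c₁ c₂ = coefPairing (dualCoef r h) φ := by
  have hR : 0 < R := zero_lt_one.trans hF.1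
  have h0 : 0 < c₁ := (inv_pos.2 hR).trans hc0
  rw [← (hasSum_dualityIntegral_dualCoef hr hh h0 hc12 hc2 ?_).tsum_eq, coefPairing]
  · congr 1
    ext n
    rw [hF.aCoef_eq hc0 (hc12.trans hc2).le]
  · refine hF.2.1.continuousOn.comp
      (continuousOn_id.inv₀ fun w hw => ne_zero_of_mem_sphere h0 hw) fun w hw => ?_
    rw [mem_ball_zero_iff, norm_inv, mem_sphere_zero_iff_norm.1 hw]
    exact inv_lt_of_inv_lt₀ hR hc0

theorem dualityAnalytic_eq_coefPairing {r : ℝ} (hr : 0 < r) {h : ℍ → ℂ}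
    (hh : MDifferentiable 𝓘(ℂ) 𝓘(ℂ) h) {φ : SmoothVector r} (hφ : φ ∈ analyticVectors r) :
    dualityAnalytic r h φ.toFun = coefPairing (dualCoef r h) φ := by
  have hex : ∃ L : ℂ, ∀ (R : ℝ) (F : ℂ → ℂ), IsAnalyticExtension r φ.toFun R F →
      ∀ c₁ c₂ : ℝ, R⁻¹ < c₁ → c₁ < c₂ → c₂ < 1 → dualityIntegral r h F c₁ c₂ = L :=
    ⟨_, fun R F hF c₁ c₂ h1 h2 h3 => dualityIntegral_eq_coefPairing hr hh hF h1 h2 h3⟩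
  obtain ⟨R, F, hF⟩ := hφ
  have hR : R⁻¹ < 1 := inv_lt_one_of_one_lt₀ hF.1
  -- Since `R > 1` there are admissible radii, so the condition defining the epsilon term is not
  -- vacuous and pins down its value.
  obtain ⟨c₁, h1, h1'⟩ := exists_between hR
  obtain ⟨c₂, h2, h2'⟩ := exists_between h1'
  rw [← dualityIntegral_eq_coefPairing hr hh hF h1 h2 h2']
  exact (Classical.epsilon_spec hex R F hF c₁ c₂ h1 h2 h2').symm

theorem IsEntireModularForm.exists_norm_dualCoef_le {r : ℝ} (hr : 0 < r) {v : SL(2, ℤ) → ℂˣ}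
    {f : ℍ → ℂ} (hf : IsEntireModularForm r v f) :
    ∃ (C : ℝ) (N : ℕ), 0 ≤ C ∧ ∀ n : ℕ, ‖dualCoef r f n‖ ≤ C * (n + 2 : ℝ) ^ N := by
  obtain ⟨C, N, hC0, hC⟩ := hf.exists_norm_bCoef_le hr
  refine ⟨(1 + 1 / r) * C, N + 1, by positivity, fun n => ?_⟩
  rw [dualCoef, norm_mul, norm_real, Real.norm_of_nonneg (hypCoef_nonneg hr n)]
  have h1 : hypCoef r n ≤ (1 + 1 / r) * (n + 2) := by
    refine (hypCoef_le hr n).trans ?_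
    have : (0 : ℝ) ≤ n := Nat.cast_nonneg n
    have h3 : (1 + 1 / r) * (n + 2) = 1 + n / r + (n + 1 + 2 / r) := by field_simp; ring
    rw [h3]
    have : 0 ≤ n + 1 + 2 / r := by positivity
    linarith
  calc _ ≤ ((1 + 1 / r) * (n + 2)) * (C * (n + 2 : ℝ) ^ N) := by
        gcongr
        exact hC _ (by norm_num) (by norm_num) n
    _ = _ := by ring

theorem IsEntireModularForm.continuous_coefPairing {r : ℝ} (hr : 0 < r) {v : SL(2, ℤ) → ℂˣ}
    {f : ℍ → ℂ} (hf : IsEntireModularForm r v f) :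
    Continuous (coefPairing (dualCoef r f) : SmoothVector r → ℂ) := by
  obtain ⟨C, N, hC0, hC⟩ := hf.exists_norm_dualCoef_le hr
  exact ModularCup.continuous_coefPairing hC0 hC

/-- On analytic vectors the form coincides with a functional that is continuous on all of `D^∞`; the
limit along analytic vectors is therefore the value of that functional. -/
theorem duality_eq_coefPairing {r : ℝ} (hr : 0 < r) {v : SL(2, ℤ) → ℂˣ}
    {f : ℍ → ℂ} (hf : IsEntireModularForm r v f) {φ : SmoothVector r}
    (hφ : φ ∈ closure (analyticVectors r)) :
    Tendsto (fun φ : SmoothVector r => dualityAnalytic r f φ.toFun) (𝓝[analyticVectors r] φ)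
      (𝓝 (coefPairing (dualCoef r f) φ)) ∧ duality r f φ = coefPairing (dualCoef r f) φ := by
  have h : Tendsto (fun φ : SmoothVector r => dualityAnalytic r f φ.toFun)
      (𝓝[analyticVectors r] φ) (𝓝 (coefPairing (dualCoef r f) φ)) :=
    (((hf.continuous_coefPairing hr).tendsto φ).mono_left nhdsWithin_le_nhds).congr'
      (eventually_nhdsWithin_of_forall fun χ hχ =>
        (dualityAnalytic_eq_coefPairing hr hf.holo hχ).symm)
  exact ⟨h, extendFrom_eq hφ h⟩

/-! ### Integrals of powers of linear functions -/

/-- The base `1 + x (1 - u)/2`; it equals `(τ - t)/(i - t)` for `x = (τ - i)/i` and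
`u = (t + i)/(t - i)`. -/
def powBase (x u : ℂ) : ℂ := 1 + x * ((1 - u) / 2)

/-- The integral `∫ g(s) (1 + x(s) (1 - u)/2)^σ dμ(s)` as a function of `u`. -/
def powInt (μ : Measure ℝ) (x g : ℝ → ℂ) (σ : ℝ) (u : ℂ) : ℂ :=
  ∫ s, g s * powBase (x s) u ^ (σ : ℂ) ∂μ

/-- On the bounded set `Q` the bases avoid the negative real axis and stay away from `0`. -/
structure IsPowDomain (μ : Measure ℝ) (x : ℝ → ℂ) (Q : Set ℂ) (δ M : ℝ) : Prop where
  pos : 0 < δ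
  nonneg : 0 ≤ M
  measurable : Measurable x
  slit : ∀ᵐ s ∂μ, ∀ u ∈ Q, powBase (x s) u ∈ slitPlane
  lower : ∀ᵐ s ∂μ, ∀ u ∈ Q, δ ≤ ‖powBase (x s) u‖
  bound : ∀ u ∈ Q, ‖u‖ ≤ M

/-- `g` decays faster than every power of `x`. -/
structure IsRapid (μ : Measure ℝ) (x g : ℝ → ℂ) : Prop where
  meas : AEStronglyMeasurable g μ
  int : ∀ n : ℕ, Integrable (fun s => ‖g s‖ * (1 + ‖x s‖) ^ n) μ

theorem IsRapid.mono {μ ν : Measure ℝ} {x g : ℝ → ℂ} (h : IsRapid μ x g) (hν : ν ≤ μ) :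
    IsRapid ν x g :=
  ⟨h.meas.mono_measure hν, fun n => (h.int n).mono_measure hν⟩

theorem IsPowDomain.mono {μ ν : Measure ℝ} {x : ℝ → ℂ} {Q : Set ℂ} {δ M : ℝ}
    (h : IsPowDomain μ x Q δ M) (hν : ν ≤ μ) : IsPowDomain ν x Q δ M :=
  ⟨h.pos, h.nonneg, h.measurable, (Measure.absolutelyContinuous_of_le hν).ae_le h.slit,
    (Measure.absolutelyContinuous_of_le hν).ae_le h.lower, h.bound⟩

theorem IsRapid.mul_x {μ : Measure ℝ} {x g : ℝ → ℂ} (h : IsRapid μ x g) (hx : Measurable x)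
    (a : ℂ) : IsRapid μ x (fun s => a * (g s * x s)) := by
  refine ⟨(h.meas.mul hx.aestronglyMeasurable).const_mul a, fun n => ?_⟩
  refine Integrable.mono' ((h.int (n + 1)).const_mul ‖a‖) ?_ (ae_of_all _ fun s => ?_)
  · exact ((h.meas.mul hx.aestronglyMeasurable).const_mul a).norm.mul
      (((hx.norm.const_add 1).pow_const n).aestronglyMeasurable)
  · rw [norm_mul, norm_norm, norm_mul, norm_mul, norm_pow,
      Real.norm_of_nonneg (show (0 : ℝ) ≤ 1 + ‖x s‖ by positivity), pow_succ']
    calc ‖a‖ * (‖g s‖ * ‖x s‖) * (1 + ‖x s‖) ^ n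
        ≤ ‖a‖ * (‖g s‖ * (1 + ‖x s‖)) * (1 + ‖x s‖) ^ n := by gcongr; linarith
      _ = _ := by ring

theorem norm_powBase_le {x u : ℂ} {M : ℝ} (hu : ‖u‖ ≤ M) :
    ‖powBase x u‖ ≤ (1 + M) * (1 + ‖x‖) := by
  have h1 : ‖(1 - u) / 2‖ ≤ 1 + M := by
    rw [norm_div, RCLike.norm_ofNat]
    have := norm_sub_le (1 : ℂ) u
    rw [norm_one] at this
    linarith [norm_nonneg (1 - u)]
  have h0 := norm_nonneg u
  calc ‖powBase x u‖ ≤ ‖(1 : ℂ)‖ + ‖x * ((1 - u) / 2)‖ := norm_add_le _ _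
    _ ≤ 1 + ‖x‖ * (1 + M) := by rw [norm_one, norm_mul]; gcongr
    _ ≤ _ := by nlinarith [norm_nonneg x]

/-- For `σ ≥ 0` the upper bound on the base matters, for `σ ≤ 0` the lower bound `δ`; adding the two
constants avoids a case distinction later. For `σ ≤ 0` the exponent `⌈σ⌉₊` is `0`. -/
theorem norm_powBase_cpow_le {x u : ℂ} {δ M : ℝ} (hδ : 0 < δ) (hl : δ ≤ ‖powBase x u‖)
    (hu : ‖u‖ ≤ M) (σ : ℝ) :
    ‖powBase x u ^ (σ : ℂ)‖ ≤ (δ ^ σ + (1 + M) ^ ⌈σ⌉₊) * (1 + ‖x‖) ^ ⌈σ⌉₊ := by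
  rw [norm_cpow_real]
  have hM : 0 ≤ M := (norm_nonneg u).trans hu
  have hp := hδ.trans_le hl
  have h1x : (1 : ℝ) ≤ (1 + ‖x‖) ^ ⌈σ⌉₊ := one_le_pow₀ (by linarith [norm_nonneg x])
  have hd : 0 ≤ δ ^ σ := Real.rpow_nonneg hδ.le _
  rcases le_total 0 σ with hσ | hσ
  · have hb : 1 ≤ (1 + M) * (1 + ‖x‖) := by nlinarith [norm_nonneg x]
    calc ‖powBase x u‖ ^ σ ≤ ((1 + M) * (1 + ‖x‖)) ^ σ :=
          Real.rpow_le_rpow hp.le (norm_powBase_le hu) hσ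
      _ ≤ ((1 + M) * (1 + ‖x‖)) ^ (⌈σ⌉₊ : ℝ) := Real.rpow_le_rpow_of_exponent_le hb (Nat.le_ceil σ)
      _ = (1 + M) ^ ⌈σ⌉₊ * (1 + ‖x‖) ^ ⌈σ⌉₊ := by rw [Real.rpow_natCast, mul_pow]
      _ ≤ _ := by gcongr; linarith
  · calc ‖powBase x u‖ ^ σ ≤ δ ^ σ := Real.rpow_le_rpow_of_nonpos hδ hl hσ
      _ ≤ (δ ^ σ + (1 + M) ^ ⌈σ⌉₊) * 1 := by
          rw [mul_one]; linarith [pow_nonneg (show 0 ≤ 1 + M by linarith) ⌈σ⌉₊]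
      _ ≤ _ := by gcongr

theorem hasDerivAt_powBase_cpow {x u : ℂ} (h : powBase x u ∈ slitPlane) (σ : ℝ) :
    HasDerivAt (fun u => powBase x u ^ (σ : ℂ))
      (σ * powBase x u ^ ((σ - 1 : ℝ) : ℂ) * (-x / 2)) u := by
  have h1 : HasDerivAt (powBase x) (x * (-1 / 2)) u :=
    ((((hasDerivAt_id u).const_sub 1).div_const 2).const_mul x).const_add 1
  refine (h1.cpow_const h).congr_deriv ?_
  push_cast
  ring

section

variable {μ : Measure ℝ} {x : ℝ → ℂ} {Q : Set ℂ} {δ M : ℝ}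

theorem IsPowDomain.aestronglyMeasurable (hQ : IsPowDomain μ x Q δ M) {g : ℝ → ℂ}
    (hg : IsRapid μ x g) (σ : ℝ) (u : ℂ) :
    AEStronglyMeasurable (fun s => g s * powBase (x s) u ^ (σ : ℂ)) μ := by
  refine hg.meas.mul ?_
  have h1 : Measurable fun s => powBase (x s) u :=
    (hQ.measurable.mul_const _).const_add 1
  exact (h1.pow_const _).aestronglyMeasurable

theorem IsPowDomain.ae_norm_le (hQ : IsPowDomain μ x Q δ M) (g : ℝ → ℂ) (σ : ℝ) :
    ∀ᵐ s ∂μ, ∀ u ∈ Q, ‖g s * powBase (x s) u ^ (σ : ℂ)‖ ≤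
      (δ ^ σ + (1 + M) ^ ⌈σ⌉₊) * (‖g s‖ * (1 + ‖x s‖) ^ ⌈σ⌉₊) := by
  filter_upwards [hQ.lower] with s hs u hu
  rw [norm_mul]
  calc _ ≤ ‖g s‖ * ((δ ^ σ + (1 + M) ^ ⌈σ⌉₊) * (1 + ‖x s‖) ^ ⌈σ⌉₊) := by
        gcongr
        exact norm_powBase_cpow_le hQ.pos (hs u hu) (hQ.bound u hu) σ
    _ = _ := by ring

theorem IsPowDomain.integrable (hQ : IsPowDomain μ x Q δ M) {g : ℝ → ℂ} (hg : IsRapid μ x g)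
    (σ : ℝ) {u : ℂ} (hu : u ∈ Q) : Integrable (fun s => g s * powBase (x s) u ^ (σ : ℂ)) μ :=
  Integrable.mono' ((hg.int ⌈σ⌉₊).const_mul _) (hQ.aestronglyMeasurable hg σ u)
    ((hQ.ae_norm_le g σ).mono fun _ h => h u hu)

theorem IsPowDomain.norm_powInt_le (hQ : IsPowDomain μ x Q δ M) {g : ℝ → ℂ}
    (hg : IsRapid μ x g) (σ : ℝ) {u : ℂ} (hu : u ∈ Q) : ‖powInt μ x g σ u‖ ≤
      (δ ^ σ + (1 + M) ^ ⌈σ⌉₊) * ∫ s, ‖g s‖ * (1 + ‖x s‖) ^ ⌈σ⌉₊ ∂μ := by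
  rw [← integral_const_mul]
  exact norm_integral_le_of_norm_le ((hg.int _).const_mul _)
    ((hQ.ae_norm_le g σ).mono fun _ h => h u hu)

/-- Differentiation under the integral sign, up to the boundary of `Q`. The difference quotients are
dominated through the mean value inequality on the convex set `Q`. The derivative is an integral of
the same kind, with `g` multiplied by `x` and `σ` lowered by `1`. -/
theorem IsPowDomain.hasDerivWithinAt (hQ : IsPowDomain μ x Q δ M) (hconv : Convex ℝ Q)
    {g : ℝ → ℂ} (hg : IsRapid μ x g) (σ : ℝ) {u : ℂ} (hu : u ∈ Q) :
    HasDerivWithinAt (powInt μ x g σ)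
      (powInt μ x (fun s => (-σ / 2 : ℂ) * (g s * x s)) (σ - 1) u) Q u := by
  rw [hasDerivWithinAt_iff_tendsto_slope]
  have hg' := hg.mul_x hQ.measurable (-σ / 2 : ℂ)
  set K := (δ ^ (σ - 1) + (1 + M) ^ ⌈σ - 1⌉₊) with hK
  have hev : ∀ᶠ y in 𝓝[Q \ {u}] u, y ∈ Q \ {u} := eventually_mem_nhdsWithin
  have hslope : ∀ y ∈ Q, slope (powInt μ x g σ) u y =
      ∫ s, slope (fun u => g s * powBase (x s) u ^ (σ : ℂ)) u y ∂μ := by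
    intro y hy
    simp only [slope_def_module, powInt, smul_eq_mul]
    rw [integral_const_mul, integral_sub (hQ.integrable hg σ hy) (hQ.integrable hg σ hu)]
  have key : Tendsto (fun y => ∫ s, slope (fun u => g s * powBase (x s) u ^ (σ : ℂ)) u y ∂μ)
      (𝓝[Q \ {u}] u) (𝓝 (powInt μ x (fun s => (-σ / 2 : ℂ) * (g s * x s)) (σ - 1) u)) := by
    refine tendsto_integral_filter_of_dominated_convergence
      (fun s => K * (‖(-σ / 2 : ℂ) * (g s * x s)‖ * (1 + ‖x s‖) ^ ⌈σ - 1⌉₊)) ?_ ?_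
      ((hg'.int _).const_mul K) ?_
    · filter_upwards with y
      simp only [slope_def_module]
      exact ((hQ.aestronglyMeasurable hg σ y).sub (hQ.aestronglyMeasurable hg σ u)).const_smul (y - u)⁻¹
    · filter_upwards [hev] with y hy
      filter_upwards [hQ.slit, hQ.ae_norm_le (fun s => (-σ / 2 : ℂ) * (g s * x s)) (σ - 1)]
        with s hs hs'
      have hd : ∀ v ∈ Q, HasDerivWithinAt (fun u => g s * powBase (x s) u ^ (σ : ℂ))
          ((-σ / 2 : ℂ) * (g s * x s) * powBase (x s) v ^ ((σ - 1 : ℝ) : ℂ)) Q v := by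
        intro v hv
        refine (((hasDerivAt_powBase_cpow (hs v hv) σ).const_mul (g s)).congr_deriv
          ?_).hasDerivWithinAt
        ring
      have hmv := hconv.norm_image_sub_le_of_norm_hasDerivWithin_le hd hs' hu hy.1
      rw [slope_def_module, norm_smul, norm_inv,
        inv_mul_le_iff₀ (norm_pos_iff.2 (sub_ne_zero.2 hy.2))]
      exact hmv.trans_eq (mul_comm _ _)
    · filter_upwards [hQ.slit] with s hs
      have h1 := ((hasDerivAt_powBase_cpow (hs u hu) σ).const_mul (g s))
      have h2 := (hasDerivAt_iff_tendsto_slope.1 h1).mono_left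
        (nhdsWithin_mono u (show Q \ {u} ⊆ {u}ᶜ from fun y hy => hy.2))
      refine h2.trans (le_of_eq ?_)
      congr 1
      ring
  refine key.congr' ?_
  filter_upwards [hev] with y hy
  exact (hslope y hy.1).symm

/-- Rapid decay survives multiplication by `x`, so the class of these integrals is closed under
differentiation. The derivatives are complex but taken within `Q`, which gives smoothness on a
closed disk without holomorphy across its boundary. -/
theorem IsPowDomain.contDiffOn (hQ : IsPowDomain μ x Q δ M) (hconv : Convex ℝ Q)
    (hu : UniqueDiffOn ℂ Q) (n : ℕ) {g : ℝ → ℂ} (hg : IsRapid μ x g) (σ : ℝ) :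
    ContDiffOn ℂ n (powInt μ x g σ) Q := by
  induction n generalizing g σ with
  | zero =>
    rw [Nat.cast_zero, contDiffOn_zero]
    exact fun u hu' => (hQ.hasDerivWithinAt hconv hg σ hu').continuousWithinAt
  | succ n ih =>
    rw [Nat.cast_succ, contDiffOn_succ_iff_derivWithin hu]
    refine ⟨fun u hu' => (hQ.hasDerivWithinAt hconv hg σ hu').differentiableWithinAt,
      fun h => absurd h (by simp), ?_⟩
    exact (ih (hg.mul_x hQ.measurable _) (σ - 1)).congr fun u hu' =>
      (hQ.hasDerivWithinAt hconv hg σ hu').derivWithin (hu u hu')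

theorem IsPowDomain.contDiffOn_real (hQ : IsPowDomain μ x Q δ M) (hconv : Convex ℝ Q)
    (hu : UniqueDiffOn ℂ Q) {g : ℝ → ℂ} (hg : IsRapid μ x g) (σ : ℝ) :
    ContDiffOn ℝ ∞ (powInt μ x g σ) Q :=
  contDiffOn_infty.2 fun n => (hQ.contDiffOn hconv hu n hg σ).restrict_scalars ℝ

end

theorem uniqueDiffOn_closedBall_complex (c : ℂ) {R : ℝ} (hR : 0 < R) :
    UniqueDiffOn ℂ (Metric.closedBall c R) := fun u hu =>
  (uniqueDiffOn_convex (convex_closedBall c R)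
    (by rw [interior_closedBall _ hR.ne']; exact Metric.nonempty_ball.2 hR) u hu).mono_field

/-! ### The base in the disk coordinate -/

theorem powBase_eq {τ t : ℂ} (ht : t ≠ I) :
    powBase ((τ - I) / I) (uCoord t) = (τ - t) / (I - t) := by
  have h1 : t - I ≠ 0 := sub_ne_zero.2 ht
  have h2 : I - t ≠ 0 := sub_ne_zero.2 ht.symm
  have h3 : (1 - uCoord t) / 2 = I / (I - t) := by
    rw [uCoord]
    field_simp
    ring
  rw [powBase, h3]
  field_simp
  ring

theorem powBase_mob {w u : ℂ} (hw : 1 - w ≠ 0) :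
    powBase ((mob w - I) / I) u = (1 - w * u) / (1 - w) := by
  rw [powBase, mob_sub_I hw]
  field_simp
  ring

/-- A quotient `-s` with `s ≥ 0` would give `a = -s b`, forcing opposite signs of the real parts. It
is applied to `(1 - wu)/(1 - w)`. -/
theorem div_mem_slitPlane {a b : ℂ} (ha : 0 < a.re) (hb : 0 < b.re) : a / b ∈ slitPlane := by
  have hb0 : b ≠ 0 := by rintro rfl; simp at hb
  rw [mem_slitPlane_iff_not_le_zero]
  intro h
  obtain ⟨h1, h2⟩ := Complex.le_def.1 h
  have h3 : a = ((a / b).re : ℂ) * b := by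
    have : a / b = ((a / b).re : ℂ) := Complex.ext (by simp) (by simpa using h2)
    rw [← this]; field_simp
  have h4 := congrArg re h3
  rw [re_ofReal_mul] at h4
  simp only [zero_re] at h1
  nlinarith

theorem one_sub_re_pos {w : ℂ} (hw : ‖w‖ < 1) : 0 < (1 - w).re := by
  simp only [sub_re, one_re, sub_pos]
  exact (re_le_norm w).trans_lt hw

theorem powBase_mob_mem_slitPlane {w u : ℂ} (hw : ‖w‖ < 1) (hwu : ‖w * u‖ < 1) :
    powBase ((mob w - I) / I) u ∈ slitPlane := by
  rw [powBase_mob (one_sub_ne_zero_of_norm_lt hw)]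
  exact div_mem_slitPlane (one_sub_re_pos hwu) (one_sub_re_pos hw)

theorem le_norm_powBase_mob {w u : ℂ} {d : ℝ} (hd : 0 ≤ d) (hw : ‖w‖ < 1) (hwu : ‖w * u‖ ≤ 1 - d) :
    d / 2 ≤ ‖powBase ((mob w - I) / I) u‖ := by
  have h0 := norm_pos_iff.2 (one_sub_ne_zero_of_norm_lt hw)
  rw [powBase_mob (one_sub_ne_zero_of_norm_lt hw), norm_div, div_le_div_iff₀ two_pos h0]
  have h1 := norm_sub_norm_le (1 : ℂ) (w * u)
  have h2 := norm_sub_le (1 : ℂ) w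
  rw [norm_one] at h1 h2
  nlinarith

/-! ### Eichler integrals in the disk coordinate -/

/-- `∫ f(τ) ((τ - t)/(i - t))^σ dτ` along the segment from `z₁` to `z₂`, in terms of
`u = (t + i)/(t - i)`. -/
def segInt (σ : ℝ) (f : ℍ → ℂ) (z₁ z₂ : ℂ) (u : ℂ) : ℂ :=
  powInt (volume.restrict (Ioc 0 1)) (fun s => (z₁ + s * (z₂ - z₁) - I) / I)
    (fun s => f (UpperHalfPlane.ofComplex (z₁ + s * (z₂ - z₁))) * (z₂ - z₁)) σ u

/-- The parameter `(τ - i)/i` of the point `τ = i y`. -/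
def axisParam (y : ℝ) : ℂ := (y * I - I) / I

/-- The differential form `f(τ) dτ` at the point `τ = i y`. -/
def axisForm (f : ℍ → ℂ) (y : ℝ) : ℂ := f (UpperHalfPlane.ofComplex (y * I)) * I

/-- `∫ f(τ) ((τ - t)/(i - t))^σ dτ` along the points `i y` with `y ∈ S`, in terms of
`u = (t + i)/(t - i)`. -/
def axisInt (S : Set ℝ) (σ : ℝ) (f : ℍ → ℂ) (u : ℂ) : ℂ :=
  powInt (volume.restrict S) axisParam (axisForm f) σ u

theorem axisParam_eq (y : ℝ) : axisParam y = ((y - 1 : ℝ) : ℂ) := by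
  rw [axisParam]; field_simp; push_cast; ring

theorem measurable_axisParam : Measurable axisParam := by
  unfold axisParam; fun_prop

theorem continuous_axisParam : Continuous axisParam := by
  unfold axisParam; fun_prop

theorem continuousOn_comp_ofComplex {f : ℍ → ℂ} (hf : MDifferentiable 𝓘(ℂ) 𝓘(ℂ) f) :
    ContinuousOn (fun z => f (UpperHalfPlane.ofComplex z)) {z | 0 < z.im} :=
  (UpperHalfPlane.mdifferentiable_iff.1 hf).continuousOn

theorem IsRapid.of_continuousOn {a b : ℝ} {x g : ℝ → ℂ} (hx : ContinuousOn x (Icc a b))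
    (hg : ContinuousOn g (Icc a b)) : IsRapid (volume.restrict (Ioc a b)) x g := by
  refine ⟨(hg.mono Ioc_subset_Icc_self).aestronglyMeasurable measurableSet_Ioc, fun n => ?_⟩
  exact ((hg.norm.mul ((continuousOn_const.add hx.norm).pow n)).integrableOn_Icc).mono_set
    Ioc_subset_Icc_self

theorem axis_im {y : ℝ} : ((y : ℂ) * I).im = y := by simp

theorem axisForm_continuousOn {f : ℍ → ℂ} (hf : MDifferentiable 𝓘(ℂ) 𝓘(ℂ) f) :
    ContinuousOn (axisForm f) (Ioi 0) :=
  ((continuousOn_comp_ofComplex hf).comp (f := fun y : ℝ => (y : ℂ) * I)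
    (by fun_prop) fun y hy => by
      simpa only [Set.mem_ofPred_eq, axis_im] using mem_Ioi.1 hy).mul continuousOn_const

theorem IsCuspForm.isRapid {r : ℝ} {v : SL(2, ℤ) → ℂˣ} {f : ℍ → ℂ} (hf : IsCuspForm r v f) :
    IsRapid (volume.restrict (Ioi 1)) axisParam (axisForm f) := by
  have hc := axisForm_continuousOn hf.holo
  refine ⟨(hc.mono (Ioi_subset_Ioi zero_le_one)).aestronglyMeasurable measurableSet_Ioi,
    fun n => ?_⟩
  have hc2 : ContinuousOn (fun y => ‖axisForm f y‖ * (1 + ‖axisParam y‖) ^ n) (Ici 1) :=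
    (hc.mono fun y (hy : 1 ≤ y) => zero_lt_one.trans_le hy).norm.mul
      ((continuousOn_const.add continuous_axisParam.continuousOn.norm).pow n)
  have hO : (fun y => ‖axisForm f y‖ * (1 + ‖axisParam y‖) ^ n) =O[atTop]
      fun y : ℝ => y ^ (-2 : ℝ) := by
    -- On the axis `1 + ‖axisParam y‖ = y`, so the weight costs `y ^ n`, and the two extra powers
    -- leave the integrable `y ^ (-2)`.
    have h1 := hf.decay (n + 2)
    have ht : Tendsto (fun y : ℝ => UpperHalfPlane.ofComplex (y * I)) atTop
        UpperHalfPlane.atImInfty := by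
      rw [UpperHalfPlane.atImInfty, tendsto_comap_iff]
      refine tendsto_id.congr' ?_
      filter_upwards [eventually_gt_atTop 0] with y hy
      have : 0 < ((y : ℂ) * I).im := by rwa [axis_im]
      rw [Function.comp, UpperHalfPlane.ofComplex_apply_of_im_pos this, id]
      exact axis_im.symm
    obtain ⟨C, hC⟩ := (h1.comp_tendsto ht).bound
    refine Asymptotics.IsBigO.of_bound C ?_
    filter_upwards [hC, eventually_ge_atTop 1] with y hy hy1
    have hy0 : 0 < y := zero_lt_one.trans_le hy1
    have him : (UpperHalfPlane.ofComplex ((y : ℂ) * I)).im = y := by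
      have : 0 < ((y : ℂ) * I).im := by rwa [axis_im]
      rw [UpperHalfPlane.ofComplex_apply_of_im_pos this]
      exact axis_im
    simp only [Function.comp, him] at hy
    rw [Real.norm_of_nonneg (Real.rpow_nonneg hy0.le _)] at hy
    have hx : 1 + ‖axisParam y‖ = y := by
      rw [axisParam_eq, norm_real, Real.norm_of_nonneg (by linarith)]; ring
    rw [hx, Real.norm_of_nonneg (by positivity), Real.norm_of_nonneg (Real.rpow_nonneg hy0.le _),
      axisForm, norm_mul, norm_I, mul_one]
    calc _ ≤ C * y ^ (-(n + 2 : ℝ)) * y ^ n := by gcongr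
      _ = C * y ^ (-2 : ℝ) := by
        rw [mul_assoc, ← Real.rpow_natCast y n, ← Real.rpow_add hy0]
        congr 2
        ring
  have hint : IntegrableOn (fun y : ℝ => y ^ (-2 : ℝ)) (Ioi 1) :=
    integrableOn_Ioi_rpow_of_lt (by norm_num) one_pos
  exact ((hc2.locallyIntegrableOn measurableSet_Ici).integrableOn_of_isBigO_atTop hO
    ⟨Ioi 1, Ioi_mem_atTop 1, hint⟩).mono_set Ioi_subset_Ici_self

/-- The whole half-axis: the bases have real part at least `1` for `|u| ≤ 1`. -/
theorem isPowDomain_axis :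
    IsPowDomain (volume.restrict (Ioi 1)) axisParam (Metric.closedBall 0 1) 1 1 := by
  have hre : ∀ y : ℝ, 1 < y → ∀ u ∈ Metric.closedBall (0 : ℂ) 1,
      1 ≤ (powBase (axisParam y) u).re := by
    intro y hy u hu
    rw [mem_closedBall_zero_iff] at hu
    have h1 : (powBase (axisParam y) u).re = 1 + (y - 1) * ((1 - u.re) / 2) := by
      rw [powBase, axisParam_eq, add_re, re_ofReal_mul]
      simp
    rw [h1]
    have h2 := (re_le_norm u).trans hu
    nlinarith
  refine ⟨one_pos, zero_le_one, measurable_axisParam, ?_, ?_, fun u hu => by simpa using hu⟩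
  · filter_upwards [ae_restrict_mem measurableSet_Ioi] with y hy u hu
    exact Or.inl (zero_lt_one.trans_le (hre y hy u hu))
  · filter_upwards [ae_restrict_mem measurableSet_Ioi] with y hy u hu
    exact (hre y hy u hu).trans (re_le_norm _)

/-- Points in a smaller disk give bases that are controlled on a larger disk. -/
theorem isPowDomain_of_norm_le {μ : Measure ℝ} {τ : ℝ → ℂ} (hτ : Measurable τ) {m R : ℝ}
    (hm0 : 0 ≤ m) (hR : 0 < R) (hm1 : m < 1) (hmR : m * R < 1)
    (h : ∀ᵐ s ∂μ, τ s + I ≠ 0 ∧ ‖(τ s - I) / (τ s + I)‖ ≤ m) :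
    IsPowDomain μ (fun s => (τ s - I) / I) (Metric.ball 0 R) ((1 - m * R) / 2) R := by
  have hwu : ∀ w : ℂ, ‖w‖ ≤ m → ∀ u ∈ Metric.ball (0 : ℂ) R, ‖w * u‖ ≤ m * R := by
    intro w hw u hu
    rw [mem_ball_zero_iff] at hu
    rw [norm_mul]
    gcongr
  refine ⟨by linarith, hR.le, (hτ.sub_const _).div_const _, ?_, ?_,
    fun u hu => (mem_ball_zero_iff.1 hu).le⟩
  · filter_upwards [h] with s hs u hu
    rw [← mob_disk hs.1]
    exact powBase_mob_mem_slitPlane (hs.2.trans_lt hm1) ((hwu _ hs.2 u hu).trans_lt hmR)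
  · filter_upwards [h] with s hs u hu
    rw [← mob_disk hs.1]
    exact le_norm_powBase_mob (by linarith) (hs.2.trans_lt hm1)
      ((hwu _ hs.2 u hu).trans_eq (by ring))

theorem segment_mem_hypBall {c : ℝ} {z₁ z₂ : ℂ} (h₁ : z₁ ∈ hypBall c) (h₂ : z₂ ∈ hypBall c)
    {s : ℝ} (hs : s ∈ Icc (0 : ℝ) 1) : z₁ + s * (z₂ - z₁) ∈ hypBall c := by
  have h := (convex_ball _ _).add_smul_sub_mem h₁ h₂ hs
  rwa [real_smul] at h

theorem axis_norm_le {y a : ℝ} (hy : 1 ≤ y) (hya : y ≤ a) :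
    ‖((y : ℂ) * I - I) / (y * I + I)‖ ≤ ‖((a : ℂ) * I - I) / (a * I + I)‖ := by
  have h : ∀ b : ℝ, 1 ≤ b → ‖((b : ℂ) * I - I) / (b * I + I)‖ = (b - 1) / (b + 1) := by
    intro b hb
    have h1 : (b : ℂ) * I - I = ((b - 1 : ℝ) : ℂ) * I := by push_cast; ring
    have h2 : (b : ℂ) * I + I = ((b + 1 : ℝ) : ℂ) * I := by push_cast; ring
    rw [h1, h2, mul_div_mul_right _ _ I_ne_zero, ← ofReal_div, norm_real,
      Real.norm_of_nonneg (div_nonneg (by linarith) (by linarith))]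
  rw [h y hy, h a (hy.trans hya), div_le_div_iff₀ (by linarith) (by linarith)]
  nlinarith

theorem IsPowDomain.differentiableOn {μ : Measure ℝ} {x : ℝ → ℂ} {R δ M : ℝ}
    (hQ : IsPowDomain μ x (Metric.ball 0 R) δ M) {g : ℝ → ℂ} (hg : IsRapid μ x g) (σ : ℝ) :
    DifferentiableOn ℂ (powInt μ x g σ) (Metric.ball 0 R) := fun _ hu =>
  (hQ.hasDerivWithinAt (convex_ball 0 R) hg σ hu).differentiableWithinAt

/-- The disk `hypBall m` is Euclidean, hence contains the segment, and `|w| ≤ m` with `m R < 1`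
keeps `1 - wu` away from `0` for `|u| < R`. -/
theorem differentiableOn_segInt {f : ℍ → ℂ} (hf : MDifferentiable 𝓘(ℂ) 𝓘(ℂ) f) {m R : ℝ}
    (hm0 : 0 < m) (hm1 : m < 1) (hR : 0 < R) (hmR : m * R < 1) {z₁ z₂ : ℂ} (h₁ : z₁ ∈ hypBall m)
    (h₂ : z₂ ∈ hypBall m) (σ : ℝ) : DifferentiableOn ℂ (segInt σ f z₁ z₂) (Metric.ball 0 R) := by
  refine IsPowDomain.differentiableOn (isPowDomain_of_norm_le (τ := fun s => z₁ + s * (z₂ - z₁))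
    (by fun_prop) hm0.le hR hm1 hmR ?_) (IsRapid.of_continuousOn (by fun_prop) ?_) σ
  · filter_upwards [ae_restrict_mem measurableSet_Ioc] with s hs
    have h := segment_mem_hypBall h₁ h₂ (Ioc_subset_Icc_self hs)
    have h0 := add_I_ne_zero_of_im_pos (im_pos_of_mem_hypBall hm0 hm1 h)
    exact ⟨h0, ((mem_hypBall_iff hm0 hm1 h0).1 h).le⟩
  · refine ContinuousOn.mul ?_ continuousOn_const
    exact (continuousOn_comp_ofComplex hf).comp (f := fun s : ℝ => z₁ + s * (z₂ - z₁))
      (by fun_prop) fun s hs => im_pos_of_mem_hypBall hm0 hm1 (segment_mem_hypBall h₁ h₂ hs)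

theorem differentiableOn_axisInt {f : ℍ → ℂ} (hf : MDifferentiable 𝓘(ℂ) 𝓘(ℂ) f) {a R : ℝ}
    (ha : 1 ≤ a) (hR : 0 < R) (hmR : ‖((a : ℂ) * I - I) / (a * I + I)‖ * R < 1) (σ : ℝ) :
    DifferentiableOn ℂ (axisInt (Ioc 1 a) σ f) (Metric.ball 0 R) := by
  have hlt : ‖((a : ℂ) * I - I) / (a * I + I)‖ < 1 :=
    norm_disk_lt_one (by rw [axis_im]; linarith)
  refine IsPowDomain.differentiableOn (isPowDomain_of_norm_le (τ := fun y => (y : ℂ) * I)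
    (by fun_prop) (norm_nonneg _) hR hlt hmR ?_)
    (IsRapid.of_continuousOn continuous_axisParam.continuousOn
      ((axisForm_continuousOn hf).mono fun y hy => zero_lt_one.trans_le hy.1)) σ
  filter_upwards [ae_restrict_mem measurableSet_Ioc] with y hy
  exact ⟨add_I_ne_zero_of_im_pos (by rw [axis_im]; linarith [hy.1]), axis_norm_le hy.1.le hy.2⟩

/-! ### The product of Eichler integrals -/

/-- Both arguments lie in `(0, π)`, so their difference stays in the principal range and the
logarithm of the quotient splits. -/
theorem div_cpow_of_im_pos {a b : ℂ} (ha : 0 < a.im) (hb : 0 < b.im) (σ : ℂ) :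
    (a / b) ^ σ = b ^ (-σ) * a ^ σ := by
  have ha0 : a ≠ 0 := by rintro rfl; simp at ha
  have hb0 : b ≠ 0 := by rintro rfl; simp at hb
  have harg : b.arg ≠ Real.pi := fun h => by
    rw [arg_eq_pi_iff] at h; linarith [h.2]
  have hbi : b⁻¹.arg = -b.arg := by rw [arg_inv, if_neg harg]
  have hlog : log (a / b) = log a - log b := by
    rw [div_eq_mul_inv, (log_mul_eq_add_log_iff ha0 (inv_ne_zero hb0)).2, log_inv _ harg,
      sub_eq_add_neg]
    rw [hbi]
    have h2 := (arg_nonneg_iff.2 ha.le)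
    have h3 := (arg_nonneg_iff.2 hb.le)
    have h4 := arg_le_pi a
    have h5 := (arg_lt_pi_iff (z := b)).2 (Or.inr hb.ne')
    exact ⟨by linarith, by linarith⟩
  rw [cpow_def_of_ne_zero (div_ne_zero ha0 hb0), cpow_def_of_ne_zero hb0, cpow_def_of_ne_zero ha0,
    hlog, ← exp_add]
  congr 1
  ring

theorem powBase_cpow_uCoord {τ : ℂ} (hτ : 0 < τ.im) (t : LowerHalf) (σ : ℂ) :
    powBase ((τ - I) / I) (uCoord t) ^ σ = (I - (t : ℂ)) ^ (-σ) * (τ - t) ^ σ := by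
  have ht := t.2
  rw [powBase_eq (by intro h; rw [h, I_im] at ht; linarith), div_cpow_of_im_pos]
  · rw [sub_im]; linarith
  · rw [sub_im, I_im]; linarith

theorem segInt_uCoord {r : ℝ} (f : ℍ → ℂ) {z₁ z₂ : ℂ}
    (h : ∀ s ∈ Icc (0 : ℝ) 1, 0 < (z₁ + s * (z₂ - z₁)).im) (t : LowerHalf) :
    segInt (r - 2) f z₁ z₂ (uCoord t) = (I - (t : ℂ)) ^ (2 - r : ℂ) * eichler r f z₁ z₂ t := by
  rw [segInt, powInt, eichler, intervalIntegral.integral_of_le zero_le_one, ← integral_const_mul]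
  refine setIntegral_congr_fun measurableSet_Ioc fun s hs => ?_
  simp only [eichlerIntegrand]
  rw [powBase_cpow_uCoord (h s (Ioc_subset_Icc_self hs))]
  push_cast
  rw [neg_sub]
  ring

theorem axisInt_uCoord {r : ℝ} (f : ℍ → ℂ) (t : LowerHalf) :
    axisInt (Ioi 1) (r - 2) f (uCoord t) = (I - (t : ℂ)) ^ (2 - r : ℂ) * eichlerToCusp r f t := by
  rw [axisInt, powInt, eichlerToCusp, ← integral_const_mul]
  refine setIntegral_congr_fun measurableSet_Ioi fun y hy => ?_
  simp only [eichlerIntegrand, axisForm, axisParam]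
  rw [powBase_cpow_uCoord (by rw [axis_im]; exact zero_lt_one.trans hy)]
  push_cast
  rw [neg_sub]
  ring

theorem rho_eq : rho = 1 / 2 + (Real.sqrt 3 / 2 : ℝ) * I := by
  have : (Real.pi : ℂ) * I / 3 = ((Real.pi / 3 : ℝ) : ℂ) * I := by push_cast; ring
  rw [rho, this, exp_mul_I, ← ofReal_cos, ← ofReal_sin, Real.cos_pi_div_three,
    Real.sin_pi_div_three]
  push_cast
  ring

theorem rho_im_pos : 0 < rho.im := by
  have h3 : 0 < Real.sqrt 3 := Real.sqrt_pos.2 (by norm_num)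
  rw [rho_eq]
  simp [h3]

theorem rho_sub_one_im_pos : 0 < (rho - 1).im := by
  simpa using rho_im_pos

theorem rho_segment_im_pos (s : ℝ) : 0 < (rho - 1 + s * (rho - (rho - 1))).im := by
  have h : (rho - 1 + s * (rho - (rho - 1))) = rho - 1 + s := by ring
  rw [h]
  simpa using rho_im_pos

/-- The product of Eichler integrals, in terms of `u`; the second is taken over `S`. -/
def cupDisk (r₁ r₂ : ℝ) (f₁ f₂ : ℍ → ℂ) (S : Set ℝ) (u : ℂ) : ℂ :=
  segInt (r₁ - 2) f₁ (rho - 1) rho u * axisInt S (r₂ - 2) f₂ u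

/-- The weights satisfy `r₃ = (2 - r₁) + (2 - r₂)`, so the power of `i - t` splits into precisely
the two factors that normalise the Eichler kernels. -/
theorem extendsMinus_cupDisk {r₁ r₂ r₃ : ℝ} (hr : r₁ + r₂ + r₃ = 4) (f₁ f₂ : ℍ → ℂ) :
    ExtendsMinus r₃ (cupProduct r₁ r₂ f₁ f₂) (cupDisk r₁ r₂ f₁ f₂ (Ioi 1)) := by
  intro t
  have ht := t.2
  have hne : I - (t : ℂ) ≠ 0 := by
    intro h
    have := congrArg im h
    simp at this
    linarith
  have h3 : (r₃ : ℂ) = (2 - r₁) + (2 - r₂) := by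
    have : r₃ = (2 - r₁) + (2 - r₂) := by linarith
    rw [this]; push_cast; ring
  rw [cupDisk, segInt_uCoord f₁ (fun s _ => rho_segment_im_pos s), axisInt_uCoord, cupProduct, h3,
    cpow_add _ _ hne]
  ring

/-- Circles that encircle the segments, and the corresponding radius in the coordinate `u`. -/
theorem exists_radius_differentiableOn_cupDisk {f₁ f₂ : ℍ → ℂ}
    (hf₁ : MDifferentiable 𝓘(ℂ) 𝓘(ℂ) f₁) (hf₂ : MDifferentiable 𝓘(ℂ) 𝓘(ℂ) f₂) (r₁ r₂ : ℝ)
    {a c : ℝ} (ha : 1 ≤ a) (hc1 : c < 1)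
    (h₁ : ‖(rho - 1 - I) / (rho - 1 + I)‖ < c) (h₂ : ‖(rho - I) / (rho + I)‖ < c)
    (h₃ : ‖((a : ℂ) * I - I) / (a * I + I)‖ < c) :
    ∃ R, 1 < R ∧ R⁻¹ < c ∧ DifferentiableOn ℂ (segInt (r₁ - 2) f₁ (rho - 1) rho) (Metric.ball 0 R) ∧
      DifferentiableOn ℂ (cupDisk r₁ r₂ f₁ f₂ (Ioc 1 a)) (Metric.ball 0 R) := by
  have hc0 : 0 < c := (norm_nonneg _).trans_lt h₁
  obtain ⟨m, hm, hmc⟩ := exists_between (max_lt h₁ (max_lt h₂ h₃))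
  have hm1 := (le_max_left _ _).trans_lt hm
  have hm2 := ((le_max_left _ _).trans (le_max_right _ _)).trans_lt hm
  have hm3 := ((le_max_right _ _).trans (le_max_right _ _)).trans_lt hm
  have hm0 : 0 < m := (norm_nonneg _).trans_lt hm1
  -- Three nested radii `m < d < c`: the segments lie inside `m`, and `R = d⁻¹` satisfies both `m R
  -- < 1` and `R⁻¹ < c`.
  obtain ⟨d, hmd, hdc⟩ := exists_between hmc
  have hd0 := hm0.trans hmd
  have hmd' : m * d⁻¹ < 1 := by rwa [← div_eq_mul_inv, div_lt_one hd0]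
  have hseg := differentiableOn_segInt hf₁ hm0 (hmc.trans hc1) (inv_pos.2 hd0) hmd'
    ((mem_hypBall_iff hm0 (hmc.trans hc1) (add_I_ne_zero_of_im_pos rho_sub_one_im_pos)).2 hm1)
    ((mem_hypBall_iff hm0 (hmc.trans hc1) (add_I_ne_zero_of_im_pos rho_im_pos)).2 hm2) (r₁ - 2)
  refine ⟨d⁻¹, (one_lt_inv₀ hd0).2 (hdc.trans hc1), by rwa [inv_inv], hseg, hseg.mul ?_⟩
  refine differentiableOn_axisInt hf₂ ha (inv_pos.2 hd0) (lt_of_le_of_lt ?_ hmd') _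
  have := inv_pos.2 hd0
  gcongr

theorem exists_radius_rho (a : ℝ) (ha : 1 ≤ a) : ∃ c < 1, ‖(rho - 1 - I) / (rho - 1 + I)‖ < c ∧
    ‖(rho - I) / (rho + I)‖ < c ∧ ‖((a : ℂ) * I - I) / (a * I + I)‖ < c := by
  obtain ⟨c, h, hc⟩ := exists_between (max_lt (norm_disk_lt_one rho_sub_one_im_pos)
    (max_lt (norm_disk_lt_one rho_im_pos)
      (norm_disk_lt_one (z := a * I) (by rw [axis_im]; linarith))))
  exact ⟨c, hc, (le_max_left _ _).trans_lt h,
    ((le_max_left _ _).trans (le_max_right _ _)).trans_lt h,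
    ((le_max_right _ _).trans (le_max_right _ _)).trans_lt h⟩

/-! ### Uniform smallness of the tails -/

theorem hasDerivAt_exp_neg_two_mul_I (θ : ℝ) :
    HasDerivAt (fun θ : ℝ => exp (-2 * θ * I)) (exp (-2 * θ * I) * (-2 * I)) θ := by
  have h := (((hasDerivAt_id θ).ofReal_comp.const_mul (-2 : ℂ)).mul_const I).cexp
  simpa using h

theorem contDiff_exp_neg_two_mul_I : ContDiff ℝ ∞ fun θ : ℝ => exp (-2 * θ * I) :=
  ((contDiff_const.mul ofRealCLM.contDiff).mul contDiff_const).cexp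

theorem exp_neg_two_mul_I_mem (θ : ℝ) : exp (-2 * θ * I) ∈ Metric.closedBall (0 : ℂ) 1 := by
  rw [mem_closedBall_zero_iff, norm_exp_neg_two_mul_I]

theorem restrict_Ioi_le {a : ℝ} (ha : 1 ≤ a) :
    (volume.restrict (Ioi a) : Measure ℝ) ≤ volume.restrict (Ioi 1) :=
  Measure.restrict_mono (Ioi_subset_Ioi ha) le_rfl

theorem contDiff_powInt_exp {μ : Measure ℝ} {x g : ℝ → ℂ} {δ M : ℝ}
    (hQ : IsPowDomain μ x (Metric.closedBall 0 1) δ M) (hg : IsRapid μ x g) (σ : ℝ) :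
    ContDiff ℝ ∞ fun θ : ℝ => powInt μ x g σ (exp (-2 * θ * I)) :=
  (hQ.contDiffOn_real (convex_closedBall 0 1) (uniqueDiffOn_closedBall_complex 0 one_pos) hg
    σ).comp_contDiff contDiff_exp_neg_two_mul_I exp_neg_two_mul_I_mem

theorem setIntegral_Ioi_sub_Ioc {E : Type*} [NormedAddCommGroup E] [NormedSpace ℝ E] {G : ℝ → E}
    {b a : ℝ} (hG : IntegrableOn G (Ioi b)) (ha : b ≤ a) :
    (∫ y in Ioi b, G y) - ∫ y in Ioc b a, G y = ∫ y in Ioi a, G y := by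
  have h := setIntegral_union (μ := volume) (f := G) (Ioc_disjoint_Ioi (a := b) (le_refl a))
    measurableSet_Ioi
    (hG.mono_set Ioc_subset_Ioi_self) (hG.mono_set (Ioi_subset_Ioi ha))
  rw [Ioc_union_Ioi_eq_Ioi ha] at h
  rw [h, add_sub_cancel_left]

theorem tendsto_integral_Ioi_atTop {G : ℝ → ℝ} {b : ℝ} (hG : IntegrableOn G (Ioi b)) :
    Tendsto (fun a => ∫ y in Ioi a, G y) atTop (𝓝 0) := by
  have h1 := intervalIntegral_tendsto_integral_Ioi b hG tendsto_id
  have h2 := h1.const_sub (∫ y in Ioi b, G y)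
  rw [sub_self] at h2
  refine h2.congr' ?_
  filter_upwards [eventually_ge_atTop b] with a ha
  rw [id, intervalIntegral.integral_of_le ha, setIntegral_Ioi_sub_Ioc hG ha]

/-- One derivative turns the product into a sum of two products of the same shape, one with `m'` and
one with the differentiated integral and a new periodic smooth factor. Induction over all `m`, `g`,
`σ` thus reduces to `k = 0`, where the tail of a convergent integral bounds everything uniformly in
`θ`. -/
theorem eventually_norm_iteratedDeriv_tail_lt (k : ℕ) {m : ℝ → ℂ} (hm : ContDiff ℝ ∞ m)
    (hp : Function.Periodic m Real.pi) {g : ℝ → ℂ}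
    (hg : IsRapid (volume.restrict (Ioi 1)) axisParam g) (σ : ℝ) {ε : ℝ} (hε : 0 < ε) :
    ∀ᶠ a : ℝ in atTop, ∀ θ, ‖iteratedDeriv k (fun θ : ℝ => m θ *
      powInt (volume.restrict (Ioi a)) axisParam g σ (exp (-2 * θ * I))) θ‖ < ε := by
  induction k generalizing m g σ ε with
  | zero =>
    obtain ⟨B, hB⟩ := exists_norm_le_of_periodic Real.pi_pos hm.continuous hp
    have hB0 : 0 ≤ B := (norm_nonneg _).trans (hB 0)
    have ht := (tendsto_integral_Ioi_atTop (hg.int ⌈σ⌉₊)).const_mul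
      (B * ((1 : ℝ) ^ σ + (1 + 1) ^ ⌈σ⌉₊))
    rw [mul_zero] at ht
    filter_upwards [ht.eventually (gt_mem_nhds hε), eventually_ge_atTop 1] with a h1 ha θ
    rw [iteratedDeriv_zero, norm_mul]
    refine lt_of_le_of_lt ?_ h1
    refine le_of_le_of_eq (mul_le_mul (hB θ) ((isPowDomain_axis.mono (restrict_Ioi_le ha)).norm_powInt_le
      (hg.mono (restrict_Ioi_le ha)) σ (exp_neg_two_mul_I_mem θ)) (norm_nonneg _) hB0)
      (mul_assoc _ _ _).symm
  | succ k ih =>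
    have hm' := (contDiff_infty_iff_deriv.1 hm).2
    have hmu : ContDiff ℝ ∞ fun θ : ℝ => m θ * (exp (-2 * θ * I) * (-2 * I)) :=
      hm.mul (contDiff_exp_neg_two_mul_I.mul contDiff_const)
    have hpu : Function.Periodic (fun θ : ℝ => m θ * (exp (-2 * θ * I) * (-2 * I))) Real.pi := by
      intro θ
      simp only [hp θ, exp_neg_two_mul_add_pi]
    have hg' := hg.mul_x measurable_axisParam (-σ / 2 : ℂ)
    filter_upwards [ih hm' (periodic_deriv hp) hg σ (half_pos hε),
      ih hmu hpu hg' (σ - 1) (half_pos hε), eventually_ge_atTop 1] with a h1 h2 ha θ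
    have hQ := isPowDomain_axis.mono (restrict_Ioi_le ha)
    have hga := hg.mono (restrict_Ioi_le ha)
    have hga' := hg'.mono (restrict_Ioi_le ha)
    have hder : deriv (fun θ : ℝ => m θ *
        powInt (volume.restrict (Ioi a)) axisParam g σ (exp (-2 * θ * I))) =
        (fun θ : ℝ => deriv m θ *
          powInt (volume.restrict (Ioi a)) axisParam g σ (exp (-2 * θ * I))) +
        fun θ : ℝ => m θ * (exp (-2 * θ * I) * (-2 * I)) *
          powInt (volume.restrict (Ioi a)) axisParam (fun s => (-σ / 2 : ℂ) * (g s * axisParam s))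
            (σ - 1) (exp (-2 * θ * I)) := by
      ext θ
      have hT := (hQ.hasDerivWithinAt (convex_closedBall 0 1) hga σ
        (exp_neg_two_mul_I_mem θ)).scomp_hasDerivAt θ (hasDerivAt_exp_neg_two_mul_I θ)
        exp_neg_two_mul_I_mem
      have hmd : HasDerivAt m (deriv m θ) θ := (hm.differentiable (by simp) θ).hasDerivAt
      refine (hmd.mul hT).deriv.trans ?_
      simp only [Pi.add_apply, smul_eq_mul, Function.comp]
      ring
    have c1 : ContDiff ℝ k (fun θ : ℝ => deriv m θ *
        powInt (volume.restrict (Ioi a)) axisParam g σ (exp (-2 * θ * I))) :=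
      (hm'.mul (contDiff_powInt_exp hQ hga σ)).of_le (by exact_mod_cast le_top)
    have c2 : ContDiff ℝ k (fun θ : ℝ => m θ * (exp (-2 * θ * I) * (-2 * I)) *
          powInt (volume.restrict (Ioi a)) axisParam (fun s => (-σ / 2 : ℂ) * (g s * axisParam s))
            (σ - 1) (exp (-2 * θ * I))) :=
      (hmu.mul (contDiff_powInt_exp hQ hga' (σ - 1))).of_le (by exact_mod_cast le_top)
    rw [iteratedDeriv_succ', hder, iteratedDeriv_add c1.contDiffAt c2.contDiffAt]
    exact (norm_add_le _ _).trans_lt (by linarith [h1 θ, h2 θ])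

/-! ### Approximation of the product of Eichler integrals by analytic vectors -/

section

variable {r₁ r₂ : ℝ} {v₂ : SL(2, ℤ) → ℂˣ} {f₁ f₂ : ℍ → ℂ}

theorem contDiffOn_segInt (hf₁ : MDifferentiable 𝓘(ℂ) 𝓘(ℂ) f₁) (σ : ℝ) :
    ContDiffOn ℝ ∞ (segInt σ f₁ (rho - 1) rho) (Metric.closedBall 0 1) := by
  obtain ⟨m, h, hm⟩ := exists_between (max_lt (norm_disk_lt_one rho_sub_one_im_pos)
    (norm_disk_lt_one rho_im_pos))
  have h1 := (le_max_left _ _).trans_lt h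
  have h2 := (le_max_right _ _).trans_lt h
  have hm0 : 0 < m := (norm_nonneg _).trans_lt h1
  obtain ⟨d, hmd, hd⟩ := exists_between hm
  have hd0 := hm0.trans hmd
  have hdiff := differentiableOn_segInt hf₁ hm0 hm (inv_pos.2 hd0)
    (by rwa [← div_eq_mul_inv, div_lt_one hd0])
    ((mem_hypBall_iff hm0 hm (add_I_ne_zero_of_im_pos rho_sub_one_im_pos)).2 h1)
    ((mem_hypBall_iff hm0 hm (add_I_ne_zero_of_im_pos rho_im_pos)).2 h2) σ
  exact ((hdiff.contDiffOn Metric.isOpen_ball (n := ∞)).restrict_scalars ℝ).mono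
    (Metric.closedBall_subset_ball ((one_lt_inv₀ hd0).2 hd))

theorem differentiableOn_segInt_unit (hf₁ : MDifferentiable 𝓘(ℂ) 𝓘(ℂ) f₁) (σ : ℝ) :
    DifferentiableOn ℂ (segInt σ f₁ (rho - 1) rho) (Metric.ball 0 1) := by
  obtain ⟨c, hc, h1, h2, h3⟩ := exists_radius_rho 1 le_rfl
  obtain ⟨R, hR, -, hseg, -⟩ := exists_radius_differentiableOn_cupDisk hf₁ hf₁ (σ + 2) 0 le_rfl hc
    h1 h2 h3
  rw [add_sub_cancel_right] at hseg
  exact hseg.mono (Metric.ball_subset_ball hR.le)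

theorem isPowDomain_axis_subset {S : Set ℝ} (hS : S ⊆ Ioi 1) :
    IsPowDomain (volume.restrict S) axisParam (Metric.closedBall 0 1) 1 1 :=
  isPowDomain_axis.mono (Measure.restrict_mono hS le_rfl)

theorem IsCuspForm.isRapid_subset (hf₂ : IsCuspForm r₂ v₂ f₂) {S : Set ℝ} (hS : S ⊆ Ioi 1) :
    IsRapid (volume.restrict S) axisParam (axisForm f₂) :=
  hf₂.isRapid.mono (Measure.restrict_mono hS le_rfl)

theorem contDiffOn_cupDisk (hf₁ : MDifferentiable 𝓘(ℂ) 𝓘(ℂ) f₁) (hf₂ : IsCuspForm r₂ v₂ f₂)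
    {S : Set ℝ} (hS : S ⊆ Ioi 1) :
    ContDiffOn ℝ ∞ (cupDisk r₁ r₂ f₁ f₂ S) (Metric.closedBall 0 1) :=
  (contDiffOn_segInt hf₁ _).mul ((isPowDomain_axis_subset hS).contDiffOn_real
    (convex_closedBall 0 1) (uniqueDiffOn_closedBall_complex 0 one_pos)
    (hf₂.isRapid_subset hS) _)

theorem differentiableOn_cupDisk (hf₁ : MDifferentiable 𝓘(ℂ) 𝓘(ℂ) f₁)
    (hf₂ : IsCuspForm r₂ v₂ f₂) {S : Set ℝ} (hS : S ⊆ Ioi 1) :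
    DifferentiableOn ℂ (cupDisk r₁ r₂ f₁ f₂ S) (Metric.ball 0 1) := by
  refine (differentiableOn_segInt_unit hf₁ _).mul fun u hu => ?_
  exact ((isPowDomain_axis_subset hS).hasDerivWithinAt (convex_closedBall 0 1)
    (hf₂.isRapid_subset hS) _ (Metric.ball_subset_closedBall hu)).differentiableWithinAt.mono
    Metric.ball_subset_closedBall

/-- Since `(i - t)^r` never vanishes, a vector can be prescribed by its extension in the coordinate
`u`. -/
theorem extendsMinus_div_cpow (r : ℝ) (F : ℂ → ℂ) :
    ExtendsMinus r (fun t : LowerHalf => F (uCoord t) / (I - (t : ℂ)) ^ (r : ℂ)) F := by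
  intro t
  have ht := t.2
  have hne : I - (t : ℂ) ≠ 0 := by
    intro h
    have := congrArg im h
    simp at this
    linarith
  have : (I - (t : ℂ)) ^ (r : ℂ) ≠ 0 := by simp [cpow_eq_zero_iff, hne]
  field_simp

theorem isSmoothExtension_cupDisk_truncated (r₃ : ℝ) (hf₁ : MDifferentiable 𝓘(ℂ) 𝓘(ℂ) f₁)
    (hf₂ : IsCuspForm r₂ v₂ f₂) (a : ℝ) :
    IsSmoothExtension r₃ (fun t : LowerHalf => cupDisk r₁ r₂ f₁ f₂ (Ioc 1 a) (uCoord t) /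
      (I - (t : ℂ)) ^ (r₃ : ℂ)) (cupDisk r₁ r₂ f₁ f₂ (Ioc 1 a)) :=
  ⟨differentiableOn_cupDisk hf₁ hf₂ Ioc_subset_Ioi_self,
    contDiffOn_cupDisk hf₁ hf₂ Ioc_subset_Ioi_self, extendsMinus_div_cpow _ _⟩

/-- The smooth vector obtained from the product of Eichler integrals by replacing the
cusp `∞` with `i a`. -/
def truncatedCup (r₁ r₃ : ℝ) (hf₁ : MDifferentiable 𝓘(ℂ) 𝓘(ℂ) f₁) (hf₂ : IsCuspForm r₂ v₂ f₂)
    (a : ℝ) : SmoothVector r₃ :=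
  ⟨fun t : LowerHalf => cupDisk r₁ r₂ f₁ f₂ (Ioc 1 a) (uCoord t) / (I - (t : ℂ)) ^ (r₃ : ℂ),
    _, isSmoothExtension_cupDisk_truncated r₃ hf₁ hf₂ a⟩

theorem isAnalyticExtension_truncatedCup (r₃ : ℝ) (hf₁ : MDifferentiable 𝓘(ℂ) 𝓘(ℂ) f₁)
    (hf₂ : IsCuspForm r₂ v₂ f₂) {a c : ℝ} (ha : 1 ≤ a) (hc1 : c < 1)
    (h₁ : ‖(rho - 1 - I) / (rho - 1 + I)‖ < c) (h₂ : ‖(rho - I) / (rho + I)‖ < c)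
    (h₃ : ‖((a : ℂ) * I - I) / (a * I + I)‖ < c) :
    ∃ R, R⁻¹ < c ∧ IsAnalyticExtension r₃ (truncatedCup r₁ r₃ hf₁ hf₂ a).toFun R
      (cupDisk r₁ r₂ f₁ f₂ (Ioc 1 a)) := by
  obtain ⟨R, hR, hRc, -, hd⟩ := exists_radius_differentiableOn_cupDisk hf₁ hf₂.holo r₁ r₂ ha hc1
    h₁ h₂ h₃
  exact ⟨R, hRc, hR, hd, extendsMinus_div_cpow _ _⟩

theorem truncatedCup_mem_analyticVectors (r₃ : ℝ) (hf₁ : MDifferentiable 𝓘(ℂ) 𝓘(ℂ) f₁)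
    (hf₂ : IsCuspForm r₂ v₂ f₂) {a : ℝ} (ha : 1 ≤ a) :
    truncatedCup r₁ r₃ hf₁ hf₂ a ∈ analyticVectors r₃ := by
  obtain ⟨c, hc, h1, h2, h3⟩ := exists_radius_rho a ha
  obtain ⟨R, -, h⟩ := isAnalyticExtension_truncatedCup r₃ hf₁ hf₂ ha hc h1 h2 h3
  exact ⟨R, _, h⟩

theorem isSmoothExtension_cupDisk {r₃ : ℝ} (hr : r₁ + r₂ + r₃ = 4)
    (hf₁ : MDifferentiable 𝓘(ℂ) 𝓘(ℂ) f₁) (hf₂ : IsCuspForm r₂ v₂ f₂) :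
    IsSmoothExtension r₃ (cupProduct r₁ r₂ f₁ f₂) (cupDisk r₁ r₂ f₁ f₂ (Ioi 1)) :=
  ⟨differentiableOn_cupDisk hf₁ hf₂ subset_rfl, contDiffOn_cupDisk hf₁ hf₂ subset_rfl,
    extendsMinus_cupDisk hr f₁ f₂⟩

theorem axisInt_Ioi_sub (hf₂ : IsCuspForm r₂ v₂ f₂) {a : ℝ} (ha : 1 ≤ a) (σ : ℝ) {u : ℂ}
    (hu : u ∈ Metric.closedBall (0 : ℂ) 1) :
    axisInt (Ioi 1) σ f₂ u - axisInt (Ioc 1 a) σ f₂ u = axisInt (Ioi a) σ f₂ u := by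
  have hint : IntegrableOn (fun s => axisForm f₂ s * powBase (axisParam s) u ^ (σ : ℂ)) (Ioi 1) :=
    isPowDomain_axis.integrable hf₂.isRapid σ hu
  exact setIntegral_Ioi_sub_Ioc hint ha

/-- The boundary functions differ by a fixed smooth periodic function times the integral over the
remaining half-line above `ia`. -/
theorem tendsto_truncatedCup {r₃ : ℝ} (hr : r₁ + r₂ + r₃ = 4)
    (hf₁ : MDifferentiable 𝓘(ℂ) 𝓘(ℂ) f₁) (hf₂ : IsCuspForm r₂ v₂ f₂)
    (hs : IsSmoothVector r₃ (cupProduct r₁ r₂ f₁ f₂)) :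
    Tendsto (truncatedCup r₁ r₃ hf₁ hf₂) atTop (𝓝 ⟨_, hs⟩) := by
  rw [tendsto_smoothVector_iff]
  intro k
  rw [Metric.tendstoUniformly_iff]
  intro ε hε
  have hm : ContDiff ℝ ∞ fun θ : ℝ => segInt (r₁ - 2) f₁ (rho - 1) rho (exp (-2 * θ * I)) :=
    (contDiffOn_segInt hf₁ _).comp_contDiff contDiff_exp_neg_two_mul_I exp_neg_two_mul_I_mem
  have hp : Function.Periodic
      (fun θ : ℝ => segInt (r₁ - 2) f₁ (rho - 1) rho (exp (-2 * θ * I))) Real.pi := fun θ => by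
    simp only [exp_neg_two_mul_add_pi]
  filter_upwards [eventually_norm_iteratedDeriv_tail_lt k hm hp hf₂.isRapid (r₂ - 2) hε,
    eventually_ge_atTop 1] with a h ha θ
  set φ : SmoothVector r₃ := ⟨_, hs⟩
  have e0 := isSmoothExtension_cupDisk hr hf₁ hf₂
  have e1 := isSmoothExtension_cupDisk_truncated (r₁ := r₁) r₃ hf₁ hf₂ a
  have hsub : φ.boundary - (truncatedCup r₁ r₃ hf₁ hf₂ a).boundary = fun θ : ℝ =>
      segInt (r₁ - 2) f₁ (rho - 1) rho (exp (-2 * θ * I)) *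
        powInt (volume.restrict (Ioi a)) axisParam (axisForm f₂) (r₂ - 2) (exp (-2 * θ * I)) := by
    ext θ
    rw [Pi.sub_apply, φ.boundary_eq e0.2.2 e0.2.1.continuousOn,
      SmoothVector.boundary_eq _ e1.2.2 e1.2.1.continuousOn, cupDisk, cupDisk, ← mul_sub,
      axisInt_Ioi_sub hf₂ ha _ (exp_neg_two_mul_I_mem θ)]
    rfl
  have c0 : ContDiff ℝ k φ.boundary := φ.contDiff_boundary.of_le (by exact_mod_cast le_top)
  have c1 : ContDiff ℝ k (truncatedCup r₁ r₃ hf₁ hf₂ a).boundary :=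
    (SmoothVector.contDiff_boundary _).of_le (by exact_mod_cast le_top)
  rw [dist_eq_norm, ← iteratedDeriv_sub c0.contDiffAt c1.contDiffAt, hsub]
  exact h θ

end

/-! ### The duality integral as a single contour integral -/

theorem summable_add_two_pow_mul_pow (N : ℕ) {c : ℝ} (hc0 : 0 < c) (hc1 : c < 1) :
    Summable fun n : ℕ => (n + 2 : ℝ) ^ N * c ^ n := by
  have h := (summable_nat_add_iff 2).2
    (summable_pow_mul_geometric_of_norm_lt_one (R := ℝ) N (r := c)
      (by rwa [Real.norm_of_nonneg hc0.le]))
  refine (h.mul_right (c ^ 2)⁻¹).congr fun n => ?_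
  push_cast
  rw [pow_add c]
  field_simp

/-- Polynomial growth makes `∑ dualCoef r f n * w ^ n` converge uniformly on `|w| = c < 1`. The
kernel does not depend on `F`, which makes the interchange with the path integrals possible. -/
theorem IsEntireModularForm.exists_kernel {r : ℝ} (hr : 0 < r) {v : SL(2, ℤ) → ℂˣ}
    {f : ℍ → ℂ} (hf : IsEntireModularForm r v f) {c : ℝ} (hc0 : 0 < c) (hc1 : c < 1) :
    ∃ K : ℂ → ℂ, ContinuousOn K (Metric.sphere 0 c) ∧ ∀ F : ℂ → ℂ,
      ContinuousOn (fun w => F w⁻¹) (Metric.sphere 0 c) →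
      ∑' n, dualCoef r f n * aCoef F c n = ∮ w in C(0, c), F w⁻¹ * K w := by
  obtain ⟨C, N, hC0, hC⟩ := hf.exists_norm_dualCoef_le hr
  have hterm : ∀ n, ContinuousOn (fun w : ℂ => (2 * Real.pi * I : ℂ)⁻¹ * (dualCoef r f n * w ^ n) *
      w⁻¹) (Metric.sphere 0 c) := fun n => ContinuousOn.mul (by fun_prop)
    (continuousOn_id.inv₀ fun w hw => ne_zero_of_mem_sphere hc0 hw)
  set M : ℕ → ℝ := fun n => ‖(2 * Real.pi * I : ℂ)⁻¹‖ * (C * ((n + 2 : ℝ) ^ N * c ^ n)) * c⁻¹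
    with hMdef
  have hM : Summable M :=
    (((summable_add_two_pow_mul_pow N hc0 hc1).mul_left C).mul_left _).mul_right _
  have hle : ∀ n, ∀ w ∈ Metric.sphere (0 : ℂ) c,
      ‖(2 * Real.pi * I : ℂ)⁻¹ * (dualCoef r f n * w ^ n) * w⁻¹‖ ≤ M n := by
    intro n w hw
    rw [norm_mul, norm_mul, norm_mul, norm_pow, norm_inv w, mem_sphere_zero_iff_norm.1 hw, hMdef]
    simp only
    rw [← mul_assoc C]
    gcongr
    exact hC n
  refine ⟨fun w => ∑' n, (2 * Real.pi * I : ℂ)⁻¹ * (dualCoef r f n * w ^ n) * w⁻¹,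
    continuousOn_tsum hterm hM hle, fun F hF => ?_⟩
  obtain ⟨B, hB⟩ := (isCompact_sphere (0 : ℂ) c).exists_bound_of_continuousOn hF
  have key := hasSum_circleIntegral hc0.le
    (f := fun n w => F w⁻¹ * ((2 * Real.pi * I : ℂ)⁻¹ * (dualCoef r f n * w ^ n) * w⁻¹))
    (g := fun w => F w⁻¹ * ∑' n, (2 * Real.pi * I : ℂ)⁻¹ * (dualCoef r f n * w ^ n) * w⁻¹)
    (fun n => hF.mul (hterm n)) (hM.mul_left B)
    (fun n w hw => by
      rw [norm_mul]
      exact mul_le_mul (hB w hw) (hle n w hw) (norm_nonneg _) ((norm_nonneg _).trans (hB w hw)))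
    (fun w hw => (Summable.of_norm_bounded hM fun n => hle n w hw).hasSum.mul_left _)
  rw [← key.tsum_eq]
  congr 1
  ext n
  rw [aCoef, ← circleIntegral.integral_const_mul, ← circleIntegral.integral_const_mul]
  refine circleIntegral.integral_congr hc0.le fun w _ => ?_
  ring

/-! ### Path integrals -/

theorem IsEncircledPath.mem_hypBall {c : ℝ} (hc0 : 0 < c) (hc1 : c < 1) {z₁ z₂ : ℂ} {γ : ℝ → ℂ}
    (hγ : IsEncircledPath c z₁ z₂ γ) {s : ℝ} (hs : s ∈ Icc (0 : ℝ) 1) : γ s ∈ hypBall c :=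
  (mem_hypBall_iff hc0 hc1 (add_I_ne_zero_of_im_pos (hγ.2.2.2 s hs).1)).2 (hγ.2.2.2 s hs).2

theorem norm_disk_mul_lt_one {c : ℝ} (hc0 : 0 < c) (hc1 : c < 1) {τ u : ℂ} (hτ : τ ∈ hypBall c)
    (hu : ‖u‖ ≤ c⁻¹) : ‖(τ - I) / (τ + I) * u‖ < 1 := by
  have h0 := add_I_ne_zero_of_im_pos (im_pos_of_mem_hypBall hc0 hc1 hτ)
  have h1 := (mem_hypBall_iff hc0 hc1 h0).1 hτ
  rw [norm_mul]
  calc _ ≤ ‖(τ - I) / (τ + I)‖ * c⁻¹ := by gcongr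
    _ < c * c⁻¹ := by gcongr
    _ = 1 := mul_inv_cancel₀ hc0.ne'

theorem powBase_mem_slitPlane_of_mem_hypBall {c : ℝ} (hc0 : 0 < c) (hc1 : c < 1) {τ u : ℂ}
    (hτ : τ ∈ hypBall c) (hu : ‖u‖ ≤ c⁻¹) : powBase ((τ - I) / I) u ∈ slitPlane := by
  have h0 := add_I_ne_zero_of_im_pos (im_pos_of_mem_hypBall hc0 hc1 hτ)
  have h1 := (mem_hypBall_iff hc0 hc1 h0).1 hτ
  have h2 := norm_disk_mul_lt_one hc0 hc1 hτ hu
  have h3 := powBase_mob_mem_slitPlane (h1.trans hc1) h2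
  rwa [mob_disk h0] at h3

/-- The form `f(τ) ((τ - t)/(i - t))^σ` has a primitive on disks. -/
theorem exists_primitive {f : ℍ → ℂ} (hf : MDifferentiable 𝓘(ℂ) 𝓘(ℂ) f) {c : ℝ} (hc0 : 0 < c)
    (hc1 : c < 1) (σ : ℝ) {u : ℂ} (hu : ‖u‖ ≤ c⁻¹) : ∃ P : ℂ → ℂ, ∀ τ ∈ hypBall c,
      HasDerivAt P (f (UpperHalfPlane.ofComplex τ) * powBase ((τ - I) / I) u ^ (σ : ℂ)) τ := by
  refine DifferentiableOn.isExactOn_ball ?_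
  have h1 := UpperHalfPlane.mdifferentiable_iff.1 hf
  refine (h1.mono fun τ hτ => im_pos_of_mem_hypBall hc0 hc1 hτ).mul ?_
  refine DifferentiableOn.cpow ?_ (differentiableOn_const _) fun τ hτ =>
    powBase_mem_slitPlane_of_mem_hypBall hc0 hc1 hτ hu
  unfold powBase
  fun_prop

theorem continuousOn_form {f : ℍ → ℂ} (hf : MDifferentiable 𝓘(ℂ) 𝓘(ℂ) f) {c : ℝ} (hc0 : 0 < c)
    (hc1 : c < 1) (σ : ℝ) {u : ℂ} (hu : ‖u‖ ≤ c⁻¹) :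
    ContinuousOn (fun τ => f (UpperHalfPlane.ofComplex τ) * powBase ((τ - I) / I) u ^ (σ : ℂ))
      (hypBall c) := by
  refine ((continuousOn_comp_ofComplex hf).mono fun τ hτ => im_pos_of_mem_hypBall hc0 hc1 hτ).mul ?_
  refine ContinuousOn.cpow ?_ continuousOn_const fun τ hτ =>
    powBase_mem_slitPlane_of_mem_hypBall hc0 hc1 hτ hu
  unfold powBase
  fun_prop

theorem integral_form_eq_sub {G P : ℂ → ℂ} {U : Set ℂ} (hP : ∀ τ ∈ U, HasDerivAt P (G τ) τ)
    (hG : ContinuousOn G U) {a b : ℝ} (hab : a ≤ b) {γ γ' : ℝ → ℂ}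
    (hγ : ∀ s ∈ Icc a b, HasDerivAt γ (γ' s) s) (hγ' : ContinuousOn γ' (Icc a b))
    (hU : MapsTo γ (Icc a b) U) : ∫ s in a..b, G (γ s) * γ' s = P (γ b) - P (γ a) := by
  have hc : ContinuousOn γ (Icc a b) := fun s hs => (hγ s hs).continuousAt.continuousWithinAt
  refine intervalIntegral.integral_eq_sub_of_hasDerivAt (f := fun s => P (γ s)) (fun s hs => ?_) ?_
  · rw [uIcc_of_le hab] at hs
    exact (hP _ (hU hs)).comp s (hγ s hs)
  · exact ((hG.comp hc hU).mul hγ').intervalIntegrable_of_Icc hab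

/-- The path and the segment both stay in the disk `hypBall c`, on which the integrand has a
primitive. The endpoint case `|u| = c⁻¹` is allowed because the disk is open; it is the case needed
on the contour `|w| = c`. -/
theorem pathIntegral_eq_segInt {f : ℍ → ℂ} (hf : MDifferentiable 𝓘(ℂ) 𝓘(ℂ) f) {c : ℝ}
    (hc0 : 0 < c) (hc1 : c < 1) {z₁ z₂ : ℂ} {γ : ℝ → ℂ} (hγ : IsEncircledPath c z₁ z₂ γ)
    (σ : ℝ) {u : ℂ} (hu : ‖u‖ ≤ c⁻¹) :
    pathIntegral γ (fun τ => f (UpperHalfPlane.ofComplex τ) * powBase ((τ - I) / I) u ^ (σ : ℂ)) =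
      segInt σ f z₁ z₂ u := by
  obtain ⟨P, hP⟩ := exists_primitive hf hc0 hc1 σ hu
  have hG := continuousOn_form hf hc0 hc1 σ hu
  have hm := fun s hs => hγ.mem_hypBall hc0 hc1 (s := s) hs
  rw [pathIntegral, integral_form_eq_sub hP hG zero_le_one
    (fun s _ => (hγ.1.differentiable one_ne_zero s).hasDerivAt)
    (hγ.1.continuous_deriv le_rfl).continuousOn hm, hγ.2.1, hγ.2.2.1]
  have h1 : z₁ ∈ hypBall c := by have := hm 0 (by simp); rwa [hγ.2.1] at this
  have h2 : z₂ ∈ hypBall c := by have := hm 1 (by simp); rwa [hγ.2.2.1] at this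
  have key := integral_form_eq_sub hP hG zero_le_one (γ := fun s : ℝ => z₁ + s * (z₂ - z₁))
    (γ' := fun _ => z₂ - z₁) (fun s _ => by
      have := (((hasDerivAt_id s).ofReal_comp).mul_const (z₂ - z₁)).const_add z₁
      simpa using this) continuousOn_const fun s hs => segment_mem_hypBall h1 h2 hs
  simp only [ofReal_one, one_mul, add_sub_cancel, ofReal_zero, zero_mul, add_zero] at key
  rw [← key, segInt, powInt, intervalIntegral.integral_of_le zero_le_one]
  refine setIntegral_congr_fun measurableSet_Ioc fun s _ => ?_
  ring

theorem pathIntegral_eq_axisInt {f : ℍ → ℂ} (hf : MDifferentiable 𝓘(ℂ) 𝓘(ℂ) f) {c a : ℝ}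
    (hc0 : 0 < c) (hc1 : c < 1) (ha : 1 ≤ a) {γ : ℝ → ℂ} (hγ : IsEncircledPath c I (a * I) γ)
    (σ : ℝ) {u : ℂ} (hu : ‖u‖ ≤ c⁻¹) :
    pathIntegral γ (fun τ => f (UpperHalfPlane.ofComplex τ) * powBase ((τ - I) / I) u ^ (σ : ℂ)) =
      axisInt (Ioc 1 a) σ f u := by
  obtain ⟨P, hP⟩ := exists_primitive hf hc0 hc1 σ hu
  have hG := continuousOn_form hf hc0 hc1 σ hu
  have hm := fun s hs => hγ.mem_hypBall hc0 hc1 (s := s) hs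
  rw [pathIntegral, integral_form_eq_sub hP hG zero_le_one
    (fun s _ => (hγ.1.differentiable one_ne_zero s).hasDerivAt)
    (hγ.1.continuous_deriv le_rfl).continuousOn hm, hγ.2.1, hγ.2.2.1]
  have h2 : (a * I : ℂ) ∈ hypBall c := by have := hm 1 (by simp); rwa [hγ.2.2.1] at this
  have h3 := (mem_hypBall_iff hc0 hc1
    (add_I_ne_zero_of_im_pos (by rw [axis_im]; linarith))).1 h2
  have key := integral_form_eq_sub hP hG ha (γ := fun y : ℝ => (y : ℂ) * I)
    (γ' := fun _ => I) (fun s _ => by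
      have := ((hasDerivAt_id s).ofReal_comp).mul_const I
      simpa using this) continuousOn_const fun s hs =>
        (mem_hypBall_iff hc0 hc1
          (add_I_ne_zero_of_im_pos (by rw [axis_im]; linarith [hs.1]))).2
          ((axis_norm_le hs.1 hs.2).trans_lt h3)
  simp only [ofReal_one, one_mul] at key
  rw [← key, axisInt, powInt, intervalIntegral.integral_of_le ha]
  refine setIntegral_congr_fun measurableSet_Ioc fun s _ => ?_
  simp only [axisForm, axisParam]
  ring

/-! ### Interchange of integrals -/

/-- Fubini for an integrand continuous on a compact rectangle: an encircled path keeps the base in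
the slit plane for all `w` on the circle. -/
theorem pathIntegral_circleIntegral_swap {f : ℍ → ℂ} (hf : MDifferentiable 𝓘(ℂ) 𝓘(ℂ) f) {c : ℝ}
    (hc0 : 0 < c) (hc1 : c < 1) {z₁ z₂ : ℂ} {γ : ℝ → ℂ} (hγ : IsEncircledPath c z₁ z₂ γ) (σ : ℝ)
    {G : ℂ → ℂ} (hG : ContinuousOn G (Metric.sphere 0 c)) :
    pathIntegral γ (fun τ => f (UpperHalfPlane.ofComplex τ) *
      ∮ w in C(0, c), powBase ((τ - I) / I) w⁻¹ ^ (σ : ℂ) * G w) =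
    ∮ w in C(0, c), pathIntegral γ (fun τ => f (UpperHalfPlane.ofComplex τ) *
      powBase ((τ - I) / I) w⁻¹ ^ (σ : ℂ)) * G w := by
  have hm := fun s hs => hγ.mem_hypBall hc0 hc1 (s := s) hs
  have hγc := hγ.1.continuous
  have hcm := continuous_circleMap 0 c
  have hcm0 : ∀ t, circleMap 0 c t ≠ 0 := fun t => circleMap_ne_center hc0.ne'
  set Φ : ℝ → ℝ → ℂ := fun s t => f (UpperHalfPlane.ofComplex (γ s)) *
    powBase ((γ s - I) / I) (circleMap 0 c t)⁻¹ ^ (σ : ℂ) * deriv γ s *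
    (G (circleMap 0 c t) * deriv (circleMap 0 c) t) with hΦ
  have hΦc : ContinuousOn (Function.uncurry Φ) (Icc (0 : ℝ) 1 ×ˢ Icc (0 : ℝ) (2 * Real.pi)) := by
    have h1 : ContinuousOn (fun p : ℝ × ℝ => f (UpperHalfPlane.ofComplex (γ p.1)))
        (Icc (0 : ℝ) 1 ×ˢ Icc (0 : ℝ) (2 * Real.pi)) :=
      (continuousOn_comp_ofComplex hf).comp (hγc.comp continuous_fst).continuousOn fun p hp =>
        (hγ.2.2.2 p.1 hp.1).1
    have h2 : ContinuousOn (fun p : ℝ × ℝ =>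
        powBase ((γ p.1 - I) / I) (circleMap 0 c p.2)⁻¹ ^ (σ : ℂ))
        (Icc (0 : ℝ) 1 ×ˢ Icc (0 : ℝ) (2 * Real.pi)) := by
      refine ContinuousOn.cpow ?_ continuousOn_const fun p hp =>
        powBase_mem_slitPlane_of_mem_hypBall hc0 hc1 (hm p.1 hp.1) ?_
      · have h3 : Continuous fun p : ℝ × ℝ => (circleMap 0 c p.2)⁻¹ :=
          (hcm.comp continuous_snd).inv₀ fun p => hcm0 p.2
        unfold powBase
        fun_prop
      · rw [norm_inv, norm_circleMap_zero, abs_of_pos hc0]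
    have h4 : Continuous fun p : ℝ × ℝ => deriv γ p.1 :=
      (hγ.1.continuous_deriv le_rfl).comp continuous_fst
    have h5 : Continuous fun t : ℝ => G (circleMap 0 c t) :=
      hG.comp_continuous hcm (circleMap_mem_sphere 0 hc0.le)
    have h6 : Continuous fun t : ℝ => deriv (circleMap 0 c) t := by
      simp only [deriv_circleMap]
      exact hcm.mul continuous_const
    exact ((h1.mul h2).mul h4.continuousOn).mul
      ((h5.comp continuous_snd).mul (h6.comp continuous_snd)).continuousOn
  have hint : IntegrableOn (Function.uncurry Φ) (uIoc (0 : ℝ) 1 ×ˢ uIoc (0 : ℝ) (2 * Real.pi)) := by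
    refine (hΦc.integrableOn_compact (isCompact_Icc.prod isCompact_Icc)).mono_set ?_
    rw [uIoc_of_le zero_le_one, uIoc_of_le (by positivity)]
    exact prod_mono Ioc_subset_Icc_self Ioc_subset_Icc_self
  have hswap := intervalIntegral_intervalIntegral_swap hint
  simp only [pathIntegral, circleIntegral]
  calc _ = ∫ s in (0 : ℝ)..1, ∫ t in (0 : ℝ)..(2 * Real.pi), Φ s t := by
        refine intervalIntegral.integral_congr fun s _ => ?_
        rw [mul_right_comm, ← intervalIntegral.integral_const_mul]
        refine intervalIntegral.integral_congr fun t _ => ?_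
        simp only [hΦ, smul_eq_mul]
        ring
    _ = _ := hswap
    _ = _ := by
        refine intervalIntegral.integral_congr fun t _ => ?_
        simp only [hΦ, smul_eq_mul]
        rw [intervalIntegral.integral_mul_const]
        ring

/-! ### The inner double integral -/

/-- The product of the two modified Eichler kernels, in terms of `u`. -/
def kernelProd (r₁ r₂ : ℝ) (τ₁ τ₂ u : ℂ) : ℂ :=
  powBase ((τ₁ - I) / I) u ^ ((r₁ - 2 : ℝ) : ℂ) * powBase ((τ₂ - I) / I) u ^ ((r₂ - 2 : ℝ) : ℂ)

theorem ne_of_mem_diskCircle {c : ℝ} (hc0 : 0 < c) (hc1 : c < 1) {z : ℂ}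
    (hz : z ∈ Metric.sphere ((((1 + c ^ 2) / (1 - c ^ 2) : ℝ) : ℂ) * I) (2 * c / (1 - c ^ 2))) :
    z - I ≠ 0 ∧ z + I ≠ 0 := by
  rw [mem_diskCircle_iff hc0 hc1] at hz
  constructor <;> intro h <;> rw [h] at hz <;> simp at hz <;> exact hc0.ne hz

theorem diskCircleIntegral_congr {c : ℝ} (hc0 : 0 < c) (hc1 : c < 1) {F G : ℂ → ℂ}
    (h : ∀ z, z - I ≠ 0 → z + I ≠ 0 → F z = G z) :
    diskCircleIntegral c F = diskCircleIntegral c G := by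
  have h1 : 0 < 1 - c ^ 2 := by nlinarith
  refine circleIntegral.integral_congr (by positivity) fun z hz => ?_
  obtain ⟨h2, h3⟩ := ne_of_mem_diskCircle hc0 hc1 hz
  exact h z h2 h3

/-- The factor `(z + i)/(z - i)` of the lift together with `(z + i)⁻²` makes `1/(z² + 1)`, and the
modified Eichler kernels are powers of the bases in the coordinate `u`. -/
theorem inner_integral_eq_dualityIntegral (r₁ r₂ r₃ : ℝ) (f₃ : ℍ → ℂ) {c₁ c₂ : ℝ} (hc0 : 0 < c₁)
    (hc12 : c₁ < c₂) (hc2 : c₂ < 1) (τ₁ τ₂ : ℂ) :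
    (1 / Real.pi * diskCircleIntegral c₂ fun z =>
        f₃ (UpperHalfPlane.ofComplex z) * (-z - I) ^ (r₃ : ℂ) *
          (1 / Real.pi * diskCircleIntegral c₁ fun τ =>
            ₂F₁ (1 : ℂ) 1 (r₃ : ℂ) (((τ - I) * (z + I)) / ((τ + I) * (z - I))) *
              modKernel r₁ τ₁ τ * modKernel r₂ τ₂ τ / (τ ^ 2 + 1)) / (z ^ 2 + 1)) =
      dualityIntegral r₃ f₃ (kernelProd r₁ r₂ τ₁ τ₂) c₁ c₂ := by
  rw [dualityIntegral]
  congr 1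
  refine diskCircleIntegral_congr (hc0.trans hc12) hc2 fun z hz1 hz2 => ?_
  rw [sigmaLift]
  have hin : (diskCircleIntegral c₁ fun τ =>
      ₂F₁ (1 : ℂ) 1 (r₃ : ℂ) (((τ - I) * (z + I)) / ((τ + I) * (z - I))) *
        modKernel r₁ τ₁ τ * modKernel r₂ τ₂ τ / (τ ^ 2 + 1)) =
      diskCircleIntegral c₁ fun τ => kernelProd r₁ r₂ τ₁ τ₂ (uCoord τ) *
        ₂F₁ (1 : ℂ) 1 (r₃ : ℂ) (((τ - I) * (z + I)) / ((τ + I) * (z - I))) / (τ ^ 2 + 1) := by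
    refine diskCircleIntegral_congr hc0 (hc12.trans hc2) fun τ h1 _ => ?_
    rw [kernelProd, powBase_eq (sub_ne_zero.1 h1), powBase_eq (sub_ne_zero.1 h1), modKernel,
      modKernel]
    push_cast
    ring
  rw [hin]
  generalize (diskCircleIntegral c₁ fun τ => kernelProd r₁ r₂ τ₁ τ₂ (uCoord τ) *
        ₂F₁ (1 : ℂ) 1 (r₃ : ℂ) (((τ - I) * (z + I)) / ((τ + I) * (z - I))) / (τ ^ 2 + 1)) = X
  have e1 : z ^ 2 + 1 = (z - I) * (z + I) := by linear_combination I_sq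
  have e2 : -z - I = -I - z := by ring
  rw [e1, e2]
  field_simp

theorem continuousOn_kernel_inv {c : ℝ} (hc0 : 0 < c) (hc1 : c < 1) {τ : ℂ} (hτ : τ ∈ hypBall c)
    (σ : ℝ) : ContinuousOn (fun w : ℂ => powBase ((τ - I) / I) w⁻¹ ^ (σ : ℂ))
      (Metric.sphere 0 c) := by
  refine ContinuousOn.cpow ?_ continuousOn_const fun w hw =>
    powBase_mem_slitPlane_of_mem_hypBall hc0 hc1 hτ
      (by rw [norm_inv, mem_sphere_zero_iff_norm.1 hw])
  have h3 : ContinuousOn (fun w : ℂ => w⁻¹) (Metric.sphere 0 c) :=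
    continuousOn_id.inv₀ fun w hw => ne_zero_of_mem_sphere hc0 hw
  unfold powBase
  fun_prop

theorem pathIntegral_congr {γ : ℝ → ℂ} {F G : ℂ → ℂ}
    (h : ∀ s ∈ Icc (0 : ℝ) 1, F (γ s) = G (γ s)) : pathIntegral γ F = pathIntegral γ G := by
  refine intervalIntegral.integral_congr fun s hs => ?_
  rw [uIcc_of_le zero_le_one] at hs
  simp only [h s hs]

/-- The duality integral of the kernel product is a contour integral against `K`. The integrals over
`τ₂` and then `τ₁` are carried under it and evaluated pointwise on the contour, which rebuilds the
truncated product there. Its coefficients on `|w| = c₁` are its boundary Fourier coefficients. -/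
theorem fourfold_eq_coefPairing {r₁ r₂ r₃ : ℝ} (hr₃ : 0 < r₃) {v₂ v₃ : SL(2, ℤ) → ℂˣ}
    {f₁ f₂ f₃ : ℍ → ℂ} (hf₁ : MDifferentiable 𝓘(ℂ) 𝓘(ℂ) f₁) (hf₂ : IsCuspForm r₂ v₂ f₂)
    (hf₃ : IsEntireModularForm r₃ v₃ f₃) {a c₁ c₂ : ℝ} (ha : 1 ≤ a) (hc12 : c₁ < c₂) (hc2 : c₂ < 1)
    {γ₁ γ₂ : ℝ → ℂ} (hγ₁ : IsEncircledPath c₁ (rho - 1) rho γ₁)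
    (hγ₂ : IsEncircledPath c₁ I (a * I) γ₂) :
    fourfold r₁ r₂ r₃ f₁ f₂ f₃ γ₁ γ₂ c₁ c₂ =
      coefPairing (dualCoef r₃ f₃) (truncatedCup r₁ r₃ hf₁ hf₂ a) := by
  have hc1 := hc12.trans hc2
  have h₁ : ‖(rho - 1 - I) / (rho - 1 + I)‖ < c₁ := by
    have := (hγ₁.2.2.2 0 (by simp)).2
    rwa [hγ₁.2.1] at this
  have h₂ : ‖(rho - I) / (rho + I)‖ < c₁ := by
    have := (hγ₁.2.2.2 1 (by simp)).2
    rwa [hγ₁.2.2.1] at this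
  have h₃ : ‖((a : ℂ) * I - I) / (a * I + I)‖ < c₁ := by
    have := (hγ₂.2.2.2 1 (by simp)).2
    rwa [hγ₂.2.2.1] at this
  have hc0 : 0 < c₁ := (norm_nonneg _).trans_lt h₁
  obtain ⟨K, hK, hKF⟩ := hf₃.exists_kernel hr₃ hc0 hc1
  obtain ⟨R, hRc, hext⟩ := isAnalyticExtension_truncatedCup (r₁ := r₁) r₃ hf₁ hf₂ ha hc1 h₁ h₂ h₃
  have hinv : ∀ {R : ℝ} {F : ℂ → ℂ}, 0 < R → R⁻¹ < c₁ → DifferentiableOn ℂ F (Metric.ball 0 R) →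
      ContinuousOn (fun w => F w⁻¹) (Metric.sphere 0 c₁) := by
    intro R F hR hRc hF
    refine hF.continuousOn.comp
      (continuousOn_id.inv₀ fun w hw => ne_zero_of_mem_sphere hc0 hw) fun w hw => ?_
    rw [mem_ball_zero_iff, norm_inv, mem_sphere_zero_iff_norm.1 hw]
    exact inv_lt_of_inv_lt₀ hR hRc
  have hnorm : ∀ w ∈ Metric.sphere (0 : ℂ) c₁, ‖w⁻¹‖ ≤ c₁⁻¹ := fun w hw => by
    rw [norm_inv, mem_sphere_zero_iff_norm.1 hw]
  have hax : ContinuousOn (fun w : ℂ => axisInt (Ioc 1 a) (r₂ - 2) f₂ w⁻¹)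
      (Metric.sphere 0 c₁) := by
    obtain ⟨d, hd, hdc⟩ := exists_between h₃
    have hd0 := (norm_nonneg _).trans_lt hd
    exact hinv (inv_pos.2 hd0) (by rwa [inv_inv]) (differentiableOn_axisInt hf₂.holo ha
      (inv_pos.2 hd0) (by rwa [← div_eq_mul_inv, div_lt_one hd0]) _)
  -- For single points `τ₁`, `τ₂` the kernel product is not needed as an analytic vector; continuity
  -- on `|w| = c₁` suffices for the series and the kernel formula.
  have hinner : ∀ τ₁ ∈ hypBall c₁, ∀ τ₂ ∈ hypBall c₁,
      dualityIntegral r₃ f₃ (kernelProd r₁ r₂ τ₁ τ₂) c₁ c₂ =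
        ∮ w in C(0, c₁), powBase ((τ₂ - I) / I) w⁻¹ ^ ((r₂ - 2 : ℝ) : ℂ) *
          (powBase ((τ₁ - I) / I) w⁻¹ ^ ((r₁ - 2 : ℝ) : ℂ) * K w) := by
    intro τ₁ hτ₁ τ₂ hτ₂
    have hcont : ContinuousOn (fun w => kernelProd r₁ r₂ τ₁ τ₂ w⁻¹) (Metric.sphere 0 c₁) :=
      (continuousOn_kernel_inv hc0 hc1 hτ₁ _).mul (continuousOn_kernel_inv hc0 hc1 hτ₂ _)
    rw [← (hasSum_dualityIntegral_dualCoef hr₃ hf₃.holo hc0 hc12 hc2 hcont).tsum_eq, hKF _ hcont]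
    refine circleIntegral.integral_congr hc0.le fun w _ => ?_
    simp only [kernelProd]
    ring
  have hmid : ∀ τ₁ ∈ hypBall c₁, (pathIntegral γ₂ fun τ₂ => f₂ (UpperHalfPlane.ofComplex τ₂) *
      dualityIntegral r₃ f₃ (kernelProd r₁ r₂ τ₁ τ₂) c₁ c₂) =
        ∮ w in C(0, c₁), powBase ((τ₁ - I) / I) w⁻¹ ^ ((r₁ - 2 : ℝ) : ℂ) *
          (axisInt (Ioc 1 a) (r₂ - 2) f₂ w⁻¹ * K w) := by
    intro τ₁ hτ₁
    have e : (pathIntegral γ₂ fun τ₂ => f₂ (UpperHalfPlane.ofComplex τ₂) *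
        dualityIntegral r₃ f₃ (kernelProd r₁ r₂ τ₁ τ₂) c₁ c₂) =
        pathIntegral γ₂ fun τ₂ => f₂ (UpperHalfPlane.ofComplex τ₂) *
          ∮ w in C(0, c₁), powBase ((τ₂ - I) / I) w⁻¹ ^ ((r₂ - 2 : ℝ) : ℂ) *
            (powBase ((τ₁ - I) / I) w⁻¹ ^ ((r₁ - 2 : ℝ) : ℂ) * K w) :=
      pathIntegral_congr fun s hs => by rw [hinner τ₁ hτ₁ _ (hγ₂.mem_hypBall hc0 hc1 hs)]
    rw [e, pathIntegral_circleIntegral_swap hf₂.holo hc0 hc1 hγ₂ (r₂ - 2)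
      (G := fun w => powBase ((τ₁ - I) / I) w⁻¹ ^ ((r₁ - 2 : ℝ) : ℂ) * K w)
      ((continuousOn_kernel_inv hc0 hc1 hτ₁ _).mul hK)]
    refine circleIntegral.integral_congr hc0.le fun w hw => ?_
    rw [pathIntegral_eq_axisInt hf₂.holo hc0 hc1 ha hγ₂ _ (hnorm w hw)]
    ring
  have hfour : fourfold r₁ r₂ r₃ f₁ f₂ f₃ γ₁ γ₂ c₁ c₂ =
      pathIntegral γ₁ fun τ₁ => f₁ (UpperHalfPlane.ofComplex τ₁) *
        ∮ w in C(0, c₁), powBase ((τ₁ - I) / I) w⁻¹ ^ ((r₁ - 2 : ℝ) : ℂ) *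
          (axisInt (Ioc 1 a) (r₂ - 2) f₂ w⁻¹ * K w) := by
    simp only [fourfold, inner_integral_eq_dualityIntegral r₁ r₂ r₃ f₃ hc0 hc12 hc2]
    exact pathIntegral_congr fun s hs => by rw [hmid _ (hγ₁.mem_hypBall hc0 hc1 hs)]
  rw [hfour, pathIntegral_circleIntegral_swap hf₁ hc0 hc1 hγ₁ (r₁ - 2)
    (G := fun w => axisInt (Ioc 1 a) (r₂ - 2) f₂ w⁻¹ * K w) (hax.mul hK)]
  have hcup := hKF _ (hinv (zero_lt_one.trans hext.1) hRc hext.2.1)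
  have hlast : (∮ w in C(0, c₁), pathIntegral γ₁ (fun τ => f₁ (UpperHalfPlane.ofComplex τ) *
      powBase ((τ - I) / I) w⁻¹ ^ ((r₁ - 2 : ℝ) : ℂ)) *
        (axisInt (Ioc 1 a) (r₂ - 2) f₂ w⁻¹ * K w)) =
      ∮ w in C(0, c₁), cupDisk r₁ r₂ f₁ f₂ (Ioc 1 a) w⁻¹ * K w := by
    refine circleIntegral.integral_congr hc0.le fun w hw => ?_
    rw [pathIntegral_eq_segInt hf₁ hc0 hc1 hγ₁ _ (hnorm w hw), cupDisk]
    ring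
  rw [hlast, ← hcup, coefPairing]
  congr 1
  ext n
  rw [hext.aCoef_eq hRc hc1.le]

end ModularCup

end

/-! ### The trilinear form as a limit of fourfold integrals -/

theorem mainTheorem8 (r₁ r₂ r₃ : ℝ) (v₁ v₂ v₃ : SL(2, ℤ) → ℂˣ)
    (hr : r₁ + r₂ + r₃ = 4) (hr₂ : 0 < r₂) (hr₃ : 0 < r₃)
    (hv₁ : ModularCup.IsMultiplierSystem r₁ v₁) (hv₂ : ModularCup.IsMultiplierSystem r₂ v₂)
    (hv₃ : ModularCup.IsMultiplierSystem r₃ v₃) (hv : v₁ * v₂ * v₃ = 1)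
    (f₁ f₂ f₃ : ℍ → ℂ)
    (hf₁ : ModularCup.IsAutomorphicForm r₁ v₁ f₁) (hf₂ : ModularCup.IsCuspForm r₂ v₂ f₂)
    (hf₃ : ModularCup.IsEntireModularForm r₃ v₃ f₃) :
    -- `T(f₁, f₂, f₃)` is well defined: the product of Eichler integrals lies in `D^∞`, in the
    -- closure of `D^ω`, and `[f₃, ·]` on `D^ω` has there the limit `T(f₁, f₂, f₃)`
    (∃ hs : ModularCup.IsSmoothVector r₃ (ModularCup.cupProduct r₁ r₂ f₁ f₂),
      (⟨_, hs⟩ : ModularCup.SmoothVector r₃) ∈ closure (ModularCup.analyticVectors r₃) ∧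
      Tendsto (fun φ : ModularCup.SmoothVector r₃ =>
          ModularCup.dualityAnalytic r₃ f₃ φ.toFun)
        (𝓝[ModularCup.analyticVectors r₃] ⟨_, hs⟩)
        (𝓝 (ModularCup.trilinear r₁ r₂ r₃ f₁ f₂ f₃))) ∧
    -- the limit formula, for every choice of circles and encircled paths
    ∀ (c₁ c₂ : ℝ → ℝ) (γ₁ γ₂ : ℝ → ℝ → ℂ),
      (∀ a : ℝ, 1 < a → c₁ a < c₂ a ∧ c₂ a < 1 ∧
        ModularCup.IsEncircledPath (c₁ a) (ModularCup.rho - 1) ModularCup.rho (γ₁ a) ∧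
        ModularCup.IsEncircledPath (c₁ a) I (a * I) (γ₂ a)) →
      Tendsto
        (fun a : ℝ => ModularCup.fourfold r₁ r₂ r₃ f₁ f₂ f₃ (γ₁ a) (γ₂ a) (c₁ a) (c₂ a))
        atTop (𝓝 (ModularCup.trilinear r₁ r₂ r₃ f₁ f₂ f₃)) := by
  have hs : ModularCup.IsSmoothVector r₃ (ModularCup.cupProduct r₁ r₂ f₁ f₂) :=
    ⟨_, ModularCup.isSmoothExtension_cupDisk hr hf₁.holo hf₂⟩
  have hlim := ModularCup.tendsto_truncatedCup hr hf₁.holo hf₂ hs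
  have hcl : (⟨_, hs⟩ : ModularCup.SmoothVector r₃) ∈
      closure (ModularCup.analyticVectors r₃) := by
    refine mem_closure_of_tendsto hlim ?_
    filter_upwards [eventually_ge_atTop 1] with a ha
    exact ModularCup.truncatedCup_mem_analyticVectors r₃ hf₁.holo hf₂ ha
  obtain ⟨hT, hd⟩ := ModularCup.duality_eq_coefPairing hr₃ hf₃ hcl
  have htri : ModularCup.trilinear r₁ r₂ r₃ f₁ f₂ f₃ =
      ModularCup.coefPairing (ModularCup.dualCoef r₃ f₃) ⟨_, hs⟩ := by
    rw [ModularCup.trilinear, dif_pos hs, hd]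
  rw [htri]
  refine ⟨⟨hs, hcl, hT⟩, fun c₁ c₂ γ₁ γ₂ h => ?_⟩
  -- Continuity of the pairing on `D^∞` gives the limit along the truncated products. For each `a >
  -- 1` the fourfold integral equals that pairing whatever circles and paths are chosen, so no
  -- uniformity in the choices is required.
  refine (((hf₃.continuous_coefPairing hr₃).tendsto _).comp hlim).congr' ?_
  filter_upwards [eventually_gt_atTop 1] with a ha
  obtain ⟨h1, h2, h3, h4⟩ := h a ha
  exact (ModularCup.fourfold_eq_coefPairing hr₃ hf₁.holo hf₂ hf₃ ha.le h1 h2 h3 h4).symm
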